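/- Let $d\ge 1$, $p>1$, $\nu>0$, $s\in\{1,-1\}$, and let $$u_t=F(u),\qquad F(u)=\nu\Delta u+\tfrac{s}{p}\,\partial_{x_1}\bigl(|u|^p\bigr)\qquad\text{on }\mathbb R^d$$ ($s=-1$ is the generalized Burgers equation). Let $G=(\mathbb R_{>0}\times SO(d-1))\ltimes\mathbb R^d$ be the Lie group of triples $g=(\alpha,Q,b)$ with $$(\alpha_1,Q_1,b_1)(\alpha_2,Q_2,b_2)=\bigl(\alpha_1\alpha_2,\;Q_1Q_2,\;b_1+\alpha_1^{p-1}\tilde Q_1b_2\bigr),\qquad \tilde Q=\begin{pmatrix}1&0\\0&Q\end{pmatrix},$$ unit $\mathbb 1=(1,I,0)$, Lie algebra $\mathfrak g=\mathbb R\times\mathfrak{so}(d-1)\times\mathbb R^d$, and tangent of left multiplication $T_{\mathbb 1}L_g\mu=(\alpha\mu_1,\,Q\mu_2,\,\alpha^{p-1}\tilde Q\mu_3)$. Put $m(g)=\alpha^{2-2p}$, and let $G$ act on functions by $(a(g)v)(x)=\alpha^{-1}v(\alpha^{1-p}\tilde Q^{\top}(x-b))$. Let either $X=C^0_0(\mathbb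 R^d)$ (continuous functions vanishing at infinity) and $Y=C^2_0(\mathbb R^d)$ (functions in $C^2(\mathbb R^d)$ all of whose derivatives of order $\le 2$ vanish at infinity), or $X=L^2(\mathbb R^d)$ and $Y=H^2(\mathbb R^d)$ (real-valued functions). For $v\in X$ and $\mu\in\mathfrak g$ let $T_{\mathbb 1}a\,v[\mu]=\lim_{t\to0}\frac1t\bigl(a(\exp(t\mu))v-v\bigr)$, if this limit exists in $X$, and let $Y_1=\{v\in Y: T_{\mathbb 1}a\,v[\mu]\text{ exists in }X\text{ for all }\mu\in\mathfrak g\}$, with norm $\|v\|_Y$ plus the sum of $\|T_{\mathbb 1}a\,v[\epsilon]\|_X$ over a finite spanning family of $\epsilon\in\mathfrak g$. Equations for $u$ and $v$ hold at every time as equalities in $X$. In the case $X=L^2$ derivatives in $x$ are weak, and $F(v)$ is understood to be defined at $v\in H^2$ when $|v|^p$ is locally integrable and $F(v)\in L^2$. Derivatives in time are one-sided at the time $0$. **Theorem.** Let $\hat T\in(0,\infty]$ and $\mu\in C([0,\hat T);\mathfrak g)$. There is a solution $g\in C^1([0,\hat T);G)$ of $$g'(\tau)=T_{\mathbb 1}L_{g(\tau)}\mu(\tau),\qquad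 g(0)=\mathbb 1,$$ and every $C^1$ solution on an interval $J$ with $0\in J\subseteq[0,\hat T)$ is a restriction of it. There are $T\in(0,\infty]$ and a solution $\sigma\in C^1([0,T);[0,\hat T))$ of $$\dot\sigma(t)=m\bigl(g(\sigma(t))\bigr),\qquad \sigma(0)=0,$$ such that every $C^1$ solution on an interval $J$ with $0\in J\subseteq[0,\infty)$ and values in $[0,\hat T)$ is a restriction of $\sigma$ (in particular $J\subseteq[0,T)$). The map $\sigma:[0,T)\to[0,\hat T)$ is a $C^1$ diffeomorphism. Moreover, in both cases for $(X,Y_1)$ and for every $u_0\in Y_1$: (i) If $u\in C([0,T);Y_1)\cap C^1([0,T);X)$ solves $u_t=F(u)$, $u(0)=u_0$, then $v(\tau)=a(g(\tau)^{-1})\,u(\sigma^{-1}(\tau))$ belongs to $C([0,\hat T);Y_1)\cap C^1([0,\hat T);X)$ and solves $$v_\tau=F(v)-T_{\mathbb 1}a\,v[\mu],\qquad v(0)=u_0.$$ (ii) If $v\in C([0,\hat T);Y_1)\cap C^1([0,\hat T);X)$ solves $v_\tau=F(v)-T_{\mathbb 1}a\,v[\mu]$, $v(0)=u_0$, then $u(t)=a(g(\sigma(t)))\,v(\sigma(t))$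 belongs to $C([0,T);Y_1)\cap C^1([0,T);X)$ and solves $u_t=F(u)$, $u(0)=u_0$. -/

import Mathlib

open MeasureTheory Filter Topology Set
open scoped ContDiff ZeroAtInfty ENNReal Laplacian

noncomputable section

namespace BurgersFreezing

/-- The space `ℝ^d` with `d = n + 1 ≥ 1`, with its Euclidean norm.  The first coordinate has
index `0`. -/
abbrev Eu (n : ℕ) : Type := EuclideanSpace ℝ (Fin (n + 1))

/-- The `j`-th standard basis vector of `ℝ^d`. -/
abbrev eb {n : ℕ} (j : Fin (n + 1)) : Eu n := EuclideanSpace.single j (1 : ℝ)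

/-! ### The symmetry group -/

/-- The block diagonal matrix with blocks `c` (of size one) and `A`. -/
def aug {n : ℕ} (c : ℝ) (A : Matrix (Fin n) (Fin n) ℝ) :
    Matrix (Fin (n + 1)) (Fin (n + 1)) ℝ :=
  Matrix.of fun i j =>
    Fin.cases (motive := fun _ => ℝ) (Fin.cases (motive := fun _ => ℝ) c (fun _ => 0) j)
      (fun i' => Fin.cases (motive := fun _ => ℝ) 0 (fun j' => A i' j') j) i

lemma aug_mul {n : ℕ} (c c' : ℝ) (A B : Matrix (Fin n) (Fin n) ℝ) :
    aug c A * aug c' B = aug (c * c') (A * B) := by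
  ext i j
  rw [Matrix.mul_apply, Fin.sum_univ_succ]
  refine Fin.cases ?_ (fun i => ?_) i <;> refine Fin.cases ?_ (fun j => ?_) j <;>
    simp [aug, Matrix.mul_apply]

lemma aug_one {n : ℕ} : aug 1 (1 : Matrix (Fin n) (Fin n) ℝ) = 1 := by
  ext i j
  refine Fin.cases ?_ (fun i => ?_) i <;> refine Fin.cases ?_ (fun j => ?_) j <;>
    simp [aug, Matrix.one_apply, Fin.succ_ne_zero, (Fin.succ_ne_zero _).symm]

/-- A matrix as an operator on `ℝ^d`. -/
abbrev opr {n : ℕ} (M : Matrix (Fin (n + 1)) (Fin (n + 1)) ℝ) : Eu n →L[ℝ] Eu n :=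
  Matrix.toEuclideanCLM (𝕜 := ℝ) M

/-- The group `G = (ℝ_{>0} × SO(d-1)) ⋉ ℝ^d`: elements are triples `(α, Q, b)`.  The parameter `p`
enters through the group law below. -/
@[ext] structure SimGroup (n : ℕ) (p : ℝ) where
  /-- the scaling component `α` -/
  scale : ℝ
  /-- the rotation component `Q` -/
  rot : Matrix.specialOrthogonalGroup (Fin n) ℝ
  /-- the translation component `b` -/
  trans : Eu n
  /-- `α` is positive -/
  scale_pos : 0 < scale

/-- The Lie algebra `ℝ × so(d-1) × ℝ^d`. -/
abbrev SimAlg (n : ℕ) : Type := ℝ × LieAlgebra.Orthogonal.so (Fin n) ℝ × Eu n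

namespace SimGroup

variable {n : ℕ} {p : ℝ}

/-- The augmented rotation `diag(1, Q)`. -/
def aQ (g : SimGroup n p) : Matrix (Fin (n + 1)) (Fin (n + 1)) ℝ :=
  aug 1 (g.rot : Matrix (Fin n) (Fin n) ℝ)

/-- The augmented inverse rotation `diag(1, Q⁻¹) = diag(1, Qᵀ)`. -/
def aQinv (g : SimGroup n p) : Matrix (Fin (n + 1)) (Fin (n + 1)) ℝ :=
  aug 1 ((g.rot⁻¹ : Matrix.specialOrthogonalGroup (Fin n) ℝ) : Matrix (Fin n) (Fin n) ℝ)

lemma aQ_mul_aQinv (g : SimGroup n p) : g.aQ * g.aQinv = 1 := by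
  rw [aQ, aQinv, aug_mul, ← Submonoid.coe_mul]
  simp [aug_one]

lemma aQinv_mul_aQ (g : SimGroup n p) : g.aQinv * g.aQ = 1 := by
  rw [aQ, aQinv, aug_mul, ← Submonoid.coe_mul]
  simp [aug_one]

/-- `(α₁, Q₁, b₁) (α₂, Q₂, b₂) = (α₁ α₂, Q₁ Q₂, b₁ + α₁ ^ (p - 1) diag(1, Q₁) b₂)`. -/
instance : Mul (SimGroup n p) where
  mul g h := ⟨g.scale * h.scale, g.rot * h.rot,
    g.trans + g.scale ^ (p - 1) • opr g.aQ h.trans, mul_pos g.scale_pos h.scale_pos⟩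

instance : One (SimGroup n p) where
  one := ⟨1, 1, 0, one_pos⟩

instance : Inv (SimGroup n p) where
  inv g := ⟨g.scale⁻¹, g.rot⁻¹, -(g.scale ^ (1 - p) • opr g.aQinv g.trans),
    inv_pos.mpr g.scale_pos⟩

@[simp] lemma mul_scale (g h : SimGroup n p) : (g * h).scale = g.scale * h.scale := rfl
@[simp] lemma mul_rot (g h : SimGroup n p) : (g * h).rot = g.rot * h.rot := rfl
@[simp] lemma mul_trans (g h : SimGroup n p) :
    (g * h).trans = g.trans + g.scale ^ (p - 1) • opr g.aQ h.trans := rfl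
@[simp] lemma one_scale : (1 : SimGroup n p).scale = 1 := rfl
@[simp] lemma one_rot : (1 : SimGroup n p).rot = 1 := rfl
@[simp] lemma one_trans : (1 : SimGroup n p).trans = 0 := rfl
@[simp] lemma inv_scale (g : SimGroup n p) : (g⁻¹).scale = g.scale⁻¹ := rfl
@[simp] lemma inv_rot (g : SimGroup n p) : (g⁻¹).rot = g.rot⁻¹ := rfl
@[simp] lemma inv_trans (g : SimGroup n p) :
    (g⁻¹).trans = -(g.scale ^ (1 - p) • opr g.aQinv g.trans) := rfl

lemma aQ_mul (g h : SimGroup n p) : (g * h).aQ = g.aQ * h.aQ := by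
  simp [aQ, aug_mul]

lemma aQ_one : (1 : SimGroup n p).aQ = 1 := by simp [aQ, aug_one]

instance : Group (SimGroup n p) :=
  Group.ofLeftAxioms
    (fun g h k => by
      ext1
      · simp [mul_assoc]
      · simp [mul_assoc]
      · simp only [mul_trans, mul_scale, aQ_mul, map_add, map_smul, map_mul, smul_add, smul_smul,
          mul_apply_eq_comp, Real.mul_rpow g.scale_pos.le h.scale_pos.le, add_assoc])
    (fun g => by
      ext1
      · simp
      · simp
      · simp [aQ_one])
    (fun g => by
      ext1
      · simp [g.scale_pos.ne']
      · simp
      · have h : (g.scale⁻¹) ^ (p - 1) = g.scale ^ (1 - p) := by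
          rw [Real.inv_rpow g.scale_pos.le, ← Real.rpow_neg g.scale_pos.le]; ring_nf
        simp [h, aQ, aQinv])

/-- The homomorphism `m(α, Q, b) = α ^ (2 - 2 p)`. -/
def mfac (g : SimGroup n p) : ℝ := g.scale ^ (2 - 2 * p)

/-- The linear part `x ↦ α ^ (1 - p) diag(1, Q)ᵀ x` of the coordinate change in the action. -/
def lin (g : SimGroup n p) : Eu n ≃L[ℝ] Eu n :=
  ContinuousLinearEquiv.equivOfInverse
    (g.scale ^ (1 - p) • opr g.aQinv) (g.scale ^ (p - 1) • opr g.aQ)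
    (fun x => by
      have h : g.scale ^ (p - 1) * g.scale ^ (1 - p) = 1 := by
        rw [← Real.rpow_add g.scale_pos]; simp
      have h2 : opr g.aQ (opr g.aQinv x) = x := by
        rw [← mul_apply_eq_comp, ← map_mul, aQ_mul_aQinv]; simp
      change g.scale ^ (p - 1) • opr g.aQ (g.scale ^ (1 - p) • opr g.aQinv x) = x
      rw [map_smul, smul_smul, h, h2, one_smul])
    (fun x => by
      have h : g.scale ^ (1 - p) * g.scale ^ (p - 1) = 1 := by
        rw [← Real.rpow_add g.scale_pos]; simp
      have h2 : opr g.aQinv (opr g.aQ x) = x := by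
        rw [← mul_apply_eq_comp, ← map_mul, aQinv_mul_aQ]; simp
      change g.scale ^ (1 - p) • opr g.aQinv (g.scale ^ (p - 1) • opr g.aQ x) = x
      rw [map_smul, smul_smul, h, h2, one_smul])

/-- The coordinate change `x ↦ α ^ (1 - p) diag(1, Q)ᵀ (x - b)`. -/
def pull (g : SimGroup n p) : Eu n ≃ₜ Eu n :=
  (Homeomorph.subRight g.trans).trans g.lin.toHomeomorph

lemma pull_apply (g : SimGroup n p) (x : Eu n) :
    g.pull x = g.scale ^ (1 - p) • opr g.aQinv (x - g.trans) := rfl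

/-- The action `(a(g) v)(x) = α⁻¹ v(α ^ (1 - p) diag(1, Q)ᵀ (x - b))` on functions. -/
def actFun (g : SimGroup n p) (v : Eu n → ℝ) : Eu n → ℝ := fun x => g.scale⁻¹ * v (g.pull x)

/-- The group law is the one for which `a` is a left action. -/
lemma actFun_mul (g h : SimGroup n p) (v : Eu n → ℝ) :
    (g * h).actFun v = g.actFun (h.actFun v) := by
  funext x
  have e : (g * h).pull x = h.pull (g.pull x) := by
    have hh : (g * h).aQinv = h.aQinv * g.aQinv := by simp [aQinv, aug_mul]
    have h1 : opr g.aQinv (opr g.aQ h.trans) = h.trans := by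
      rw [← mul_apply_eq_comp, ← map_mul, aQinv_mul_aQ]; simp
    have h2 : g.scale ^ (1 - p) * g.scale ^ (p - 1) = 1 := by
      rw [← Real.rpow_add g.scale_pos]; simp
    simp only [pull_apply, hh, mul_trans, mul_scale, map_mul, mul_apply_eq_comp,
      Real.mul_rpow g.scale_pos.le h.scale_pos.le, ← sub_sub, map_sub, map_smul, h1, smul_sub,
      smul_smul]
    rw [mul_comm (h.scale ^ (1 - p)), mul_assoc (g.scale ^ (1 - p)),
      mul_comm (h.scale ^ (1 - p)), ← mul_assoc, h2, one_mul]
  simp only [actFun, e, mul_scale, mul_inv]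
  ring

/-- The exponential map of `G`: for `μ = (c, S, w)` it is
`(exp c, exp S, ∑_k ((p - 1) c I + diag(0, S)) ^ k w / (k + 1)!)`, the value at time `1` of the
solution of `g' = T₁L_g μ`, `g(0) = 1` with constant `μ`. -/
def gexp (p : ℝ) (μ : SimAlg n) : SimGroup n p where
  scale := Real.exp μ.1
  rot := ⟨NormedSpace.exp (μ.2.1 : Matrix (Fin n) (Fin n) ℝ), by
    have key : ∀ B : Matrix (Fin n) (Fin n) ℝ, B.transpose = -B →
        NormedSpace.exp B ∈ Matrix.orthogonalGroup (Fin n) ℝ := by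
      intro B hB
      rw [Matrix.mem_orthogonalGroup_iff, ← Matrix.exp_transpose, hB,
        ← Matrix.exp_add_of_commute _ _ (Commute.neg_right (Commute.refl B))]
      simp
    have hS := (LieAlgebra.Orthogonal.mem_so (n := Fin n) (R := ℝ) _).mp μ.2.1.2
    refine Matrix.mem_specialOrthogonalGroup_iff.mpr ⟨key _ hS, ?_⟩
    set S : Matrix (Fin n) (Fin n) ℝ := μ.2.1.1 with hSdef
    have hB : ((1 / 2 : ℝ) • S).transpose = -((1 / 2 : ℝ) • S) := by
      rw [Matrix.transpose_smul, hS, smul_neg]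
    have h2 : NormedSpace.exp S
        = NormedSpace.exp ((1 / 2 : ℝ) • S) * NormedSpace.exp ((1 / 2 : ℝ) • S) := by
      rw [← Matrix.exp_add_of_commute _ _ (Commute.refl _), ← add_smul]
      norm_num
    have h3 := (Matrix.mem_orthogonalGroup_iff (Fin n) ℝ).mp (key _ hB)
    have h4 := congrArg Matrix.det h3
    rw [Matrix.det_mul, Matrix.det_transpose, Matrix.det_one] at h4
    rw [h2, Matrix.det_mul, h4]⟩
  trans := ∑' k : ℕ, ((k + 1).factorial : ℝ)⁻¹ •
    ((((p - 1) * μ.1) • (1 : Eu n →L[ℝ] Eu n) + opr (aug 0 (μ.2.1 : Matrix (Fin n) (Fin n) ℝ))) ^ k)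
      μ.2.2
  scale_pos := Real.exp_pos _

end SimGroup

open SimGroup

/-! ### Time intervals and the reconstruction equations -/

/-- The interval `[0, T)` for `T ∈ [-∞, ∞]`. -/
def tI (T : EReal) : Set ℝ := {t | 0 ≤ t ∧ (t : EReal) < T}

/-- Intervals in `[0, ∞)` that contain `0`. -/
def IsInitialInterval (J : Set ℝ) : Prop := (0 : ℝ) ∈ J ∧ J ⊆ Ici 0 ∧ J.OrdConnected

/-- `f` is continuously differentiable on the interval `J` with derivative `f'` (one-sided at
endpoints). -/
def IsC1With {X : Type} [NormedAddCommGroup X] [NormedSpace ℝ X] (f f' : ℝ → X) (J : Set ℝ) :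
    Prop :=
  (∀ t ∈ J, HasDerivWithinAt f (f' t) J t) ∧ ContinuousOn f' J

/-- `g` is a `C¹` solution on the interval `J` of `g' = T₁L_g μ`, `g(0) = 1`, where
`T₁L_g μ = (α μ₁, Q μ₂, α ^ (p - 1) diag(1, Q) μ₃)` for `g = (α, Q, b)`.  Derivatives of curves in
`G` are taken in the ambient space `ℝ × ℝ^{(d-1)×(d-1)} × ℝ^d`. -/
def SolvesGroupODE {n : ℕ} {p : ℝ} (μ : ℝ → SimAlg n) (g : ℝ → SimGroup n p) (J : Set ℝ) : Prop :=
  g 0 = 1 ∧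
  IsC1With (fun τ => (g τ).scale) (fun τ => (g τ).scale * (μ τ).1) J ∧
  (∀ i j, IsC1With (fun τ => ((g τ).rot : Matrix (Fin n) (Fin n) ℝ) i j)
    (fun τ => (((g τ).rot : Matrix (Fin n) (Fin n) ℝ) *
      ((μ τ).2.1 : Matrix (Fin n) (Fin n) ℝ)) i j) J) ∧
  IsC1With (fun τ => (g τ).trans)
    (fun τ => (g τ).scale ^ (p - 1) • opr (g τ).aQ (μ τ).2.2) J

/-- `σ : J → [0, T̂)` is a `C¹` solution of `σ' = m(g(σ))`, `σ(0) = 0`. -/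
def SolvesTimeODE {n : ℕ} {p : ℝ} (That : EReal) (g : ℝ → SimGroup n p) (σ : ℝ → ℝ) (J : Set ℝ) :
    Prop :=
  σ 0 = 0 ∧ MapsTo σ J (tI That) ∧ IsC1With σ (fun t => mfac (g (σ t))) J

/-! ### Generators of an action and the scaled spaces -/

section Action

variable {n : ℕ} {p : ℝ} {X : Type} [NormedAddCommGroup X] [NormedSpace ℝ X]

/-- `w = T₁a v[μ]`, i.e. `w` is the limit in `X` of `(a(exp(t μ)) v - v) / t` as `t → 0`. -/
def IsGen (act : SimGroup n p → X → X) (v : X) (μ : SimAlg n) (w : X) : Prop :=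
  Tendsto (fun t : ℝ => t⁻¹ • (act (gexp p (t • μ)) v - v)) (𝓝[≠] 0) (𝓝 w)

/-- The value `T₁a v[μ]` (meaningful when the limit exists). -/
def gen (act : SimGroup n p → X → X) (v : X) (μ : SimAlg n) : X :=
  limUnder (𝓝[≠] 0) (fun t : ℝ => t⁻¹ • (act (gexp p (t • μ)) v - v))

/-- The rotation generator `E_ij - E_ji` in `so(d-1)`. -/
def soBasis (i j : Fin n) : LieAlgebra.Orthogonal.so (Fin n) ℝ :=
  ⟨Matrix.single i j 1 - Matrix.single j i 1, by
    rw [LieAlgebra.Orthogonal.mem_so]; simp [Matrix.transpose_sub]⟩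

/-- From a space `Y = {v ∈ X : mem v}` of twice differentiable functions, the subspace of those `v`
for which `T₁a v[μ]` exists in `X` for all `μ`. -/
def MemScal (act : SimGroup n p → X → X) (mem : X → Prop) (v : X) : Prop :=
  mem v ∧ ∀ μ : SimAlg n, ∃ w : X, IsGen act v μ w

/-- The norm of the scaled space: the norm of `Y` plus the `X`-norms of `T₁a v[ε]`, where `ε` runs
through a spanning family of the Lie algebra. -/
def scalNorm (act : SimGroup n p → X → X) (N : X → ℝ) (v : X) : ℝ :=
  N v + ‖gen act v (1, 0, 0)‖ + (∑ i : Fin n, ∑ j : Fin n, ‖gen act v (0, soBasis i j, 0)‖)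
    + ∑ i : Fin (n + 1), ‖gen act v (0, 0, eb i)‖

/-- `u ∈ C(J; Y₁)`, where `Y₁ = {v ∈ X : MemScal act mem v}` carries the norm
`scalNorm act N`. -/
def ContIntoScal (act : SimGroup n p → X → X) (mem : X → Prop) (N : X → ℝ) (u : ℝ → X)
    (J : Set ℝ) : Prop :=
  (∀ t ∈ J, MemScal act mem (u t)) ∧
  ∀ t ∈ J, Tendsto (fun s => scalNorm act N (u s - u t)) (𝓝[J] t) (𝓝 0)

/-- `u ∈ C([0,T); Y₁) ∩ C¹([0,T); X)` solves `u_t = F(u)`, `u(0) = u₀`; here `isF v f` says that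
`f ∈ X` is the value `F(v)`. -/
def SolvesOriginal (act : SimGroup n p → X → X) (mem : X → Prop) (N : X → ℝ)
    (isF : X → X → Prop) (u₀ : X) (T : EReal) (u : ℝ → X) : Prop :=
  ContIntoScal act mem N u (tI T) ∧ u 0 = u₀ ∧
  ∃ u' : ℝ → X, IsC1With u u' (tI T) ∧ ∀ t ∈ tI T, isF (u t) (u' t)

/-- `v ∈ C([0,T̂); Y₁) ∩ C¹([0,T̂); X)` solves `v_τ = F(v) - T₁a v[μ]`, `v(0) = u₀`. -/
def SolvesComoving (act : SimGroup n p → X → X) (mem : X → Prop) (N : X → ℝ)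
    (isF : X → X → Prop) (μ : ℝ → SimAlg n) (u₀ : X) (That : EReal) (v : ℝ → X) : Prop :=
  ContIntoScal act mem N v (tI That) ∧ v 0 = u₀ ∧
  ∃ v' : ℝ → X, IsC1With v v' (tI That) ∧
    ∀ τ ∈ tI That, ∃ f w : X, isF (v τ) f ∧ IsGen act (v τ) (μ τ) w ∧ v' τ = f - w

end Action

/-! ### The case `X = C₀⁰(ℝ^d)`, `Y = C₀²(ℝ^d)` -/

/-- The space `C₀⁰(ℝ^d)` with the supremum norm. -/
abbrev XC (n : ℕ) : Type := C₀(Eu n, ℝ)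

/-- The action on `C₀⁰(ℝ^d)`. -/
def actC {n : ℕ} {p : ℝ} (g : SimGroup n p) (v : XC n) : XC n where
  toFun := g.actFun v
  continuous_toFun := continuous_const.mul (v.continuous.comp g.pull.continuous)
  zero_at_infty' := by
    have h := (v.zero_at_infty'.comp g.pull.isClosedEmbedding.tendsto_cocompact).const_mul
      g.scale⁻¹
    rw [mul_zero] at h
    exact h

/-- Membership in `C₀²(ℝ^d)`: twice continuously differentiable, and all derivatives up to order
two vanish at infinity. -/
def MemC2 {n : ℕ} (v : XC n) : Prop :=
  ContDiff ℝ 2 v ∧ ∀ k ≤ 2, Tendsto (fun x => iteratedFDeriv ℝ k v x) (cocompact (Eu n)) (𝓝 0)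

/-- The `C²`-norm: the sum of the supremum norms of the derivatives up to order two. -/
def normC2 {n : ℕ} (v : XC n) : ℝ :=
  ∑ k ∈ Finset.range 3, ⨆ x, ‖iteratedFDeriv ℝ k v x‖

/-- `f = F(v)` for `F(v) = ν Δv + (s/p) ∂₁(|v|^p)`, with classical derivatives. -/
def IsFC {n : ℕ} (p ν s : ℝ) (v f : XC n) : Prop :=
  ∀ x, f x = ν * Δ (v : Eu n → ℝ) x + s / p * lineDeriv ℝ (fun y => |v y| ^ p) x (eb 0)

/-! ### The case `X = L²(ℝ^d)`, `Y = H²(ℝ^d)` -/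

/-- The space `L²(ℝ^d)` of real functions. -/
abbrev XL (n : ℕ) : Type := Lp ℝ 2 (volume : Measure (Eu n))

lemma memLp_actFun {n : ℕ} {p : ℝ} (g : SimGroup n p) (v : XL n) :
    MemLp (g.actFun v) 2 (volume : Measure (Eu n)) := by
  have hsub : MeasurePreserving (fun x : Eu n => x - g.trans) volume volume :=
    measurePreserving_sub_right volume g.trans
  have hdet : LinearMap.det (g.lin.toLinearEquiv : Eu n →ₗ[ℝ] Eu n) ≠ 0 :=
    (LinearEquiv.isUnit_det' g.lin.toLinearEquiv).ne_zero
  have hmap := Measure.map_linearMap_addHaar_eq_smul_addHaar (volume : Measure (Eu n)) hdet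
  have h1 : MemLp v 2 (Measure.map g.lin (volume : Measure (Eu n))) := by
    have : Measure.map g.lin (volume : Measure (Eu n)) = _ := hmap
    rw [this]
    exact (Lp.memLp v).smul_measure ENNReal.ofReal_ne_top
  have h2 : MemLp (v ∘ g.lin) 2 (volume : Measure (Eu n)) :=
    h1.comp_of_map g.lin.continuous.aemeasurable
  exact (h2.comp_measurePreserving hsub).const_mul g.scale⁻¹

/-- The action on `L²(ℝ^d)`. -/
def actL {n : ℕ} {p : ℝ} (g : SimGroup n p) (v : XL n) : XL n := (memLp_actFun g v).toLp

/-- `w` is the weak partial derivative `∂_j v` of the locally integrable function `v`. -/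
def HasWeakPartial {n : ℕ} (j : Fin (n + 1)) (v w : Eu n → ℝ) : Prop :=
  LocallyIntegrable v volume ∧ LocallyIntegrable w volume ∧
  ∀ φ : Eu n → ℝ, ContDiff ℝ ∞ φ → HasCompactSupport φ →
    ∫ x, v x * fderiv ℝ φ x (eb j) = -∫ x, w x * φ x

open Classical in
/-- The weak partial derivative `∂_j v` in `L²`, if it exists there (and `0` otherwise). -/
def wpd {n : ℕ} (j : Fin (n + 1)) (v : XL n) : XL n :=
  if h : ∃ w : XL n, HasWeakPartial j v w then h.choose else 0

/-- Membership in `H²(ℝ^d)`: the weak partial derivatives of order one and two exist in `L²`. -/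
def MemH2 {n : ℕ} (v : XL n) : Prop :=
  ∃ D : Fin (n + 1) → XL n, ∃ D2 : Fin (n + 1) → Fin (n + 1) → XL n,
    (∀ i, HasWeakPartial i v (D i)) ∧ ∀ i j, HasWeakPartial j (D i) (D2 i j)

/-- The `H²`-norm. -/
def normH2 {n : ℕ} (v : XL n) : ℝ :=
  √(‖v‖ ^ 2 + ∑ i, ‖wpd i v‖ ^ 2 + ∑ i, ∑ j, ‖wpd j (wpd i v)‖ ^ 2)

/-- `f = F(v)` for `F(v) = ν Δv + (s/p) ∂₁(|v|^p)`, with weak derivatives, as an equality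
in `L²`. -/
def IsFL {n : ℕ} (p ν s : ℝ) (v f : XL n) : Prop :=
  ∃ h : Eu n → ℝ, HasWeakPartial 0 (fun x => |v x| ^ p) h ∧
    f =ᵐ[volume] fun x => ν * ∑ i, wpd i (wpd i v) x + s / p * h x

end BurgersFreezing

end

noncomputable section

namespace BurgersFreezing

/-! ### Calculus on the intervals `[0, T)` -/

/-! The equation is equivariant. The coordinate change in a(g) is a similarity with ratio α^(1-p)
whose linear part sends e₁ to a multiple of itself, so F(a(g)v) = m(g) a(g)F(v). Granted this, the
theorem is a product rule: along g' = T₁L_g μ the action satisfies (a(g)v)' = a(g) T₁a v[μ] for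
fixed v. Passing between u and v therefore creates exactly the term T₁a v[μ], and the factor m(g) is
absorbed by the time change σ' = m(g(σ)).

The difficulty is that T₁a v[μ] is only a limit along the one-parameter groups exp(tμ), whereas g is
a general curve. Neither linearity in μ nor existence at a(g)v is evident. Duality settles both. On
test functions the dual action `coact` is differentiable along curves, and its derivative is the
explicit first-order operator `adjGen`, which is linear in μ (`hasDerivAt_pairing`). If the
resulting weak generators W(s) lie in X and depend continuously on s, integrating the pairings
yields a(γ(τ))v = a(γ(a))v + ∫ a(γ)W in X, so a(γ)v is differentiable in norm
(`hasDerivWithinAt_act`). Hence weak and strong generators agree (`isGen_of_weakGen`,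
`weakGen_of_isGen`), they are linear in μ (`gen_eq_expand`), and T₁a(a(g)v)[μ] = a(g) T₁a
v[Ad(g⁻¹)μ] (`isGen_act`). It follows that Y₁ is invariant and that a preserves continuity into Y₁
(`contIntoScal_act`). `IsEquivariantSetting` collects what this needs from X, Y and F; it is
verified separately for C₀ and L².

The group equation is triangular: α is an exponential, Q solves a linear equation that conserves
QQᵀ, and b is an integral. The map σ is the inverse of ρ(τ) = ∫₀^τ 1/m(g). -/

lemma exists_gt_mem_tI {T : EReal} {t : ℝ} (ht : t ∈ tI T) : ∃ b, t < b ∧ b ∈ tI T := by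
  obtain ⟨b, hb, hbT⟩ := EReal.lt_iff_exists_real_btwn.mp ht.2
  have : t < b := by exact_mod_cast hb
  exact ⟨b, this, ht.1.trans this.le, hbT⟩

lemma Icc_subset_tI {T : EReal} {b : ℝ} (hb : b ∈ tI T) : Icc 0 b ⊆ tI T := fun _ ht =>
  ⟨ht.1, lt_of_le_of_lt (EReal.coe_le_coe_iff.mpr ht.2) hb.2⟩

lemma zero_mem_tI {T : EReal} (hT : 0 < T) : (0 : ℝ) ∈ tI T := ⟨le_rfl, by exact_mod_cast hT⟩

lemma isInitialInterval_tI {T : EReal} (hT : 0 < T) : IsInitialInterval (tI T) :=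
  ⟨zero_mem_tI hT, fun _ h => h.1, ⟨fun _ hx _ hy _ hz =>
    ⟨hx.1.trans hz.1, lt_of_le_of_lt (EReal.coe_le_coe_iff.mpr hz.2) hy.2⟩⟩⟩

/-- Derivatives within [0, T) at t may be taken within a compact [0, b] with t < b, which transfers
results on compact intervals to half-open ones. -/
lemma nhdsWithin_tI {T : EReal} {t b : ℝ} (htb : t < b) (hb : b ∈ tI T) :
    𝓝[tI T] t = 𝓝[Icc 0 b] t := by
  refine nhdsWithin_eq_nhdsWithin (mem_Iio.mpr htb) isOpen_Iio ?_
  ext x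
  refine ⟨fun h => ⟨⟨h.1.1, h.2.le⟩, h.2⟩, fun h => ⟨Icc_subset_tI hb h.1, h.2⟩⟩

lemma uniqueDiffOn_tI {T : EReal} (hT : 0 < T) : UniqueDiffOn ℝ (tI T) := by
  refine uniqueDiffOn_convex (isInitialInterval_tI hT).2.2.convex ?_
  obtain ⟨b, hb, hbT⟩ := exists_gt_mem_tI (zero_mem_tI hT)
  refine ⟨b / 2, interior_mono (Icc_subset_tI hbT) ?_⟩
  rw [interior_Icc]
  constructor <;> linarith

lemma hasDerivWithinAt_congr_nhds {E : Type*} [NormedAddCommGroup E] [NormedSpace ℝ E]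
    {f : ℝ → E} {f' : E} {s t : Set ℝ} {x : ℝ} (h : 𝓝[s] x = 𝓝[t] x) :
    HasDerivWithinAt f f' s x ↔ HasDerivWithinAt f f' t x :=
  hasDerivWithinAt_congr_set (nhdsWithin_eq_iff_eventuallyEq.mp h)

/-- The fundamental theorem of calculus on a compact interval, with one-sided derivatives at the
endpoints. -/
lemma hasDerivWithinAt_integral_Icc {E : Type*} [NormedAddCommGroup E] [NormedSpace ℝ E]
    [CompleteSpace E] {f : ℝ → E} {a b c t : ℝ} (hf : ContinuousOn f (Icc a b))
    (hc : c ∈ Icc a b) (ht : t ∈ Icc a b) :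
    HasDerivWithinAt (fun u => ∫ x in c..u, f x) (f t) (Icc a b) t := by
  have : Fact (t ∈ Icc a b) := ⟨ht⟩
  refine intervalIntegral.integral_hasDerivWithinAt_right (s := Icc a b) (t := Icc a b) ?_ ?_
    (hf t ht)
  · exact (hf.mono (ordConnected_Icc.uIcc_subset hc ht)).intervalIntegrable
  · exact hf.stronglyMeasurableAtFilter_nhdsWithin measurableSet_Icc t

lemma hasDerivWithinAt_integral_tI {E : Type*} [NormedAddCommGroup E] [NormedSpace ℝ E]
    [CompleteSpace E] {f : ℝ → E} {T : EReal} {t : ℝ} (hf : ContinuousOn f (tI T))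
    (ht : t ∈ tI T) :
    HasDerivWithinAt (fun u => ∫ x in (0 : ℝ)..u, f x) (f t) (tI T) t := by
  obtain ⟨b, htb, hb⟩ := exists_gt_mem_tI ht
  rw [hasDerivWithinAt_congr_nhds (nhdsWithin_tI htb hb)]
  exact hasDerivWithinAt_integral_Icc (hf.mono (Icc_subset_tI hb)) ⟨le_rfl, hb.1⟩ ⟨ht.1, htb.le⟩

/-- Each uniqueness proof below exhibits a quotient, product or difference with zero derivative and
ends here. -/
lemma eq_of_hasDerivWithinAt_zero {E : Type*} [NormedAddCommGroup E] [NormedSpace ℝ E]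
    {f : ℝ → E} {J : Set ℝ} (hJ : J.OrdConnected) (hf : ∀ t ∈ J, HasDerivWithinAt f 0 J t)
    {s t : ℝ} (hs : s ∈ J) (ht : t ∈ J) : f t = f s := by
  have := Convex.norm_image_sub_le_of_norm_hasDerivWithin_le (C := 0) hf (by simp) hJ.convex hs ht
  rw [zero_mul] at this
  exact sub_eq_zero.mp (norm_le_zero_iff.mp this)

/-! ### Rotations -/

/-- `R' = R S` on `J`, entrywise. -/
def SolvesRot {n : ℕ} (S : ℝ → Matrix (Fin n) (Fin n) ℝ) (R : ℝ → Matrix (Fin n) (Fin n) ℝ)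
    (J : Set ℝ) : Prop :=
  ∀ t ∈ J, ∀ i j, HasDerivWithinAt (fun τ => R τ i j) ((R t * S t) i j) J t

/-- Skew-symmetry cancels the two terms of the product rule: R S R'ᵀ + R Sᵀ R'ᵀ = 0. With R = R'
this is conservation of orthogonality, with two solutions it is uniqueness. -/
lemma SolvesRot.hasDerivWithinAt_mul_transpose {n : ℕ} {S R R' : ℝ → Matrix (Fin n) (Fin n) ℝ}
    {J : Set ℝ} (hS : ∀ t, (S t).transpose = -S t) (hR : SolvesRot S R J) (hR' : SolvesRot S R' J)
    {t : ℝ} (ht : t ∈ J) (i j : Fin n) :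
    HasDerivWithinAt (fun τ => (R τ * (R' τ).transpose) i j) 0 J t := by
  have h : ∀ k ∈ Finset.univ, HasDerivWithinAt (fun τ => R τ i k * R' τ j k)
      ((R t * S t) i k * R' t j k + R t i k * (R' t * S t) j k) J t :=
    fun k _ => (hR t ht i k).mul (hR' t ht j k)
  have h2 := HasDerivWithinAt.fun_sum h
  have e : ∑ k, ((R t * S t) i k * R' t j k + R t i k * (R' t * S t) j k) = 0 := by
    have : ((R t * S t) * (R' t).transpose + R t * (R' t * S t).transpose) i j = 0 := by
      rw [Matrix.transpose_mul, hS t, Matrix.mul_assoc]; simp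
    rw [Matrix.add_apply, Matrix.mul_apply, Matrix.mul_apply, ← Finset.sum_add_distrib] at this
    exact this
  rw [e] at h2
  exact h2

lemma SolvesRot.unique {n : ℕ} {S R R' : ℝ → Matrix (Fin n) (Fin n) ℝ}
    {J : Set ℝ} (hJ : J.OrdConnected) (h0 : (0 : ℝ) ∈ J) (hS : ∀ t, (S t).transpose = -S t)
    (hR : SolvesRot S R J) (hR' : SolvesRot S R' J) (hR0 : R 0 = 1) (hR0' : R' 0 = 1)
    (hO : ∀ t, R' t ∈ Matrix.orthogonalGroup (Fin n) ℝ) : EqOn R R' J := by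
  intro t ht
  have h : R t * (R' t).transpose = 1 := by
    ext i j
    have := eq_of_hasDerivWithinAt_zero hJ
      (fun s hs => hR.hasDerivWithinAt_mul_transpose hS hR' hs i j) h0 ht
    rw [this, hR0, hR0']; simp
  have h2 := (Matrix.mem_orthogonalGroup_iff' (Fin n) ℝ).mp (hO t)
  calc R t = R t * ((R' t).transpose * R' t) := by
        rw [show (R' t).transpose * R' t = 1 from h2, mul_one]
    _ = R' t := by rw [← mul_assoc, h, one_mul]

/-- Truncation of a real number to `[-2, 2]`. -/
def clampTwo (x : ℝ) : ℝ := max (-2) (min 2 x)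

lemma abs_clampTwo_le (x : ℝ) : |clampTwo x| ≤ 2 := by
  rw [abs_le, clampTwo]
  exact ⟨le_max_left _ _, max_le (by norm_num) (min_le_left _ _)⟩

lemma abs_clampTwo_sub_le (x y : ℝ) : |clampTwo x - clampTwo y| ≤ |x - y| := by
  have h1 := abs_max_sub_max_le_max (-2) (min 2 x) (-2) (min 2 y)
  have h2 := abs_min_sub_min_le_max 2 x 2 y
  rw [sub_self, abs_zero, max_eq_right (abs_nonneg (min 2 x - min 2 y))] at h1
  rw [sub_self, abs_zero, max_eq_right (abs_nonneg (x - y))] at h2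
  exact h1.trans h2

lemma clampTwo_eq {x : ℝ} (h : |x| < 2) : clampTwo x = x := by
  rw [abs_lt] at h
  rw [clampTwo, min_eq_right h.2.le, max_eq_right h.1.le]

lemma abs_entry_le_one {n : ℕ} {Q : Matrix (Fin n) (Fin n) ℝ} (h : Q * Q.transpose = 1)
    (i j : Fin n) : |Q i j| ≤ 1 := by
  have h1 : ∑ k, Q i k * Q i k = 1 := by
    have := congrFun (congrFun h i) i
    rwa [Matrix.mul_apply, Matrix.one_apply_eq] at this
  rw [← sq_le_one_iff_abs_le_one, sq, ← h1]
  exact Finset.single_le_sum (f := fun k => Q i k * Q i k) (fun k _ => mul_self_nonneg _)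
    (Finset.mem_univ j)

/-- The truncated rotation equation has a solution on a compact interval. -/
lemma exists_solution_clamped {n : ℕ} {b : ℝ} (hb : 0 ≤ b) (S : ℝ → Matrix (Fin n) (Fin n) ℝ)
    (hS : ∀ i j, ContinuousOn (fun t => S t i j) (Icc 0 b)) :
    ∃ q : ℝ → Fin n → Fin n → ℝ, q 0 = (1 : Matrix (Fin n) (Fin n) ℝ) ∧ ∀ t ∈ Icc 0 b,
      HasDerivWithinAt q (fun i j => ∑ k, clampTwo (q t i k) * S t k j) (Icc 0 b) t := by
  have hbd : ∃ C : NNReal, ∀ t ∈ Icc 0 b, ∀ i j, |S t i j| ≤ C := by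
    have h1 : ∀ i j, ∃ C, ∀ t ∈ Icc 0 b, ‖S t i j‖ ≤ C := fun i j =>
      isCompact_Icc.exists_bound_of_continuousOn (hS i j)
    choose C hC using h1
    have hC0 : ∀ i j, 0 ≤ C i j := fun i j => (norm_nonneg _).trans (hC i j 0 ⟨le_rfl, hb⟩)
    refine ⟨⟨∑ i, ∑ j, C i j, Finset.sum_nonneg fun i _ => Finset.sum_nonneg fun j _ => hC0 i j⟩,
      fun t ht i j => (hC i j t ht).trans ?_⟩
    calc C i j ≤ ∑ j, C i j := Finset.single_le_sum (fun j _ => hC0 i j) (Finset.mem_univ j)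
      _ ≤ ∑ i, ∑ j, C i j := Finset.single_le_sum (f := fun i => ∑ j, C i j)
          (fun i _ => Finset.sum_nonneg fun j _ => hC0 i j) (Finset.mem_univ i)
  obtain ⟨C, hC⟩ := hbd
  let f : ℝ → (Fin n → Fin n → ℝ) → (Fin n → Fin n → ℝ) :=
    fun t q i j => ∑ k, clampTwo (q i k) * S t k j
  let x₀ : Fin n → Fin n → ℝ := (1 : Matrix (Fin n) (Fin n) ℝ)
  -- Truncation bounds the field by 2nC on the whole space, so the radius 2nC·b suffices for all of
  -- [0, b] in one application; the last condition holds with equality.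
  have hPL : IsPicardLindelof f (tmin := 0) (tmax := b) ⟨0, le_rfl, hb⟩ x₀
      (n * (2 * C) * ⟨b, hb⟩) 0 (n * (2 * C)) (n * C) := by
    refine ⟨fun t ht => ?_, fun x _ => ?_, fun t ht x _ => ?_, ?_⟩
    · refine (LipschitzWith.of_dist_le_mul fun q q' => ?_).lipschitzOnWith
      rw [dist_pi_le_iff (by positivity)]
      intro i
      rw [dist_pi_le_iff (by positivity)]
      intro j
      rw [Real.dist_eq, ← Finset.sum_sub_distrib]
      calc |∑ k, (clampTwo (q i k) * S t k j - clampTwo (q' i k) * S t k j)|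
          ≤ ∑ k : Fin n, |clampTwo (q i k) * S t k j - clampTwo (q' i k) * S t k j| :=
            Finset.abs_sum_le_sum_abs _ _
        _ ≤ ∑ _k : Fin n, C * dist q q' := by
            refine Finset.sum_le_sum fun k _ => ?_
            rw [← sub_mul, abs_mul, mul_comm]
            refine mul_le_mul (hC t ht k j) ((abs_clampTwo_sub_le _ _).trans ?_) (abs_nonneg _)
              C.2
            exact (dist_le_pi_dist (q i) (q' i) k).trans (dist_le_pi_dist q q' i)
        _ = _ := by simp [mul_assoc]
    · refine continuousOn_pi.mpr fun i => continuousOn_pi.mpr fun j => ?_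
      exact continuousOn_finsetSum _ fun k _ => continuousOn_const.mul (hS k j)
    · rw [pi_norm_le_iff_of_nonneg (by positivity)]
      intro i
      rw [pi_norm_le_iff_of_nonneg (by positivity)]
      intro j
      calc |∑ k, clampTwo (x i k) * S t k j|
          ≤ ∑ k : Fin n, |clampTwo (x i k) * S t k j| := Finset.abs_sum_le_sum_abs _ _
        _ ≤ ∑ _k : Fin n, 2 * (C : ℝ) := by
            refine Finset.sum_le_sum fun k _ => ?_
            rw [abs_mul]
            exact mul_le_mul (abs_clampTwo_le _) (hC t ht k j) (abs_nonneg _) (by norm_num)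
        _ = _ := by simp
    · simp only [sub_zero, sub_self, max_eq_left hb, NNReal.coe_zero]
      exact le_rfl
  obtain ⟨q, hq0, hq⟩ := hPL.exists_eq_forall_mem_Icc_hasDerivWithinAt₀
  exact ⟨q, hq0, hq⟩

/-- Orthogonal matrices have entries of modulus at most 1 < 2, so the truncation is never felt: the
solution stays orthogonal and hence solves the original equation. -/
lemma exists_solvesRot_Icc {n : ℕ} {b : ℝ} (hb : 0 ≤ b) (S : ℝ → Matrix (Fin n) (Fin n) ℝ)
    (hS : ∀ i j, ContinuousOn (fun t => S t i j) (Icc 0 b)) (hA : ∀ t, (S t).transpose = -S t) :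
    ∃ Q : ℝ → Matrix (Fin n) (Fin n) ℝ, Q 0 = 1 ∧ SolvesRot S Q (Icc 0 b) ∧
      ∀ t ∈ Icc 0 b, Q t ∈ Matrix.specialOrthogonalGroup (Fin n) ℝ := by
  obtain ⟨q, hq0, hq⟩ := exists_solution_clamped hb S hS
  let Q : ℝ → Matrix (Fin n) (Fin n) ℝ := fun t => q t
  have hQ0 : Q 0 = 1 := hq0
  have hcont : ∀ i j, ContinuousOn (fun t => Q t i j) (Icc 0 b) := fun i j t ht =>
    (hasDerivWithinAt_pi.mp (hasDerivWithinAt_pi.mp (hq t ht) i) j).continuousWithinAt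
  have hQc : ContinuousOn Q (Icc 0 b) :=
    continuousOn_pi.mpr fun i => continuousOn_pi.mpr fun j => hcont i j
  have hPc : ContinuousOn (fun t => Q t * (Q t).transpose) (Icc 0 b) :=
    (continuous_id.matrix_mul continuous_id.matrix_transpose).comp_continuousOn hQc
  -- where the solution is orthogonal, the truncation is inactive
  have hder : ∀ t ∈ Icc 0 b, (∀ i j, |Q t i j| < 2) → ∀ i j,
      HasDerivWithinAt (fun τ => Q τ i j) ((Q t * S t) i j) (Icc 0 b) t := by
    intro t ht h i j
    have := hasDerivWithinAt_pi.mp (hasDerivWithinAt_pi.mp (hq t ht) i) j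
    have e : ∑ k, clampTwo (q t i k) * S t k j = (Q t * S t) i j := by
      rw [Matrix.mul_apply]
      exact Finset.sum_congr rfl fun k _ => by rw [clampTwo_eq (h i k)]
    rw [← e]
    exact this
  -- The set of orthogonal times is closed, contains 0 and extends to the right: just after such a
  -- time the entries are still below 2, the untruncated equation holds, and Q Qᵀ is constant.
  have horth : Icc 0 b ⊆ {t | Q t * (Q t).transpose = 1} := by
    refine IsClosed.Icc_subset_of_forall_mem_nhdsWithin ?_ ?_ ?_
    · rw [inter_comm]
      exact hPc.preimage_isClosed_of_isClosed isClosed_Icc isClosed_singleton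
    · simp [hQ0]
    · rintro t ⟨ht1, ht2⟩
      have hlt : ∀ i j, |Q t i j| < 2 := fun i j =>
        (abs_entry_le_one ht1 i j).trans_lt one_lt_two
      have hev : ∀ᶠ s in 𝓝[Icc 0 b] t, ∀ i j, |Q s i j| < 2 := by
        refine eventually_all.mpr fun i => eventually_all.mpr fun j => ?_
        exact (hcont i j t ⟨ht2.1, ht2.2.le⟩).abs.eventually_lt_const (hlt i j)
      have hev2 : ∀ᶠ s in 𝓝[≥] t, s ∈ Icc 0 b ∧ ∀ i j, |Q s i j| < 2 := by
        have hsub : Ico t b ⊆ Icc 0 b := fun s hs => ⟨ht2.1.trans hs.1, hs.2.le⟩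
        have h1 : Ico t b ∈ 𝓝[≥] t := Ico_mem_nhdsGE ht2.2
        have h2 : 𝓝[≥] t ≤ 𝓝[Icc 0 b] t := by
          rw [← nhdsWithin_Ico_eq_nhdsGE ht2.2]
          exact nhdsWithin_mono _ hsub
        filter_upwards [h1, h2 hev] with s hs hs2 using ⟨hsub hs, hs2⟩
      obtain ⟨u, hu, hsub⟩ := (mem_nhdsGE_iff_exists_Icc_subset).mp hev2
      refine mem_of_superset (Icc_mem_nhdsGT hu) fun s hs => ?_
      have hrot : SolvesRot S Q (Icc t u) := fun r hr i j =>
        (hder r (hsub hr).1 (hsub hr).2 i j).mono fun x hx => (hsub hx).1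
      change Q s * (Q s).transpose = 1
      rw [← show Q t * (Q t).transpose = 1 from ht1]
      ext i j
      exact eq_of_hasDerivWithinAt_zero ordConnected_Icc
        (fun r hr => hrot.hasDerivWithinAt_mul_transpose hA hrot hr i j) (left_mem_Icc.mpr hu.le) hs
  refine ⟨Q, hQ0, fun t ht => hder t ht fun i j =>
    (abs_entry_le_one (horth ht) i j).trans_lt one_lt_two, fun t ht => ?_⟩
  refine Matrix.mem_specialOrthogonalGroup_iff.mpr
    ⟨(Matrix.mem_orthogonalGroup_iff (Fin n) ℝ).mpr (horth ht), ?_⟩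
  have hdet : ∀ s ∈ Icc 0 b, (Q s).det = 1 ∨ (Q s).det = -1 := fun s hs => by
    have := congrArg Matrix.det (horth hs : Q s * (Q s).transpose = 1)
    rw [Matrix.det_mul, Matrix.det_transpose, Matrix.det_one] at this
    exact mul_self_eq_one_iff.mp this
  -- The determinant is ±1, continuous, and 1 at time 0; reaching -1 would force the value 0 in
  -- between.
  refine (hdet t ht).resolve_right fun hneg => ?_
  have hdc : ContinuousOn (fun s => (Q s).det) (Icc 0 t) :=
    continuous_id.matrix_det.comp_continuousOn (hQc.mono (Icc_subset_Icc_right ht.2))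
  have h0 : (0 : ℝ) ∈ Icc (Q t).det (Q 0).det := by
    rw [hneg, hQ0]; simp
  obtain ⟨s, hs, hs0⟩ := intermediate_value_Icc' ht.1 hdc h0
  have hs0 : (Q s).det = 0 := hs0
  rcases hdet s ⟨hs.1, hs.2.trans ht.2⟩ with h | h <;> rw [hs0] at h <;> norm_num at h

/-- The solutions on [0, b] agree on overlaps by uniqueness, so the diagonal t ↦ `R t t` glues them.
Each is extended by 1 off [0, b] to take values in SO(d-1) everywhere. -/
lemma exists_solvesRot {n : ℕ} {T : EReal} (S : ℝ → Matrix (Fin n) (Fin n) ℝ)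
    (hS : ∀ i j, ContinuousOn (fun t => S t i j) (tI T)) (hA : ∀ t, (S t).transpose = -S t) :
    ∃ R : ℝ → Matrix.specialOrthogonalGroup (Fin n) ℝ, R 0 = 1 ∧
      SolvesRot S (fun t => (R t : Matrix (Fin n) (Fin n) ℝ)) (tI T) := by
  have hex : ∀ b : ℝ, ∃ R : ℝ → Matrix.specialOrthogonalGroup (Fin n) ℝ, R 0 = 1 ∧ (b ∈ tI T →
      SolvesRot S (fun t => (R t : Matrix (Fin n) (Fin n) ℝ)) (Icc 0 b)) := by
    classical
    intro b
    by_cases hb : b ∈ tI T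
    · obtain ⟨Q, hQ0, hQ, hSO⟩ := exists_solvesRot_Icc hb.1 S
        (fun i j => (hS i j).mono (Icc_subset_tI hb)) hA
      have hmem : ∀ t ∈ Icc 0 b, ((if h : t ∈ Icc 0 b then ⟨Q t, hSO t h⟩ else 1 :
          Matrix.specialOrthogonalGroup (Fin n) ℝ) : Matrix (Fin n) (Fin n) ℝ) = Q t :=
        fun t ht => by rw [dif_pos ht]
      refine ⟨fun t => if h : t ∈ Icc 0 b then ⟨Q t, hSO t h⟩ else 1, ?_, fun _ t ht i j => ?_⟩
      · exact Subtype.ext ((hmem 0 ⟨le_rfl, hb.1⟩).trans hQ0)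
      · simp only [hmem t ht]
        refine (hQ t ht i j).congr (fun s hs => ?_) ?_
        · simp only [hmem s hs]
        · simp only [hmem t ht]
    · exact ⟨1, rfl, fun h => absurd h hb⟩
  choose R hR0 hR using hex
  have heq : ∀ b ∈ tI T, ∀ t ∈ Icc 0 b, R t t = R b t := fun b hb t ht => Subtype.ext <|
    SolvesRot.unique ordConnected_Icc (left_mem_Icc.mpr ht.1) hA (hR t (Icc_subset_tI hb ht))
      (fun s hs i j => (hR b hb s ⟨hs.1, hs.2.trans ht.2⟩ i j).mono (Icc_subset_Icc_right ht.2))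
      (by rw [hR0]; rfl) (by rw [hR0]; rfl)
      (fun s => (Matrix.mem_specialOrthogonalGroup_iff.mp (R b s).2).1) (right_mem_Icc.mpr ht.1)
  refine ⟨fun t => R t t, hR0 0, fun t ht i j => ?_⟩
  obtain ⟨b, htb, hb⟩ := exists_gt_mem_tI ht
  rw [hasDerivWithinAt_congr_nhds (nhdsWithin_tI htb hb)]
  have htb' : t ∈ Icc 0 b := ⟨ht.1, htb.le⟩
  simp only [heq b hb t htb']
  refine (hR b hb t htb' i j).congr (fun s hs => ?_) ?_
  · simp only [heq b hb s hs]
  · simp only [heq b hb t htb']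

/-! ### Change of the time variable -/

/-- The scalar autonomous-type equation `σ' = m(σ)` with `m > 0`, solved by inverting
`ρ(τ) = ∫₀^τ 1 / m`. -/
lemma exists_timeChange {S : EReal} (hS : 0 < S) (m : ℝ → ℝ) (hm : ContinuousOn m (tI S))
    (hpos : ∀ τ ∈ tI S, 0 < m τ) :
    ∃ (T : EReal) (σ ρ : ℝ → ℝ), 0 < T ∧ σ 0 = 0 ∧ ρ 0 = 0 ∧ BijOn σ (tI T) (tI S) ∧
      InvOn ρ σ (tI T) (tI S) ∧
      (∀ t ∈ tI T, HasDerivWithinAt σ (m (σ t)) (tI T) t) ∧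
      (∀ τ ∈ tI S, HasDerivWithinAt ρ (m τ)⁻¹ (tI S) τ) := by
  have hS0 := zero_mem_tI hS
  have hc : ContinuousOn (fun τ => (m τ)⁻¹) (tI S) := hm.inv₀ fun τ hτ => (hpos τ hτ).ne'
  let ρ : ℝ → ℝ := fun τ => ∫ s in (0 : ℝ)..τ, (m s)⁻¹
  have hρ : ∀ τ ∈ tI S, HasDerivWithinAt ρ (m τ)⁻¹ (tI S) τ := fun τ hτ =>
    hasDerivWithinAt_integral_tI hc hτ
  have hρ0 : ρ 0 = 0 := intervalIntegral.integral_same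
  have hρc : ContinuousOn ρ (tI S) := fun τ hτ => (hρ τ hτ).continuousWithinAt
  have hoc := (isInitialInterval_tI hS).2.2
  have hmono : StrictMonoOn ρ (tI S) := by
    refine strictMonoOn_of_deriv_pos hoc.convex hρc fun τ hτ => ?_
    have := (hρ τ (interior_subset hτ)).hasDerivAt (mem_interior_iff_mem_nhds.mp hτ)
    rw [this.deriv]
    exact inv_pos.mpr (hpos τ (interior_subset hτ))
  -- T is the total new time ∫ 1/m, possibly ∞. The supremum is not attained because ρ is strictly
  -- increasing and [0, S) has no last point.
  let T : EReal := sSup ((fun τ => (ρ τ : EReal)) '' tI S)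
  have himg : ρ '' tI S = tI T := by
    ext t
    constructor
    · rintro ⟨τ, hτ, rfl⟩
      refine ⟨hρ0 ▸ hmono.monotoneOn hS0 hτ hτ.1, ?_⟩
      obtain ⟨b, hb, hbS⟩ := exists_gt_mem_tI hτ
      exact (EReal.coe_lt_coe_iff.mpr (hmono hτ hbS hb)).trans_le
        (le_sSup (mem_image_of_mem _ hbS))
    · rintro ⟨ht0, htT⟩
      obtain ⟨_, ⟨b, hb, rfl⟩, htb⟩ := lt_sSup_iff.mp htT
      have htb : t < ρ b := EReal.coe_lt_coe_iff.mp htb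
      obtain ⟨τ, hτ, rfl⟩ := intermediate_value_Icc hb.1 (hρc.mono (Icc_subset_tI hb))
        (show t ∈ Icc (ρ 0) (ρ b) from ⟨hρ0.symm ▸ ht0, htb.le⟩)
      exact mem_image_of_mem _ (Icc_subset_tI hb hτ)
  have hT : 0 < T := by
    have : (0 : ℝ) ∈ tI T := himg ▸ ⟨0, hS0, hρ0⟩
    exact_mod_cast this.2
  have hocT := (isInitialInterval_tI hT).2.2
  let σ : ℝ → ℝ := Function.invFunOn ρ (tI S)
  have hbij : BijOn ρ (tI S) (tI T) := ⟨fun τ hτ => himg ▸ mem_image_of_mem _ hτ, hmono.injOn,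
    himg.symm.subset⟩
  have hinv : InvOn σ ρ (tI S) (tI T) := hbij.invOn_invFunOn
  have hσbij : BijOn σ (tI T) (tI S) := hinv.symm.bijOn hbij.surjOn.mapsTo_invFunOn hbij.mapsTo
  have hσ0 : σ 0 = 0 := by
    have := hinv.1 hS0
    rwa [hρ0] at this
  have hσc : ContinuousOn σ (tI T) := by
    -- A strictly increasing bijection of intervals is an order isomorphism, hence a homeomorphism;
    -- this gives continuity of σ, also at the endpoint 0.
    let e : tI S ≃o tI T := (hmono.orderIso ρ (tI S)).trans (OrderIso.setCongr _ _ himg)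
    have he : ∀ x : tI T, ((e.symm x : tI S) : ℝ) = σ x := fun x => by
      have h1 : ρ (e.symm x) = x := congrArg Subtype.val (e.apply_symm_apply x)
      rw [← h1]
      exact (hinv.1 (e.symm x).2).symm
    rw [continuousOn_iff_continuous_domRestrict]
    have : Continuous fun x : tI T => ((e.symm x : tI S) : ℝ) :=
      continuous_subtype_val.comp e.symm.continuous
    exact this.congr he
  refine ⟨T, σ, ρ, hT, hσ0, hρ0, hσbij, hinv.symm, fun t ht => ?_, hρ⟩
  have hσt := hσbij.mapsTo ht
  have hne : (m (σ t))⁻¹ ≠ 0 := (inv_pos.mpr (hpos _ hσt)).ne'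
  have hd := (hρ _ hσt).hasFDerivWithinAt
  have hu : (ContinuousLinearEquiv.unitsEquivAut ℝ (Units.mk0 _ hne) : ℝ →L[ℝ] ℝ) =
      ContinuousLinearMap.toSpanSingleton ℝ (m (σ t))⁻¹ := by
    ext; simp
  -- The inverse function rule relative to the two intervals, which includes the one-sided
  -- derivative at 0.
  have := HasFDerivWithinAt.of_local_left_inverse (g := σ) (f := ρ) (a := t) (s := tI T) (t := tI S)
    (f' := ContinuousLinearEquiv.unitsEquivAut ℝ (Units.mk0 _ hne))
    (tendsto_nhdsWithin_iff.mpr ⟨hσc t ht, eventually_mem_nhdsWithin.mono fun x hx =>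
      hσbij.mapsTo hx⟩) (by rw [hu]; exact hd) ht
    (eventually_mem_nhdsWithin.mono fun x hx => hinv.2 hx)
  simpa using this.hasDerivWithinAt

lemma contDiffOn_one_tI {T : EReal} (hT : 0 < T) {f f' : ℝ → ℝ}
    (hf : ∀ t ∈ tI T, HasDerivWithinAt f (f' t) (tI T) t) (hf' : ContinuousOn f' (tI T)) :
    ContDiffOn ℝ 1 f (tI T) := by
  have hu := uniqueDiffOn_tI hT
  refine (contDiffOn_one_iff_derivWithin hu).mpr
    ⟨fun t ht => (hf t ht).differentiableWithinAt, hf'.congr fun t ht => ?_⟩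
  exact (hf t ht).derivWithin (hu t ht)

variable {n : ℕ} {p : ℝ}

/-! ### The topology of the group -/

namespace SimGroup

/-- The topology of the ambient space in which derivatives of curves are taken, so that
differentiable curves are continuous into G. -/
instance : TopologicalSpace (SimGroup n p) :=
  TopologicalSpace.induced
    (fun g => (g.scale, (g.rot : Matrix (Fin n) (Fin n) ℝ), g.trans)) inferInstance

lemma continuous_coords : Continuous
    (fun g : SimGroup n p => (g.scale, (g.rot : Matrix (Fin n) (Fin n) ℝ), g.trans)) :=
  continuous_induced_dom

lemma continuous_scale : Continuous (fun g : SimGroup n p => g.scale) := continuous_coords.fst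

lemma continuous_rot : Continuous (fun g : SimGroup n p => (g.rot : Matrix (Fin n) (Fin n) ℝ)) :=
  continuous_coords.snd.fst

lemma continuous_trans : Continuous (fun g : SimGroup n p => g.trans) := continuous_coords.snd.snd

lemma rot_inv_coe (Q : Matrix.specialOrthogonalGroup (Fin n) ℝ) :
    ((Q⁻¹ : Matrix.specialOrthogonalGroup (Fin n) ℝ) : Matrix (Fin n) (Fin n) ℝ)
      = (Q : Matrix (Fin n) (Fin n) ℝ).transpose := rfl

lemma continuous_aug (c : ℝ) : Continuous (fun A : Matrix (Fin n) (Fin n) ℝ => aug c A) := by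
  refine continuous_matrix fun i j => ?_
  refine Fin.cases ?_ (fun i => ?_) i <;> refine Fin.cases ?_ (fun j => ?_) j <;> simp only [aug]
  · exact continuous_const
  · exact continuous_const
  · exact continuous_const
  · exact continuous_id.matrix_elem i j

lemma continuous_opr :
    Continuous (fun M : Matrix (Fin (n + 1)) (Fin (n + 1)) ℝ => (opr M : Eu n →L[ℝ] Eu n)) :=
  LinearMap.continuous_of_finiteDimensional
    ((Matrix.toEuclideanCLM (𝕜 := ℝ) (n := Fin (n + 1))).toAlgEquiv.toLinearMap)

lemma continuous_oprAQ : Continuous (fun g : SimGroup n p => opr g.aQ) :=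
  continuous_opr.comp ((continuous_aug 1).comp continuous_rot)

lemma continuous_oprAQinv : Continuous (fun g : SimGroup n p => opr g.aQinv) :=
  continuous_opr.comp ((continuous_aug 1).comp continuous_rot.matrix_transpose)

lemma continuous_scale_rpow (r : ℝ) : Continuous (fun g : SimGroup n p => g.scale ^ r) :=
  continuous_scale.rpow_const fun g => Or.inl g.scale_pos.ne'

lemma continuous_inv : Continuous (fun g : SimGroup n p => g⁻¹) := by
  refine continuous_induced_rng.mpr (Continuous.prodMk ?_ (Continuous.prodMk ?_ ?_))
  · exact continuous_scale.inv₀ fun g => g.scale_pos.ne'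
  · exact continuous_rot.matrix_transpose
  · exact ((continuous_scale_rpow _).smul (continuous_oprAQinv.clm_apply continuous_trans)).neg

end SimGroup

open SimGroup

/-! ### The reconstruction equations -/

lemma SolvesGroupODE.continuousOn {μ : ℝ → SimAlg n} {g : ℝ → SimGroup n p} {J : Set ℝ}
    (h : SolvesGroupODE μ g J) : ContinuousOn g J := by
  obtain ⟨-, h1, h2, h3⟩ := h
  refine IsInducing.continuousOn_iff ⟨rfl⟩ |>.mpr ?_
  refine ContinuousOn.prodMk (fun t ht => (h1.1 t ht).continuousWithinAt)
    (ContinuousOn.prodMk ?_ (fun t ht => (h3.1 t ht).continuousWithinAt))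
  exact continuousOn_pi.mpr fun i => continuousOn_pi.mpr fun j => fun t ht =>
    ((h2 i j).1 t ht).continuousWithinAt

lemma continuous_entry_so (i j : Fin n) :
    Continuous (fun μ : SimAlg n => (μ.2.1 : Matrix (Fin n) (Fin n) ℝ) i j) :=
  (continuous_subtype_val.comp continuous_snd.fst).matrix_elem i j

lemma so_transpose (S : LieAlgebra.Orthogonal.so (Fin n) ℝ) :
    (S : Matrix (Fin n) (Fin n) ℝ).transpose = -S :=
  (LieAlgebra.Orthogonal.mem_so (n := Fin n) (R := ℝ) _).mp S.2

/-- The system is triangular: α and Q are found independently of b, and then b' is a known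
continuous function of time. Uniqueness follows the same order. -/
theorem exists_solvesGroupODE {T : EReal} (μ : ℝ → SimAlg n) (hμ : ContinuousOn μ (tI T)) :
    ∃ g : ℝ → SimGroup n p, SolvesGroupODE μ g (tI T) := by
  have h1 : ContinuousOn (fun t => (μ t).1) (tI T) := hμ.fst
  have h3 : ContinuousOn (fun t => (μ t).2.2) (tI T) := hμ.snd.snd
  have hS : ∀ i j, ContinuousOn (fun t => ((μ t).2.1 : Matrix (Fin n) (Fin n) ℝ) i j) (tI T) :=
    fun i j => (continuous_entry_so i j).comp_continuousOn hμ
  have hSc : ContinuousOn (fun t => ((μ t).2.1 : Matrix (Fin n) (Fin n) ℝ)) (tI T) :=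
    continuousOn_pi.mpr fun i => continuousOn_pi.mpr fun j => hS i j
  obtain ⟨R, hR0, hR⟩ := exists_solvesRot (fun t => ((μ t).2.1 : Matrix (Fin n) (Fin n) ℝ)) hS
    (fun t => so_transpose _)
  let α : ℝ → ℝ := fun t => Real.exp (∫ s in (0 : ℝ)..t, (μ s).1)
  have hα : ∀ t ∈ tI T, HasDerivWithinAt α (α t * (μ t).1) (tI T) t := fun t ht =>
    (hasDerivWithinAt_integral_tI h1 ht).exp
  have hαc : ContinuousOn α (tI T) := fun t ht => (hα t ht).continuousWithinAt
  have hRc : ContinuousOn (fun t => (R t : Matrix (Fin n) (Fin n) ℝ)) (tI T) :=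
    continuousOn_pi.mpr fun i => continuousOn_pi.mpr fun j => fun t ht =>
      (hR t ht i j).continuousWithinAt
  let db : ℝ → Eu n := fun t =>
    α t ^ (p - 1) • opr (aug 1 (R t : Matrix (Fin n) (Fin n) ℝ)) (μ t).2.2
  have hdb : ContinuousOn db (tI T) := by
    have h4 : ContinuousOn (fun t => α t ^ (p - 1)) (tI T) :=
      hαc.rpow_const fun t _ => Or.inl (Real.exp_pos _).ne'
    exact h4.smul (((continuous_opr.comp (continuous_aug 1)).comp_continuousOn hRc).clm_apply h3)
  refine ⟨fun t => ⟨α t, R t, ∫ s in (0 : ℝ)..t, db s, Real.exp_pos _⟩, ?_, ⟨hα, hαc.mul h1⟩,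
    fun i j => ⟨fun t ht => hR t ht i j, ?_⟩,
    fun t ht => hasDerivWithinAt_integral_tI hdb ht, hdb⟩
  · refine SimGroup.ext ?_ hR0 ?_
    · simp [α]
    · exact intervalIntegral.integral_same
  · have : ContinuousOn (fun t => (R t : Matrix (Fin n) (Fin n) ℝ) *
        ((μ t).2.1 : Matrix (Fin n) (Fin n) ℝ)) (tI T) :=
      (continuous_fst.matrix_mul continuous_snd).comp_continuousOn (hRc.prodMk hSc)
    exact (continuous_id.matrix_elem i j).comp_continuousOn this

theorem SolvesGroupODE.unique {μ : ℝ → SimAlg n} {g h : ℝ → SimGroup n p} {J : Set ℝ}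
    (hJ : IsInitialInterval J) (hg : SolvesGroupODE μ g J) (hh : SolvesGroupODE μ h J) :
    EqOn h g J := by
  obtain ⟨h0, -, hoc⟩ := hJ
  obtain ⟨hg0, hg1, hg2, hg3⟩ := hg
  obtain ⟨hh0, hh1, hh2, hh3⟩ := hh
  have e1 : ∀ t ∈ J, (h t).scale = (g t).scale := by
    intro t ht
    have hd : ∀ s ∈ J, HasDerivWithinAt (fun s => (h s).scale / (g s).scale) 0 J s := by
      intro s hs
      exact ((hh1.1 s hs).div (hg1.1 s hs) (g s).scale_pos.ne').congr_deriv (by ring)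
    have := eq_of_hasDerivWithinAt_zero hoc hd h0 ht
    simp only [hg0, hh0, one_scale, div_one] at this
    exact (div_eq_one_iff_eq (g t).scale_pos.ne').mp this
  have e2 : ∀ t ∈ J, (h t).rot = (g t).rot := fun t ht => Subtype.ext <|
    SolvesRot.unique (S := fun t => ((μ t).2.1 : Matrix (Fin n) (Fin n) ℝ))
      (R := fun t => ((h t).rot : Matrix (Fin n) (Fin n) ℝ))
      (R' := fun t => ((g t).rot : Matrix (Fin n) (Fin n) ℝ)) hoc h0 (fun t => so_transpose _)
      (fun s hs i j => (hh2 i j).1 s hs) (fun s hs i j => (hg2 i j).1 s hs)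
      (by simp [hh0]) (by simp [hg0])
      (fun s => (Matrix.mem_specialOrthogonalGroup_iff.mp (g s).rot.2).1) ht
  intro t ht
  ext1
  · exact e1 t ht
  · exact e2 t ht
  · have hd : ∀ s ∈ J, HasDerivWithinAt (fun s => (h s).trans - (g s).trans) 0 J s := by
      intro s hs
      exact ((hh3.1 s hs).sub (hg3.1 s hs)).congr_deriv (by
        simp only [aQ, e1 s hs, e2 s hs, sub_self])
    have := eq_of_hasDerivWithinAt_zero hoc hd h0 ht
    simp only [hg0, hh0, one_trans, sub_self] at this
    exact sub_eq_zero.mp this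

lemma mfac_pos (g : SimGroup n p) : 0 < mfac g := Real.rpow_pos_of_pos g.scale_pos _

/-- The time transformation belonging to a continuous curve in the group. -/
theorem exists_solvesTimeODE {That : EReal} (hT : 0 < That) {g : ℝ → SimGroup n p}
    (hg : ContinuousOn g (tI That)) :
    ∃ (T : EReal) (σ ρ : ℝ → ℝ), 0 < T ∧ ρ 0 = 0 ∧ SolvesTimeODE That g σ (tI T) ∧
      (∀ (J : Set ℝ) (θ : ℝ → ℝ), IsInitialInterval J →
        SolvesTimeODE That g θ J → J ⊆ tI T ∧ EqOn θ σ J) ∧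
      BijOn σ (tI T) (tI That) ∧ InvOn ρ σ (tI T) (tI That) ∧
      ContDiffOn ℝ 1 σ (tI T) ∧ ContDiffOn ℝ 1 ρ (tI That) ∧
      ∀ τ ∈ tI That, HasDerivWithinAt ρ (mfac (g τ))⁻¹ (tI That) τ := by
  have hm : ContinuousOn (fun τ => mfac (g τ)) (tI That) :=
    (continuous_scale_rpow _).comp_continuousOn hg
  obtain ⟨T, σ, ρ, hT0, hσ0, hρ0, hbij, hinv, hσ, hρ⟩ :=
    exists_timeChange hT _ hm fun τ _ => mfac_pos _
  have hσc : ContinuousOn (fun t => mfac (g (σ t))) (tI T) :=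
    hm.comp (fun t ht => (hσ t ht).continuousWithinAt) hbij.mapsTo
  refine ⟨T, σ, ρ, hT0, hρ0, ⟨hσ0, hbij.mapsTo, hσ, hσc⟩, ?_, hbij, hinv,
    contDiffOn_one_tI hT0 hσ hσc,
    contDiffOn_one_tI hT hρ (hm.inv₀ fun τ _ => (mfac_pos _).ne'), hρ⟩
  rintro J θ ⟨h0, hJ, hoc⟩ ⟨hθ0, hθm, hθ⟩
  -- Any solution θ satisfies (ρ ∘ θ)' = m⁻¹ m = 1, so θ inverts ρ. This forces both J ⊆ [0, T) and
  -- θ = σ.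
  have key : ∀ t ∈ J, ρ (θ t) = t := by
    intro t ht
    have hd : ∀ s ∈ J, HasDerivWithinAt (fun s => ρ (θ s) - s) 0 J s := by
      intro s hs
      have := ((hρ _ (hθm hs)).comp s (hθ.1 s hs) hθm).sub (hasDerivWithinAt_id s J)
      rw [inv_mul_cancel₀ (mfac_pos _).ne', sub_self] at this
      exact this
    have := eq_of_hasDerivWithinAt_zero hoc hd h0 ht
    rw [hθ0, hρ0, sub_self] at this
    exact sub_eq_zero.mp this
  have hρm : MapsTo ρ (tI That) (tI T) := fun τ hτ => by
    obtain ⟨t, ht, rfl⟩ := hbij.surjOn hτ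
    rwa [hinv.1 ht]
  refine ⟨fun t ht => key t ht ▸ hρm (hθm ht), fun t ht => ?_⟩
  have := hinv.2 (hθm ht)
  rw [key t ht] at this
  exact this.symm

/-! ### Block matrices and exponentials -/

lemma aug_add (c c' : ℝ) (A B : Matrix (Fin n) (Fin n) ℝ) :
    aug (c + c') (A + B) = aug c A + aug c' B := by
  ext i j
  refine Fin.cases ?_ (fun i => ?_) i <;> refine Fin.cases ?_ (fun j => ?_) j <;>
    simp [aug]

lemma aug_smul (r c : ℝ) (A : Matrix (Fin n) (Fin n) ℝ) :
    aug (r * c) (r • A) = r • aug c A := by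
  ext i j
  refine Fin.cases ?_ (fun i => ?_) i <;> refine Fin.cases ?_ (fun j => ?_) j <;>
    simp [aug]

lemma aug_transpose (c : ℝ) (A : Matrix (Fin n) (Fin n) ℝ) :
    (aug c A).transpose = aug c A.transpose := by
  ext i j
  refine Fin.cases ?_ (fun i => ?_) i <;> refine Fin.cases ?_ (fun j => ?_) j <;>
    simp [aug]

lemma aug_pow (c : ℝ) (A : Matrix (Fin n) (Fin n) ℝ) (k : ℕ) : aug c A ^ k = aug (c ^ k) (A ^ k) := by
  induction k with
  | zero => simp [aug_one]
  | succ k ih => rw [pow_succ, ih, aug_mul, pow_succ, pow_succ]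

/-- `aug` as a linear map. -/
def augLin (n : ℕ) : ℝ × Matrix (Fin n) (Fin n) ℝ →ₗ[ℝ] Matrix (Fin (n + 1)) (Fin (n + 1)) ℝ where
  toFun x := aug x.1 x.2
  map_add' _ _ := aug_add _ _ _ _
  map_smul' _ _ := aug_smul _ _ _

/-- The exponential series converges for operators on Euclidean space; the inverse of the
finite-dimensional algebra isomorphism is continuous and carries it back to matrices, so no matrix
norm has to be chosen. -/
lemma hasSum_exp_matrix {m : ℕ} (S : Matrix (Fin m) (Fin m) ℝ) :
    HasSum (fun k : ℕ => ((k.factorial : ℝ)⁻¹) • S ^ k) (NormedSpace.exp S) ∧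
      Matrix.toEuclideanCLM (𝕜 := ℝ) (NormedSpace.exp S) =
        NormedSpace.exp (Matrix.toEuclideanCLM (𝕜 := ℝ) S) := by
  let e := Matrix.toEuclideanCLM (𝕜 := ℝ) (n := Fin m)
  have h1 := NormedSpace.exp_series_hasSum_exp' (𝕂 := ℝ) (e S)
  have hc : Continuous e.symm.toAlgEquiv.toLinearMap :=
    LinearMap.continuous_of_finiteDimensional e.symm.toAlgEquiv.toLinearMap
  have h2 := h1.map e.symm.toAlgEquiv.toLinearMap hc
  have h3 : (fun k : ℕ => ((k.factorial : ℝ)⁻¹) • S ^ k) =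
      e.symm.toAlgEquiv.toLinearMap ∘ fun k : ℕ => ((k.factorial : ℝ)⁻¹) • e S ^ k := by
    funext k
    change _ = e.symm (((k.factorial : ℝ)⁻¹) • e S ^ k)
    rw [map_smul, map_pow, StarAlgEquiv.symm_apply_apply]
  rw [← h3] at h2
  have h4 : NormedSpace.exp S = e.symm (NormedSpace.exp (e S)) := by
    rw [NormedSpace.exp_eq_tsum ℝ]
    exact h2.tsum_eq
  refine ⟨h4 ▸ h2, ?_⟩
  rw [h4]
  exact e.apply_symm_apply _

/-- Powers act blockwise, diag(0, S)^k = diag(0^k, S^k), and the corner series sums to exp 0 = 1. -/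
lemma exp_opr_aug (S : Matrix (Fin n) (Fin n) ℝ) :
    NormedSpace.exp (opr (aug 0 S)) = opr (aug 1 (NormedSpace.exp S)) := by
  rw [← (hasSum_exp_matrix (aug 0 S)).2]
  congr 1
  have h0 : HasSum (fun k : ℕ => ((k.factorial : ℝ)⁻¹) • (0 : ℝ) ^ k) 1 := by
    have := NormedSpace.exp_series_hasSum_exp' (𝕂 := ℝ) (0 : ℝ)
    rwa [NormedSpace.exp_zero] at this
  have h1 := h0.prodMk (hasSum_exp_matrix S).1
  have hc : Continuous (augLin n) :=
    (continuous_matrix fun i j => by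
      refine Fin.cases ?_ (fun i => ?_) i <;> refine Fin.cases ?_ (fun j => ?_) j
      · exact continuous_fst
      · exact continuous_const
      · exact continuous_const
      · exact continuous_snd.matrix_elem i j)
  have h2 := h1.map (augLin n) hc
  refine (hasSum_exp_matrix (aug 0 S)).1.unique ?_
  convert! h2 using 2 with k
  funext k
  simp [augLin, aug_pow, ← aug_smul]

lemma hasDerivAt_exp_matrix_entry {m : ℕ} (S : Matrix (Fin m) (Fin m) ℝ) (t : ℝ) (i j : Fin m) :
    HasDerivAt (fun t : ℝ => NormedSpace.exp (t • S) i j) ((NormedSpace.exp (t • S) * S) i j) t := by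
  let e := Matrix.toEuclideanCLM (𝕜 := ℝ) (n := Fin m)
  have h1 := hasDerivAt_exp_smul_const (𝕂 := ℝ) (e S) t
  let L : (EuclideanSpace ℝ (Fin m) →L[ℝ] EuclideanSpace ℝ (Fin m)) →L[ℝ] ℝ :=
    (EuclideanSpace.proj i).comp (ContinuousLinearMap.apply ℝ (EuclideanSpace ℝ (Fin m))
      (EuclideanSpace.single j 1))
  have hL : ∀ M : Matrix (Fin m) (Fin m) ℝ, L (e M) = M i j := by
    intro M
    change (Matrix.toEuclideanCLM (𝕜 := ℝ) M (WithLp.toLp 2 (Pi.single j 1))) i = M i j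
    rw [Matrix.toEuclideanCLM_toLp]
    simp
  have h2 := L.hasFDerivAt.comp_hasDerivAt t h1
  have e1 : ∀ s : ℝ, NormedSpace.exp (s • e S) = e (NormedSpace.exp (s • S)) := fun s => by
    rw [(hasSum_exp_matrix (s • S)).2, map_smul]
  have e2 : (L ∘ fun u : ℝ => NormedSpace.exp (u • e S)) =
      fun t : ℝ => NormedSpace.exp (t • S) i j := by
    funext s
    simp only [Function.comp, e1, hL]
  rw [e2] at h2
  refine h2.congr_deriv ?_
  rw [e1, ← map_mul, hL]

/-- `t ↦ ∑ₖ tᵏ⁺¹ / (k + 1)! Aᵏ w` is a primitive of `t ↦ exp(t A) w`. -/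
lemma hasDerivAt_tsum_pow {E : Type*} [NormedAddCommGroup E] [NormedSpace ℝ E] [CompleteSpace E]
    (A : E →L[ℝ] E) (w : E) (t : ℝ) :
    HasDerivAt (fun t : ℝ => ∑' k : ℕ, ((k + 1).factorial : ℝ)⁻¹ • ((t • A) ^ k) (t • w))
      (NormedSpace.exp (t • A) w) t := by
  have hterm : ∀ (k : ℕ) (s : ℝ), ((k + 1).factorial : ℝ)⁻¹ • ((s • A) ^ k) (s • w) =
      (s ^ (k + 1) * ((k + 1).factorial : ℝ)⁻¹) • (A ^ k) w := by
    intro k s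
    rw [smul_pow, smul_apply, map_smul, smul_smul, smul_smul, pow_succ]
    ring_nf
  have hd : ∀ (k : ℕ) (s : ℝ), HasDerivAt
      (fun s : ℝ => ((k + 1).factorial : ℝ)⁻¹ • ((s • A) ^ k) (s • w))
      ((s ^ k * (k.factorial : ℝ)⁻¹) • (A ^ k) w) s := by
    intro k s
    simp only [hterm]
    refine HasDerivAt.smul_const (c' := s ^ k * (k.factorial : ℝ)⁻¹) ?_ ((A ^ k) w)
    refine ((hasDerivAt_pow (k + 1) s).mul_const _).congr_deriv ?_
    rw [Nat.factorial_succ]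
    push_cast
    have h1 : ((k : ℝ) + 1) ≠ 0 := by positivity
    have h2 : (k.factorial : ℝ) ≠ 0 := by positivity
    field_simp
  -- The ball of radius R contains both 0, where every term vanishes, and t; on it the
  -- differentiated series is dominated by an exponential series.
  let R : ℝ := |t| + 1
  have hR : 0 ≤ R := by positivity
  have hu : Summable fun k : ℕ => (R * ‖A‖) ^ k / k.factorial * ‖w‖ :=
    (Real.summable_pow_div_factorial _).mul_right _
  have hpow : ∀ k : ℕ, ‖(A ^ k) w‖ ≤ ‖A‖ ^ k * ‖w‖ := by
    intro k
    induction k with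
    | zero => simp
    | succ k ih =>
      rw [pow_succ', pow_succ', mul_assoc]
      exact (A.le_opNorm _).trans (mul_le_mul_of_nonneg_left ih (norm_nonneg _))
  have h0 : Summable fun k : ℕ =>
      ((k + 1).factorial : ℝ)⁻¹ • (((0 : ℝ) • A) ^ k) ((0 : ℝ) • w) := by
    simp only [zero_smul, map_zero, smul_zero]
    exact summable_zero
  have key := hasDerivAt_tsum_of_isPreconnected (y := t) (y₀ := 0) (t := Metric.ball (0 : ℝ) R) hu
    Metric.isOpen_ball (convex_ball 0 R).isPreconnected (fun k s _ => hd k s)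
    (fun k s hs => ?_) (Metric.mem_ball_self (by positivity)) ?_ ?_
  · refine key.congr_deriv ?_
    have h1 := NormedSpace.exp_series_hasSum_exp' (𝕂 := ℝ) (t • A)
    have h2 := h1.map (ContinuousLinearMap.apply ℝ E w) (ContinuousLinearMap.continuous _)
    refine (HasSum.tsum_eq ?_)
    convert! h2 using 1
    funext k
    simp [smul_pow, smul_smul, mul_comm]
  · rw [mem_ball_zero_iff, Real.norm_eq_abs] at hs
    calc ‖(s ^ k * (k.factorial : ℝ)⁻¹) • (A ^ k) w‖
        = |s| ^ k * (k.factorial : ℝ)⁻¹ * ‖(A ^ k) w‖ := by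
          rw [norm_smul, Real.norm_eq_abs, abs_mul, abs_pow, abs_of_nonneg (a := _⁻¹) (by positivity)]
      _ ≤ R ^ k * (k.factorial : ℝ)⁻¹ * (‖A‖ ^ k * ‖w‖) := by
          gcongr
          exact hpow k
      _ = _ := by rw [mul_pow]; field_simp
  · exact h0
  · simp [R]

lemma exp_smul_one_add {E : Type*} [NormedAddCommGroup E] [NormedSpace ℝ E] [CompleteSpace E]
    (c : ℝ) (B : E →L[ℝ] E) :
    NormedSpace.exp (c • (1 : E →L[ℝ] E) + B) = Real.exp c • NormedSpace.exp B := by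
  let _ : NormedAlgebra ℚ (E →L[ℝ] E) := NormedAlgebra.restrictScalars ℚ ℝ _
  rw [NormedSpace.exp_add_of_commute ((Commute.one_left B).smul_left c),
    ← Algebra.algebraMap_eq_smul_one, ← NormedSpace.algebraMap_exp_comm,
    Algebra.algebraMap_eq_smul_one, ← Real.exp_eq_exp_ℝ, smul_mul_assoc, one_mul]

lemma opr_smul (c : ℝ) (M : Matrix (Fin (n + 1)) (Fin (n + 1)) ℝ) : opr (c • M) = c • opr M :=
  map_smul _ _ _

lemma opr_add (M N : Matrix (Fin (n + 1)) (Fin (n + 1)) ℝ) : opr (M + N) = opr M + opr N :=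
  map_add _ _ _

/-! ### Velocities of curves in the group -/

/-- The curve `γ` in the group has the velocity `T₁L_γ μ` at the time `t`. -/
def HasVel (γ : ℝ → SimGroup n p) (μ : SimAlg n) (J : Set ℝ) (t : ℝ) : Prop :=
  HasDerivWithinAt (fun τ => (γ τ).scale) ((γ t).scale * μ.1) J t ∧
  (∀ i j, HasDerivWithinAt (fun τ => ((γ τ).rot : Matrix (Fin n) (Fin n) ℝ) i j)
    ((((γ t).rot : Matrix (Fin n) (Fin n) ℝ) * (μ.2.1 : Matrix (Fin n) (Fin n) ℝ)) i j) J t) ∧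
  HasDerivWithinAt (fun τ => (γ τ).trans) ((γ t).scale ^ (p - 1) • opr (γ t).aQ μ.2.2) J t

lemma HasVel.mono {γ : ℝ → SimGroup n p} {μ : SimAlg n} {J K : Set ℝ} {t : ℝ}
    (h : HasVel γ μ J t) (hK : K ⊆ J) : HasVel γ μ K t :=
  ⟨h.1.mono hK, fun i j => (h.2.1 i j).mono hK, h.2.2.mono hK⟩

lemma SolvesGroupODE.hasVel {μ : ℝ → SimAlg n} {g : ℝ → SimGroup n p} {J : Set ℝ}
    (h : SolvesGroupODE μ g J) {t : ℝ} (ht : t ∈ J) : HasVel g (μ t) J t :=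
  ⟨h.2.1.1 t ht, fun i j => (h.2.2.1 i j).1 t ht, h.2.2.2.1 t ht⟩

lemma gexp_zero : gexp p (0 : SimAlg n) = 1 := by
  refine SimGroup.ext ?_ (Subtype.ext ?_) ?_
  · simp [gexp]
  · simp [gexp]
  · simp [gexp]

/-- This confirms that the series in `gexp` gives the exponential map, so that generators are the
special case γ = exp(tμ) of derivatives along curves. For the translation part, b is a primitive of
exp(tA)w with A = (p-1)μ₁ I + diag(0, S), and exp(tA) = α^(p-1) diag(1, Q). -/
lemma hasVel_gexp (μ : SimAlg n) (t : ℝ) :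
    HasVel (fun t : ℝ => gexp p (t • μ)) μ univ t := by
  have hs : HasDerivAt (fun t : ℝ => Real.exp (t * μ.1)) (Real.exp (t * μ.1) * μ.1) t := by
    simpa using ((hasDerivAt_id t).mul_const μ.1).exp
  refine ⟨hs.hasDerivWithinAt, fun i j =>
    (hasDerivAt_exp_matrix_entry (μ.2.1 : Matrix (Fin n) (Fin n) ℝ) t i j).hasDerivWithinAt, ?_⟩
  let A : Eu n →L[ℝ] Eu n :=
    ((p - 1) * μ.1) • (1 : Eu n →L[ℝ] Eu n) + opr (aug 0 (μ.2.1 : Matrix (Fin n) (Fin n) ℝ))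
  have hA : ∀ t : ℝ, ((p - 1) * (t • μ).1) • (1 : Eu n →L[ℝ] Eu n) +
      opr (aug 0 ((t • μ).2.1 : Matrix (Fin n) (Fin n) ℝ)) = t • A := by
    intro t
    have h1 : aug 0 ((t • μ).2.1 : Matrix (Fin n) (Fin n) ℝ) =
        t • aug 0 (μ.2.1 : Matrix (Fin n) (Fin n) ℝ) := by
      rw [← aug_smul, mul_zero]; rfl
    rw [h1, opr_smul, smul_add, smul_smul]
    congr 2
    simp only [Prod.smul_fst, smul_eq_mul]
    ring
  have h2 := hasDerivAt_tsum_pow A μ.2.2 t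
  have h3 : (fun t : ℝ => (gexp p (t • μ)).trans) = fun t : ℝ =>
      ∑' k : ℕ, ((k + 1).factorial : ℝ)⁻¹ • ((t • A) ^ k) (t • μ.2.2) := by
    funext t
    simp only [gexp, hA]
    rfl
  have h4 : NormedSpace.exp (t • A) = (gexp p (t • μ)).scale ^ (p - 1) • opr (gexp p (t • μ)).aQ := by
    have h5 : t • A = (t * ((p - 1) * μ.1)) • (1 : Eu n →L[ℝ] Eu n) +
        opr (aug 0 (t • (μ.2.1 : Matrix (Fin n) (Fin n) ℝ))) := by
      have : aug 0 (t • (μ.2.1 : Matrix (Fin n) (Fin n) ℝ)) =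
          t • aug 0 (μ.2.1 : Matrix (Fin n) (Fin n) ℝ) := by
        rw [← aug_smul, mul_zero]
      rw [this, opr_smul, smul_add, smul_smul]
    rw [h5, exp_smul_one_add, exp_opr_aug]
    have h6 : Real.exp (t * ((p - 1) * μ.1)) = (gexp p (t • μ)).scale ^ (p - 1) := by
      change _ = Real.exp (t * μ.1) ^ (p - 1)
      rw [← Real.exp_mul]
      ring_nf
    rw [h6]
    rfl
  rw [h3]
  refine h2.hasDerivWithinAt.congr_deriv ?_
  rw [h4]
  rfl

/-! ### The coordinate change as a similarity -/

lemma star_aQinv (g : SimGroup n p) : star g.aQinv = g.aQ := by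
  rw [Matrix.star_eq_conjTranspose, Matrix.conjTranspose_eq_transpose_of_trivial, aQinv,
    aug_transpose, rot_inv_coe, Matrix.transpose_transpose, aQ]

lemma norm_oprAQinv (g : SimGroup n p) (x : Eu n) : ‖opr g.aQinv x‖ = ‖x‖ := by
  refine (ContinuousLinearMap.norm_map_iff_adjoint_comp_self (opr g.aQinv)).mpr ?_ x
  have h1 : ContinuousLinearMap.adjoint (opr g.aQinv) = opr g.aQ := by
    rw [← ContinuousLinearMap.star_eq_adjoint, ← star_aQinv]
    exact (map_star _ _).symm
  rw [h1]
  exact (map_mul (Matrix.toEuclideanCLM (𝕜 := ℝ)) g.aQ g.aQinv).symm.trans (by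
    rw [aQ_mul_aQinv, map_one])

lemma opr_aQ_aQinv (g : SimGroup n p) (x : Eu n) : opr g.aQ (opr g.aQinv x) = x := by
  rw [← mul_apply_eq_comp, ← map_mul, aQ_mul_aQinv]; simp

lemma opr_aQinv_aQ (g : SimGroup n p) (x : Eu n) : opr g.aQinv (opr g.aQ x) = x := by
  rw [← mul_apply_eq_comp, ← map_mul, aQinv_mul_aQ]; simp

/-- The inverse rotation as a linear isometry. -/
def rotEquiv (g : SimGroup n p) : Eu n ≃ₗᵢ[ℝ] Eu n where
  toFun := opr g.aQinv
  invFun := opr g.aQ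
  map_add' := map_add _
  map_smul' := map_smul _
  left_inv := opr_aQ_aQinv g
  right_inv := opr_aQinv_aQ g
  norm_map' := norm_oprAQinv g

lemma pull_symm_apply (g : SimGroup n p) (y : Eu n) :
    g.pull.symm y = g.scale ^ (p - 1) • opr g.aQ y + g.trans := rfl

lemma lin_apply (g : SimGroup n p) (y : Eu n) : g.lin y = g.scale ^ (1 - p) • opr g.aQinv y := rfl

lemma lin_symm_apply (g : SimGroup n p) (y : Eu n) :
    g.lin.symm y = g.scale ^ (p - 1) • opr g.aQ y := rfl

lemma pull_eq (g : SimGroup n p) (x : Eu n) : g.pull x = g.lin (x - g.trans) := rfl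

lemma pull_symm_eq (g : SimGroup n p) (y : Eu n) : g.pull.symm y = g.lin.symm y + g.trans := rfl

/-- The Jacobian `α ^ ((p - 1) d)` of the inverse coordinate change. -/
def jac (g : SimGroup n p) : ℝ := g.scale ^ ((p - 1) * ((n : ℝ) + 1))

lemma jac_pos (g : SimGroup n p) : 0 < jac g := Real.rpow_pos_of_pos g.scale_pos _

/-- The map is a dilation after an isometry after a translation, and only the dilation by α^(1-p) in
dimension n + 1 changes volume. -/
lemma map_pull_volume (g : SimGroup n p) :
    Measure.map g.pull (volume : Measure (Eu n)) = ENNReal.ofReal (jac g) • volume := by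
  have hne : g.scale ^ (1 - p) ≠ 0 := (Real.rpow_pos_of_pos g.scale_pos _).ne'
  have h1 : (g.pull : Eu n → Eu n) =
      (fun x => g.scale ^ (1 - p) • x) ∘ (rotEquiv g) ∘ fun x => x - g.trans := by
    funext x; rfl
  have hm : MeasurePreserving ((rotEquiv g) ∘ fun x : Eu n => x - g.trans) volume volume :=
    (rotEquiv g).measurePreserving.comp (measurePreserving_sub_right volume g.trans)
  rw [h1, ← Measure.map_map (measurable_const_smul _) hm.measurable, hm.map_eq,
    Measure.map_addHaar_smul volume hne]
  congr 2
  rw [finrank_euclideanSpace_fin, abs_of_pos (inv_pos.mpr (pow_pos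
    (Real.rpow_pos_of_pos g.scale_pos _) _)), jac, ← Real.rpow_natCast, ← Real.rpow_mul
    g.scale_pos.le, ← Real.rpow_neg g.scale_pos.le]
  congr 1
  push_cast
  ring

lemma quasiMeasurePreserving_pull (g : SimGroup n p) :
    Measure.QuasiMeasurePreserving g.pull (volume : Measure (Eu n)) volume := by
  refine ⟨g.pull.continuous.measurable, ?_⟩
  rw [map_pull_volume]
  exact Measure.smul_absolutelyContinuous

lemma integral_comp_pull {F : Type*} [NormedAddCommGroup F] [NormedSpace ℝ F]
    (g : SimGroup n p) (f : Eu n → F) : ∫ x, f (g.pull x) = jac g • ∫ y, f y := by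
  have h := integral_map_equiv (μ := (volume : Measure (Eu n))) g.pull.toMeasurableEquiv f
  have e : Measure.map g.pull.toMeasurableEquiv (volume : Measure (Eu n)) =
      ENNReal.ofReal (jac g) • volume := map_pull_volume g
  rw [e, integral_smul_measure, ENNReal.toReal_ofReal (jac_pos g).le] at h
  exact h.symm

lemma locallyIntegrable_comp_pull (g : SimGroup n p) {f : Eu n → ℝ}
    (hf : LocallyIntegrable f volume) : LocallyIntegrable (fun x => f (g.pull x)) volume := by
  rw [locallyIntegrable_iff] at hf ⊢
  intro K hK
  have h1 : IntegrableOn f (g.pull '' K) (Measure.map g.pull (volume : Measure (Eu n))) := by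
    rw [map_pull_volume, IntegrableOn, Measure.restrict_smul]
    exact (hf _ (hK.image g.pull.continuous)).smul_measure ENNReal.ofReal_ne_top
  have h2 := (g.pull.measurableEmbedding.integrableOn_map_iff).mp h1
  rwa [g.pull.injective.preimage_image] at h2

lemma locallyIntegrable_actFun (g : SimGroup n p) {f : Eu n → ℝ}
    (hf : LocallyIntegrable f volume) : LocallyIntegrable (g.actFun f) volume :=
  (locallyIntegrable_comp_pull g hf).smul g.scale⁻¹

/-! ### Test functions and the dual action -/

/-- Test functions. -/
def IsTest (ψ : Eu n → ℝ) : Prop := ContDiff ℝ ∞ ψ ∧ HasCompactSupport ψ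

/-- The dual of the action with respect to the `L²` pairing. -/
def coact (g : SimGroup n p) (ψ : Eu n → ℝ) : Eu n → ℝ :=
  fun y => g.scale⁻¹ * jac g * ψ (g.pull.symm y)

lemma contDiff_pull (g : SimGroup n p) {k : WithTop ℕ∞} : ContDiff ℝ k g.pull := by
  have : ContDiff ℝ k fun x => g.lin (x - g.trans) :=
    g.lin.contDiff.comp (contDiff_id.sub contDiff_const)
  exact this

lemma contDiff_pull_symm (g : SimGroup n p) {k : WithTop ℕ∞} : ContDiff ℝ k g.pull.symm := by
  have : ContDiff ℝ k fun x => g.lin.symm x + g.trans :=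
    g.lin.symm.contDiff.add contDiff_const
  exact this

lemma IsTest.coact (g : SimGroup n p) {ψ : Eu n → ℝ} (hψ : IsTest ψ) : IsTest (coact g ψ) :=
  ⟨contDiff_const.mul (hψ.1.comp (contDiff_pull_symm g)),
    (hψ.2.comp_homeomorph g.pull.symm).mul_left⟩

lemma integral_actFun_mul (g : SimGroup n p) (v ψ : Eu n → ℝ) :
    ∫ x, g.actFun v x * ψ x = ∫ y, v y * coact g ψ y := by
  have h := integral_comp_pull g fun y => g.scale⁻¹ * v y * ψ (g.pull.symm y)
  simp only [Homeomorph.symm_apply_apply] at h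
  simp only [actFun]
  rw [h, smul_eq_mul, ← integral_const_mul]
  congr 1
  funext y
  rw [BurgersFreezing.coact]
  ring

/-! ### The dual generator -/

/-- The vector field of the infinitesimal coordinate change. -/
def vfield (p : ℝ) (μ : SimAlg n) (y : Eu n) : Eu n :=
  ((p - 1) * μ.1) • y + opr (aug 0 (μ.2.1 : Matrix (Fin n) (Fin n) ℝ)) y + μ.2.2

/-- The formal adjoint of the generator `T₁a [μ]`. -/
def adjGen (p : ℝ) (μ : SimAlg n) (ψ : Eu n → ℝ) (y : Eu n) : ℝ :=
  (((p - 1) * ((n : ℝ) + 1) - 1) * μ.1) * ψ y + fderiv ℝ ψ y (vfield p μ y)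

lemma hasFDerivAt_pull_symm (g : SimGroup n p) (y : Eu n) :
    HasFDerivAt g.pull.symm (g.lin.symm : Eu n →L[ℝ] Eu n) y := by
  have : HasFDerivAt (fun x => g.lin.symm x + g.trans) (g.lin.symm : Eu n →L[ℝ] Eu n) y :=
    g.lin.symm.hasFDerivAt.add_const _
  exact this

lemma fderiv_coact (g : SimGroup n p) {ψ : Eu n → ℝ} (hψ : IsTest ψ) (y w : Eu n) :
    fderiv ℝ (coact g ψ) y w =
      g.scale⁻¹ * jac g * fderiv ℝ ψ (g.pull.symm y) (g.lin.symm w) := by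
  have h1 : HasFDerivAt ψ (fderiv ℝ ψ (g.pull.symm y)) (g.pull.symm y) :=
    (hψ.1.differentiable (by simp) _).hasFDerivAt
  have h2 := ((h1.comp y (hasFDerivAt_pull_symm g y)).const_mul (g.scale⁻¹ * jac g)).fderiv
  have h3 : fderiv ℝ (coact g ψ) y = _ := h2
  rw [h3]
  rfl

lemma adjGen_coact (g : SimGroup n p) {ψ : Eu n → ℝ} (hψ : IsTest ψ) (μ : SimAlg n) (y : Eu n) :
    adjGen p μ (coact g ψ) y = g.scale⁻¹ * jac g *
      ((((p - 1) * ((n : ℝ) + 1) - 1) * μ.1) * ψ (g.pull.symm y) +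
        fderiv ℝ ψ (g.pull.symm y) (g.lin.symm (vfield p μ y))) := by
  rw [adjGen, fderiv_coact g hψ, coact]
  ring

/-- `aug 0 A` as a linear combination of constant matrices, applied to a vector. -/
lemma opr_aug_zero_eq_sum (A : Matrix (Fin n) (Fin n) ℝ) (y : Eu n) :
    opr (aug 0 A) y = ∑ i, ∑ j, A i j • opr (aug 0 (Matrix.single i j 1)) y := by
  have h1 : aug 0 A = ∑ i, ∑ j, A i j • aug 0 (Matrix.single i j (1 : ℝ)) := by
    have h2 : ∀ B, aug 0 B = augLin n (0, B) := fun _ => rfl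
    have h3 : ((0 : ℝ), A) = ∑ i, ∑ j, A i j • ((0 : ℝ), Matrix.single i j (1 : ℝ)) := by
      refine Prod.ext ?_ ?_
      · simp [Prod.fst_sum]
      · simp only [Prod.snd_sum, Prod.smul_snd, Matrix.smul_single, smul_eq_mul, mul_one]
        exact Matrix.matrix_eq_sum_single A
    simp only [h2]
    conv_lhs => rw [h3]
    simp only [map_sum, map_smul]
  rw [h1]
  simp only [opr, map_sum, sum_apply]
  refine Finset.sum_congr rfl fun i _ => Finset.sum_congr rfl fun j _ => ?_
  exact congrArg (fun L : Eu n →L[ℝ] Eu n => L y) (opr_smul _ _)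

/-- The derivative of the rotation is known entrywise, so diag(1, Q)y is expanded as an affine
combination of fixed vectors with the entries of Q as coefficients. -/
lemma HasVel.hasDerivWithinAt_opr {γ : ℝ → SimGroup n p} {μ : SimAlg n} {J : Set ℝ} {t : ℝ}
    (h : HasVel γ μ J t) (y : Eu n) :
    HasDerivWithinAt (fun τ => opr (γ τ).aQ y)
      (opr (γ t).aQ (opr (aug 0 (μ.2.1 : Matrix (Fin n) (Fin n) ℝ)) y)) J t := by
  have e1 : ∀ A : Matrix (Fin n) (Fin n) ℝ, opr (aug 1 A) y = opr (aug 1 0) y +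
      ∑ i, ∑ j, A i j • opr (aug 0 (Matrix.single i j 1)) y := by
    intro A
    rw [← opr_aug_zero_eq_sum, ← add_apply, ← opr_add, ← aug_add, add_zero, zero_add]
  have e2 : opr (γ t).aQ (opr (aug 0 (μ.2.1 : Matrix (Fin n) (Fin n) ℝ)) y) =
      ∑ i, ∑ j, (((γ t).rot : Matrix (Fin n) (Fin n) ℝ) *
        (μ.2.1 : Matrix (Fin n) (Fin n) ℝ)) i j • opr (aug 0 (Matrix.single i j 1)) y := by
    rw [← opr_aug_zero_eq_sum, ← mul_apply_eq_comp, ← map_mul, aQ, aug_mul, one_mul]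
  have e3 : (fun τ => opr (γ τ).aQ y) = fun τ => opr (aug 1 0) y +
      ∑ i, ∑ j, ((γ τ).rot : Matrix (Fin n) (Fin n) ℝ) i j •
        opr (aug 0 (Matrix.single i j 1)) y := by
    funext τ
    exact e1 _
  rw [e2, e3]
  exact (HasDerivWithinAt.fun_sum fun i _ => HasDerivWithinAt.fun_sum fun j _ =>
    (h.2.1 i j).smul_const _).const_add _

/-- Differentiating α^(p-1) diag(1, Q) y + b, the left-translated velocity lets the factor α^(p-1)
diag(1, Q) be pulled out of all three terms. -/
lemma HasVel.hasDerivWithinAt_pull_symm {γ : ℝ → SimGroup n p} {μ : SimAlg n} {J : Set ℝ} {t : ℝ}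
    (h : HasVel γ μ J t) (y : Eu n) :
    HasDerivWithinAt (fun τ => (γ τ).pull.symm y) ((γ t).lin.symm (vfield p μ y)) J t := by
  have h1 := h.1.rpow_const (p := p - 1) (Or.inl (γ t).scale_pos.ne')
  refine ((h1.smul (h.hasDerivWithinAt_opr y)).add h.2.2).congr_deriv ?_
  rw [lin_symm_apply, vfield, map_add, map_add, map_smul, smul_add, smul_add, smul_smul]
  have h2 : (γ t).scale * μ.1 * (p - 1) * (γ t).scale ^ (p - 1 - 1) =
      (γ t).scale ^ (p - 1) * ((p - 1) * μ.1) := by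
    rw [Real.rpow_sub_one (γ t).scale_pos.ne']
    field_simp [(γ t).scale_pos.ne']
  rw [h2]
  abel

lemma scale_inv_mul_jac (g : SimGroup n p) :
    g.scale⁻¹ * jac g = g.scale ^ ((p - 1) * ((n : ℝ) + 1) - 1) := by
  rw [jac, Real.rpow_sub_one g.scale_pos.ne', div_eq_inv_mul]

/-- The dual action of a curve with velocity `T₁L_γ μ` is differentiated by the dual generator. -/
lemma HasVel.hasDerivWithinAt_coact {γ : ℝ → SimGroup n p} {μ : SimAlg n} {J : Set ℝ} {t : ℝ}
    (h : HasVel γ μ J t) {ψ : Eu n → ℝ} (hψ : IsTest ψ) (y : Eu n) :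
    HasDerivWithinAt (fun τ => coact (γ τ) ψ y) (adjGen p μ (coact (γ t) ψ) y) J t := by
  have h1 := h.1.rpow_const (p := (p - 1) * ((n : ℝ) + 1) - 1) (Or.inl (γ t).scale_pos.ne')
  have h2 : HasFDerivAt ψ (fderiv ℝ ψ ((γ t).pull.symm y)) ((γ t).pull.symm y) :=
    (hψ.1.differentiable (by simp) _).hasFDerivAt
  have h3 := h1.mul (h2.comp_hasDerivWithinAt t (h.hasDerivWithinAt_pull_symm y))
  have e : (fun τ => coact (γ τ) ψ y) = fun τ => (γ τ).scale ^ ((p - 1) * ((n : ℝ) + 1) - 1) *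
      ψ ((γ τ).pull.symm y) := by
    funext τ
    rw [coact, scale_inv_mul_jac]
  rw [e]
  refine h3.congr_deriv ?_
  rw [adjGen_coact _ hψ, scale_inv_mul_jac]
  have h4 : (γ t).scale * μ.1 * ((p - 1) * ((n : ℝ) + 1) - 1) *
      (γ t).scale ^ ((p - 1) * ((n : ℝ) + 1) - 1 - 1) =
      (γ t).scale ^ ((p - 1) * ((n : ℝ) + 1) - 1) * (((p - 1) * ((n : ℝ) + 1) - 1) * μ.1) := by
    rw [Real.rpow_sub_one (γ t).scale_pos.ne' ((p - 1) * ((n : ℝ) + 1) - 1)]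
    field_simp [(γ t).scale_pos.ne']
  rw [h4]
  simp only [Function.comp]
  ring

/-! ### Joint continuity and uniform bounds for the dual action along curves -/

section Continuity

variable {Z : Type*} [TopologicalSpace Z] {f : Z → SimGroup n p} {m : Z → SimAlg n} {h : Z → Eu n}

lemma continuous_vfield_comp (hm : Continuous m) (hh : Continuous h) :
    Continuous fun z => vfield p (m z) (h z) := by
  have h1 : Continuous fun z => opr (aug 0 ((m z).2.1 : Matrix (Fin n) (Fin n) ℝ)) :=
    continuous_opr.comp ((continuous_aug 0).comp (continuous_subtype_val.comp hm.snd.fst))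
  exact (((continuous_const.mul hm.fst).smul hh).add (h1.clm_apply hh)).add hm.snd.snd

lemma continuous_linSymm_comp (hf : Continuous f) (hh : Continuous h) :
    Continuous fun z => (f z).lin.symm (h z) :=
  ((continuous_scale_rpow (p - 1)).comp hf).smul ((continuous_oprAQ.comp hf).clm_apply hh)

lemma continuous_lin_comp (hf : Continuous f) (hh : Continuous h) :
    Continuous fun z => (f z).lin (h z) :=
  ((continuous_scale_rpow (1 - p)).comp hf).smul ((continuous_oprAQinv.comp hf).clm_apply hh)

lemma continuous_pullSymm_comp (hf : Continuous f) (hh : Continuous h) :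
    Continuous fun z => (f z).pull.symm (h z) :=
  (continuous_linSymm_comp hf hh).add (continuous_trans.comp hf)

lemma continuous_pull_comp (hf : Continuous f) (hh : Continuous h) :
    Continuous fun z => (f z).pull (h z) :=
  continuous_lin_comp hf (hh.sub (continuous_trans.comp hf))

lemma continuous_jac : Continuous fun g : SimGroup n p => jac g := continuous_scale_rpow _

lemma continuous_scale_inv : Continuous fun g : SimGroup n p => g.scale⁻¹ :=
  continuous_scale.inv₀ fun g => g.scale_pos.ne'

lemma continuous_adjGen_coact (hf : Continuous f) (hm : Continuous m) (hh : Continuous h)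
    {ψ : Eu n → ℝ} (hψ : IsTest ψ) : Continuous fun z => adjGen p (m z) (coact (f z) ψ) (h z) := by
  simp only [adjGen_coact _ hψ]
  have hz := continuous_pullSymm_comp hf hh
  have hd : Continuous (fderiv ℝ ψ) := hψ.1.continuous_fderiv (by simp)
  exact ((continuous_scale_inv.comp hf).mul (continuous_jac.comp hf)).mul
    (((continuous_const.mul hm.fst).mul (hψ.1.continuous.comp hz)).add
      ((hd.comp hz).clm_apply (continuous_linSymm_comp hf (continuous_vfield_comp hm hh))))

end Continuity

lemma adjGen_coact_eq_zero (g : SimGroup n p) {ψ : Eu n → ℝ} (hψ : IsTest ψ) (μ : SimAlg n)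
    {y : Eu n} (hy : y ∉ g.pull '' tsupport ψ) : adjGen p μ (coact g ψ) y = 0 := by
  have h : g.pull.symm y ∉ tsupport ψ := fun h => hy ⟨_, h, g.pull.apply_symm_apply y⟩
  have h2 : fderiv ℝ ψ (g.pull.symm y) = 0 :=
    image_eq_zero_of_notMem_tsupport fun h' => h (tsupport_fderiv_subset ℝ h')
  rw [adjGen_coact g hψ, h2, image_eq_zero_of_notMem_tsupport h]
  simp

lemma continuous_adjGen {ψ : Eu n → ℝ} (hψ : IsTest ψ) (μ : SimAlg n) :
    Continuous (adjGen p μ ψ) := by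
  have hf : Continuous (fderiv ℝ ψ) := hψ.1.continuous_fderiv (by simp)
  exact (continuous_const.mul hψ.1.continuous).add
    (hf.clm_apply (continuous_vfield_comp continuous_const continuous_id))

lemma hasCompactSupport_adjGen {ψ : Eu n → ℝ} (hψ : IsTest ψ) (μ : SimAlg n) :
    HasCompactSupport (adjGen p μ ψ) := by
  refine HasCompactSupport.of_support_subset_isCompact hψ.2 fun y hy => ?_
  by_contra h
  refine hy ?_
  rw [adjGen, image_eq_zero_of_notMem_tsupport h,
    image_eq_zero_of_notMem_tsupport fun h' => h (tsupport_fderiv_subset ℝ h')]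
  simp

lemma integrable_mul_of_hasCompactSupport {v φ : Eu n → ℝ} (hv : LocallyIntegrable v volume)
    (hφ : Continuous φ) (hφ2 : HasCompactSupport φ) : Integrable fun y => v y * φ y :=
  hv.integrable_smul_right_of_hasCompactSupport hφ hφ2

/-- Supplies the dominating function for differentiation under the integral. The supports move with
γ, but over a compact time interval they sweep out only a compact set, the image of [a, b] × supp ψ.
-/
lemma exists_bound_adjGen_coact {γ : ℝ → SimGroup n p} {μ : ℝ → SimAlg n} {a b : ℝ}
    (hγ : ContinuousOn γ (Icc a b)) (hμ : ContinuousOn μ (Icc a b)) {ψ : Eu n → ℝ}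
    (hψ : IsTest ψ) : ∃ (B : Set (Eu n)) (C : ℝ), IsCompact B ∧ ∀ s ∈ Icc a b, ∀ y,
      |adjGen p (μ s) (coact (γ s) ψ) y| ≤ B.indicator (fun _ => C) y := by
  let P : Set (ℝ × Eu n) := Icc a b ×ˢ tsupport ψ
  have hP : IsCompact P := isCompact_Icc.prod hψ.2
  have hγP : Continuous fun x : P => γ x.1.1 :=
    continuousOn_iff_continuous_domRestrict.mp (hγ.comp continuousOn_fst fun x (hx : x ∈ P) => hx.1)
  have hμP : Continuous fun x : P => μ x.1.1 :=
    continuousOn_iff_continuous_domRestrict.mp (hμ.comp continuousOn_fst fun x (hx : x ∈ P) => hx.1)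
  let Φ : ℝ × Eu n → Eu n := fun x => (γ x.1).pull x.2
  have hΦ : Continuous fun x : P => Φ x :=
    continuous_pull_comp hγP (continuous_snd.comp continuous_subtype_val)
  have hpP : ContinuousOn Φ P := continuousOn_iff_continuous_domRestrict.mpr hΦ
  have hK : ContinuousOn (fun x : ℝ × Eu n => adjGen p (μ x.1) (coact (γ x.1) ψ) (Φ x)) P :=
    continuousOn_iff_continuous_domRestrict.mpr (continuous_adjGen_coact hγP hμP hΦ hψ)
  obtain ⟨C, hC⟩ := hP.exists_bound_of_continuousOn hK
  refine ⟨Φ '' P, C, hP.image_of_continuousOn hpP, fun s hs y => ?_⟩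
  by_cases hy : y ∈ (γ s).pull '' tsupport ψ
  · obtain ⟨z, hz, rfl⟩ := hy
    have hmem : (γ s).pull z ∈ Φ '' P := ⟨(s, z), ⟨hs, hz⟩, rfl⟩
    rw [indicator_of_mem hmem]
    exact hC (s, z) ⟨hs, hz⟩
  · rw [adjGen_coact_eq_zero _ hψ _ hy, abs_zero]
    -- C ≥ 0 is needed only when B is nonempty, and then C bounds an actual norm.
    refine indicator_nonneg (fun y hyB => ?_) y
    obtain ⟨x, hx, -⟩ := hyB
    exact (norm_nonneg _).trans (hC x hx)

/-- Differentiation of the pairing with a test function along a curve in the group. -/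
lemma hasDerivAt_pairing {γ : ℝ → SimGroup n p} {μ : ℝ → SimAlg n} {a b t : ℝ}
    (ht : t ∈ Ioo a b) (hγ : ContinuousOn γ (Icc a b)) (hμ : ContinuousOn μ (Icc a b))
    (hvel : ∀ s ∈ Icc a b, HasVel γ (μ s) (Icc a b) s) {v : Eu n → ℝ}
    (hv : LocallyIntegrable v volume) {ψ : Eu n → ℝ} (hψ : IsTest ψ) :
    HasDerivAt (fun τ => ∫ y, v y * coact (γ τ) ψ y)
      (∫ y, v y * adjGen p (μ t) (coact (γ t) ψ) y) t := by
  obtain ⟨B, C, hB, hbound⟩ := exists_bound_adjGen_coact hγ hμ hψ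
  have hcoint : ∀ τ, Integrable fun y => v y * coact (γ τ) ψ y := fun τ =>
    integrable_mul_of_hasCompactSupport hv (hψ.coact (γ τ)).1.continuous (hψ.coact (γ τ)).2
  have hgint : Integrable fun y => v y * adjGen p (μ t) (coact (γ t) ψ) y :=
    integrable_mul_of_hasCompactSupport hv (continuous_adjGen (hψ.coact _) _)
      (hasCompactSupport_adjGen (hψ.coact _) _)
  have hbd : ∀ y, ∀ s ∈ Ioo a b, ‖v y * adjGen p (μ s) (coact (γ s) ψ) y‖ ≤
      |v y| * B.indicator (fun _ => C) y := fun y s hs => by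
    rw [Real.norm_eq_abs, abs_mul]
    exact mul_le_mul_of_nonneg_left (hbound s (Ioo_subset_Icc_self hs) y) (abs_nonneg _)
  have hbint : Integrable fun y => |v y| * B.indicator (fun _ => C) y := by
    have e : (fun y => |v y| * B.indicator (fun _ => C) y) = B.indicator fun y => |v y| * C := by
      funext y
      exact (indicator_mul_right B (fun y => |v y|) (fun _ => C)).symm
    rw [e, integrable_indicator_iff hB.measurableSet]
    exact ((hv.integrableOn_isCompact hB).abs).mul_const C
  have hder : ∀ y, ∀ s ∈ Ioo a b, HasDerivAt (fun τ => v y * coact (γ τ) ψ y)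
      (v y * adjGen p (μ s) (coact (γ s) ψ) y) s := fun y s hs =>
    (((hvel s (Ioo_subset_Icc_self hs)).hasDerivWithinAt_coact hψ y).hasDerivAt
      (Icc_mem_nhds hs.1 hs.2)).const_mul (v y)
  exact (hasDerivAt_integral_of_dominated_loc_of_deriv_le (Ioo_mem_nhds ht.1 ht.2)
    (Eventually.of_forall fun τ => (hcoint τ).aestronglyMeasurable) (hcoint t)
    hgint.aestronglyMeasurable (Eventually.of_forall hbd) hbint (Eventually.of_forall hder)).2

/-! ### The adjoint representation -/

/-- The adjoint action of `g⁻¹` on the Lie algebra. -/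
def adInv (g : SimGroup n p) (μ : SimAlg n) : SimAlg n :=
  (μ.1, ⟨(g.rot : Matrix (Fin n) (Fin n) ℝ).transpose * μ.2.1 * g.rot, by
    rw [LieAlgebra.Orthogonal.mem_so, Matrix.transpose_mul, Matrix.transpose_mul,
      Matrix.transpose_transpose, so_transpose]
    simp [Matrix.mul_assoc]⟩,
    g.lin (vfield p μ g.trans))

lemma continuous_adInv (μ : SimAlg n) : Continuous fun g : SimGroup n p => adInv g μ := by
  refine continuous_const.prodMk (Continuous.prodMk (Continuous.subtype_mk ?_ _) ?_)
  · exact ((continuous_rot.matrix_transpose).matrix_mul continuous_const).matrix_mul continuous_rot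
  · exact continuous_lin_comp continuous_id (continuous_vfield_comp continuous_const continuous_trans)

/-- The affine vector field of Ad(g⁻¹)μ is that of μ in the coordinates y = `g.pull x`. In
particular the translation part of Ad(g⁻¹)μ comes from the field of μ at b, the point that `g.pull`
sends to 0. -/
lemma linSymm_vfield_adInv (g : SimGroup n p) (μ : SimAlg n) (y : Eu n) :
    g.lin.symm (vfield p (adInv g μ) y) = vfield p μ (g.pull.symm y) := by
  have h1 : g.lin.symm (opr (aug 0 ((adInv g μ).2.1 : Matrix (Fin n) (Fin n) ℝ)) y) =
      opr (aug 0 (μ.2.1 : Matrix (Fin n) (Fin n) ℝ)) (g.lin.symm y) := by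
    rw [lin_symm_apply, lin_symm_apply, map_smul]
    congr 1
    rw [← mul_apply_eq_comp, ← mul_apply_eq_comp, ← map_mul, ← map_mul, aQ, aug_mul, aug_mul]
    congr 3
    · ring
    · have h2 : (g.rot : Matrix (Fin n) (Fin n) ℝ) *
          (g.rot : Matrix (Fin n) (Fin n) ℝ).transpose = 1 :=
        (Matrix.mem_orthogonalGroup_iff (Fin n) ℝ).mp
          (Matrix.mem_specialOrthogonalGroup_iff.mp g.rot.2).1
      simp only [adInv]
      rw [← mul_assoc, ← mul_assoc, h2, one_mul]
  conv_lhs => rw [vfield]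
  rw [map_add, map_add, map_smul, h1, pull_symm_eq]
  conv_rhs => rw [vfield]
  simp only [adInv, ContinuousLinearEquiv.symm_apply_apply]
  conv_lhs => rw [vfield]
  rw [smul_add, map_add]
  abel

lemma adjGen_adInv_coact (g : SimGroup n p) {ψ : Eu n → ℝ} (hψ : IsTest ψ) (μ : SimAlg n)
    (y : Eu n) : adjGen p (adInv g μ) (coact g ψ) y = coact g (adjGen p μ ψ) y := by
  rw [adjGen_coact g hψ, linSymm_vfield_adInv, coact, adjGen]
  simp only [adInv]

/-! ### Actions on Banach spaces of locally integrable functions -/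

/-- The properties of the action on a Banach space `X` of (classes of) locally integrable functions
that do not involve a smoother space. -/
structure IsFunctionAction {X : Type} [NormedAddCommGroup X] [NormedSpace ℝ X]
    (act : SimGroup n p → X → X) (ι : X → Eu n → ℝ) : Prop where
  locallyIntegrable : ∀ v, LocallyIntegrable (ι v) volume
  act_ae : ∀ g v, ι (act g v) =ᵐ[volume] g.actFun (ι v)
  bound : ∃ C : SimGroup n p → ℝ, Continuous C ∧ ∀ g v, ‖act g v‖ ≤ C g * ‖v‖
  continuous : ∀ v, Continuous fun g => act g v
  pairing : ∀ ψ, IsTest ψ → ∃ L : X →L[ℝ] ℝ, ∀ v, L v = ∫ y, ι v y * ψ y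
  separating : ∀ v, (∀ ψ, IsTest ψ → ∫ y, ι v y * ψ y = 0) → v = 0

/-- `w = T₁a v[μ]` in the sense of distributions. -/
def WeakGen {X : Type} (p : ℝ) (ι : X → Eu n → ℝ) (v : X) (μ : SimAlg n) (w : X) : Prop :=
  ∀ ψ, IsTest ψ → ∫ y, ι w y * ψ y = ∫ y, ι v y * adjGen p μ ψ y

/-- The value at `μ` of the linear map that agrees with `G` on the spanning family. -/
def expand {X : Type} [NormedAddCommGroup X] [NormedSpace ℝ X] (G : SimAlg n → X)
    (μ : SimAlg n) : X :=
  μ.1 • G (1, 0, 0) +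
    (∑ i, ∑ j, ((1 / 2 : ℝ) * (μ.2.1 : Matrix (Fin n) (Fin n) ℝ) i j) • G (0, soBasis i j, 0)) +
    ∑ i, μ.2.2 i • G (0, 0, eb i)

/-- Linearity in the Lie algebra is invisible in the limit defining T₁a v[μ], but plain for the
adjoint operator; it is transferred to generators by testing. -/
lemma adjGen_add (μ ν : SimAlg n) (ψ : Eu n → ℝ) (y : Eu n) :
    adjGen p (μ + ν) ψ y = adjGen p μ ψ y + adjGen p ν ψ y := by
  have h : vfield p (μ + ν) y = vfield p μ y + vfield p ν y := by
    have h1 : opr (aug 0 ((μ + ν).2.1 : Matrix (Fin n) (Fin n) ℝ)) y =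
        opr (aug 0 (μ.2.1 : Matrix (Fin n) (Fin n) ℝ)) y +
        opr (aug 0 (ν.2.1 : Matrix (Fin n) (Fin n) ℝ)) y := by
      rw [← add_apply, ← opr_add, ← aug_add, add_zero]; rfl
    simp only [vfield]
    rw [h1]
    simp only [Prod.fst_add, Prod.snd_add, mul_add, add_smul]
    abel
  simp only [adjGen, h, map_add, Prod.fst_add]
  ring

lemma adjGen_smul (c : ℝ) (μ : SimAlg n) (ψ : Eu n → ℝ) (y : Eu n) :
    adjGen p (c • μ) ψ y = c * adjGen p μ ψ y := by
  have h : vfield p (c • μ) y = c • vfield p μ y := by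
    have h1 : opr (aug 0 ((c • μ).2.1 : Matrix (Fin n) (Fin n) ℝ)) y =
        c • opr (aug 0 (μ.2.1 : Matrix (Fin n) (Fin n) ℝ)) y := by
      have : aug 0 ((c • μ).2.1 : Matrix (Fin n) (Fin n) ℝ) =
          c • aug 0 (μ.2.1 : Matrix (Fin n) (Fin n) ℝ) := by
        rw [← aug_smul, mul_zero]; rfl
      rw [this, opr_smul]; rfl
    simp only [vfield]
    rw [h1]
    simp only [Prod.smul_fst, Prod.smul_snd, smul_eq_mul, smul_add, smul_smul]
    congr 3
    ring
  simp only [adjGen, h, map_smul, Prod.smul_fst, smul_eq_mul]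
  ring

/-- The rotation generators run over all ordered pairs, so the sum yields S - Sᵀ = 2S; this explains
the factor 1/2. -/
lemma eq_sum_basis (μ : SimAlg n) :
    μ = μ.1 • ((1, 0, 0) : SimAlg n) +
      (∑ i, ∑ j, ((1 / 2 : ℝ) * (μ.2.1 : Matrix (Fin n) (Fin n) ℝ) i j) •
        ((0, soBasis i j, 0) : SimAlg n)) +
      ∑ i, μ.2.2 i • ((0, 0, eb i) : SimAlg n) := by
  refine Prod.ext ?_ (Prod.ext ?_ ?_)
  · simp [Prod.fst_sum]
  · simp only [Prod.snd_add, Prod.fst_add, Prod.snd_sum, Prod.fst_sum, Prod.smul_snd,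
      Prod.smul_fst, smul_zero, Finset.sum_const_zero, add_zero, zero_add]
    refine Subtype.ext ?_
    set S : Matrix (Fin n) (Fin n) ℝ := (μ.2.1 : Matrix (Fin n) (Fin n) ℝ)
    have hT : S.transpose = -S := so_transpose μ.2.1
    have h1 : ((∑ i, ∑ j, ((1 / 2 : ℝ) * S i j) • soBasis i j :
        LieAlgebra.Orthogonal.so (Fin n) ℝ) : Matrix (Fin n) (Fin n) ℝ) =
        ∑ i, ∑ j, ((1 / 2 : ℝ) * S i j) • (Matrix.single i j 1 - Matrix.single j i (1 : ℝ)) := by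
      rw [AddSubmonoidClass.coe_finsetSum]
      refine Finset.sum_congr rfl fun i _ => ?_
      rw [AddSubmonoidClass.coe_finsetSum]
      rfl
    rw [h1]
    have h2 : ∑ i, ∑ j, ((1 / 2 : ℝ) * S i j) • Matrix.single i j (1 : ℝ) = (1 / 2 : ℝ) • S := by
      conv_rhs => rw [Matrix.matrix_eq_sum_single S]
      simp only [Finset.smul_sum, Matrix.smul_single, smul_eq_mul, mul_one]
    have h3 : ∑ i, ∑ j, ((1 / 2 : ℝ) * S i j) • Matrix.single j i (1 : ℝ) =
        (1 / 2 : ℝ) • S.transpose := by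
      conv_rhs => rw [Matrix.matrix_eq_sum_single S.transpose]
      rw [Finset.sum_comm]
      simp only [Finset.smul_sum, Matrix.smul_single, smul_eq_mul, mul_one, Matrix.transpose_apply]
    simp only [smul_sub, Finset.sum_sub_distrib]
    rw [h2, h3, hT, smul_neg, sub_neg_eq_add, ← add_smul]
    norm_num
  · simp only [Prod.snd_add, Prod.snd_sum, Prod.smul_snd, smul_zero, Finset.sum_const_zero,
      add_zero, zero_add]
    ext k
    simp [Finset.sum_apply, Pi.single_apply]

namespace IsFunctionAction

variable {X : Type} [NormedAddCommGroup X] [NormedSpace ℝ X] {act : SimGroup n p → X → X}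
  {ι : X → Eu n → ℝ}

lemma integrable (H : IsFunctionAction act ι) (v : X) {φ : Eu n → ℝ} (hφ : Continuous φ)
    (hφ2 : HasCompactSupport φ) : Integrable fun y => ι v y * φ y :=
  integrable_mul_of_hasCompactSupport (H.locallyIntegrable v) hφ hφ2

lemma ext_pairing (H : IsFunctionAction act ι) {v w : X}
    (h : ∀ ψ, IsTest ψ → ∫ y, ι v y * ψ y = ∫ y, ι w y * ψ y) : v = w := by
  refine sub_eq_zero.mp (H.separating _ fun ψ hψ => ?_)
  obtain ⟨L, hL⟩ := H.pairing ψ hψ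
  rw [← hL, map_sub, hL, hL, h ψ hψ, sub_self]

lemma pairing_act (H : IsFunctionAction act ι) (g : SimGroup n p) (v : X) (ψ : Eu n → ℝ) :
    ∫ y, ι (act g v) y * ψ y = ∫ y, ι v y * coact g ψ y := by
  rw [← integral_actFun_mul]
  exact integral_congr_ae ((H.act_ae g v).mul (EventuallyEq.refl _ ψ))

/-- Linearity and the group law are not postulated: elements of X are determined by their pairings
with test functions, where the dual action is explicit. -/
lemma act_add (H : IsFunctionAction act ι) (g : SimGroup n p) (v w : X) :
    act g (v + w) = act g v + act g w := by
  refine H.ext_pairing fun ψ hψ => ?_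
  obtain ⟨L, hL⟩ := H.pairing ψ hψ
  obtain ⟨L', hL'⟩ := H.pairing _ (hψ.coact g)
  rw [← hL (_ + _), map_add, hL, hL, H.pairing_act, H.pairing_act, H.pairing_act, ← hL', map_add,
    hL', hL']

lemma act_smul (H : IsFunctionAction act ι) (g : SimGroup n p) (c : ℝ) (v : X) :
    act g (c • v) = c • act g v := by
  refine H.ext_pairing fun ψ hψ => ?_
  obtain ⟨L, hL⟩ := H.pairing ψ hψ
  obtain ⟨L', hL'⟩ := H.pairing _ (hψ.coact g)
  rw [← hL (c • _), map_smul, hL, H.pairing_act, H.pairing_act, ← hL', map_smul, hL']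

lemma act_neg (H : IsFunctionAction act ι) (g : SimGroup n p) (v : X) :
    act g (-v) = -act g v := by
  rw [← neg_one_smul ℝ v, H.act_smul, neg_one_smul]

lemma act_sub (H : IsFunctionAction act ι) (g : SimGroup n p) (v w : X) :
    act g (v - w) = act g v - act g w := by
  rw [sub_eq_add_neg, H.act_add, H.act_neg, ← sub_eq_add_neg]

/-- The formula for a(h)v holds only almost everywhere; it survives composition with the coordinate
change of g because that map pulls null sets back to null sets. -/
lemma act_mul (H : IsFunctionAction act ι) (g h : SimGroup n p) (v : X) :
    act (g * h) v = act g (act h v) := by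
  have h1 : g.actFun (ι (act h v)) =ᵐ[volume] g.actFun (h.actFun (ι v)) :=
    ((quasiMeasurePreserving_pull g).ae_eq_comp (H.act_ae h v)).fun_comp fun x => g.scale⁻¹ * x
  have h2 : ι (act (g * h) v) =ᵐ[volume] ι (act g (act h v)) := by
    refine (H.act_ae (g * h) v).trans ?_
    rw [actFun_mul]
    exact ((H.act_ae g _).trans h1).symm
  exact H.ext_pairing fun ψ _ => integral_congr_ae (h2.mul (EventuallyEq.refl _ ψ))

lemma act_one (H : IsFunctionAction act ι) (v : X) : act 1 v = v := by
  refine H.ext_pairing fun ψ _ => ?_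
  refine integral_congr_ae (((H.act_ae 1 v).trans ?_).mul (EventuallyEq.refl _ ψ))
  refine Eventually.of_forall fun x => ?_
  have : (1 : SimGroup n p).pull x = x := by
    rw [pull_apply]
    simp [aQinv, aug_one]
  simp [actFun, this]

lemma act_inv_act (H : IsFunctionAction act ι) (g : SimGroup n p) (v : X) :
    act g⁻¹ (act g v) = v := by
  rw [← H.act_mul, inv_mul_cancel, H.act_one]

lemma act_act_inv (H : IsFunctionAction act ι) (g : SimGroup n p) (v : X) :
    act g (act g⁻¹ v) = v := by
  rw [← H.act_mul, mul_inv_cancel, H.act_one]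

/-- Joint continuity from strong continuity and a locally bounded operator norm, after splitting
a(γ)u = a(γ)u₀ + a(γ)(u - u₀). -/
lemma tendsto_act (H : IsFunctionAction act ι) {α : Type*} {l : Filter α} {γ : α → SimGroup n p}
    {γ₀ : SimGroup n p} {u : α → X} {u₀ : X} (hγ : Tendsto γ l (𝓝 γ₀)) (hu : Tendsto u l (𝓝 u₀)) :
    Tendsto (fun i => act (γ i) (u i)) l (𝓝 (act γ₀ u₀)) := by
  obtain ⟨C, hC, hb⟩ := H.bound
  have h1 : Tendsto (fun i => act (γ i) u₀) l (𝓝 (act γ₀ u₀)) :=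
    ((H.continuous u₀).tendsto γ₀).comp hγ
  have h2 : Tendsto (fun i => act (γ i) (u i - u₀)) l (𝓝 0) := by
    refine squeeze_zero_norm (fun i => hb (γ i) (u i - u₀)) ?_
    have h3 := ((hC.tendsto γ₀).comp hγ).mul (tendsto_sub_nhds_zero_iff.mpr hu).norm
    rw [norm_zero, mul_zero] at h3
    exact h3
  have h4 := h1.add h2
  rw [add_zero] at h4
  refine h4.congr fun i => ?_
  rw [H.act_sub]
  abel

lemma continuousOn_act (H : IsFunctionAction act ι) {J : Set ℝ} {γ : ℝ → SimGroup n p} {u : ℝ → X}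
    (hγ : ContinuousOn γ J) (hu : ContinuousOn u J) : ContinuousOn (fun t => act (γ t) (u t)) J :=
  fun t ht => H.tendsto_act (hγ t ht) (hu t ht)

/-! ### Differentiability of the action along curves -/

lemma weakGen_add (H : IsFunctionAction act ι) {v w w' : X} {μ μ' : SimAlg n}
    (h : WeakGen p ι v μ w) (h' : WeakGen p ι v μ' w') : WeakGen p ι v (μ + μ') (w + w') := by
  intro ψ hψ
  obtain ⟨L, hL⟩ := H.pairing ψ hψ
  rw [← hL, map_add, hL, hL, h ψ hψ, h' ψ hψ, ← integral_add]
  · simp only [adjGen_add, mul_add]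
  · exact H.integrable v (continuous_adjGen hψ _) (hasCompactSupport_adjGen hψ _)
  · exact H.integrable v (continuous_adjGen hψ _) (hasCompactSupport_adjGen hψ _)

lemma weakGen_smul (H : IsFunctionAction act ι) {v w : X} {μ : SimAlg n} (c : ℝ)
    (h : WeakGen p ι v μ w) : WeakGen p ι v (c • μ) (c • w) := by
  intro ψ hψ
  obtain ⟨L, hL⟩ := H.pairing ψ hψ
  rw [← hL, map_smul, hL, h ψ hψ, smul_eq_mul, ← integral_const_mul]
  simp only [adjGen_smul]
  congr 1
  funext y
  ring

lemma weakGen_sum (H : IsFunctionAction act ι) {v : X} {κ : Type*} (s : Finset κ)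
    {w : κ → X} {μ : κ → SimAlg n} (h : ∀ i ∈ s, WeakGen p ι v (μ i) (w i)) :
    WeakGen p ι v (∑ i ∈ s, μ i) (∑ i ∈ s, w i) := by
  classical
  induction s using Finset.induction_on with
  | empty =>
    intro ψ hψ
    obtain ⟨L, hL⟩ := H.pairing ψ hψ
    have h0 : ∀ y, adjGen p (0 : SimAlg n) ψ y = 0 := fun y => by
      simpa using adjGen_smul (p := p) 0 (0 : SimAlg n) ψ y
    simp only [Finset.sum_empty, h0, mul_zero, integral_zero]
    rw [← hL, map_zero]
  | insert a s ha ih =>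
    rw [Finset.sum_insert ha, Finset.sum_insert ha]
    exact H.weakGen_add (h a (Finset.mem_insert_self a s))
      (ih fun i hi => h i (Finset.mem_insert_of_mem hi))

lemma weakGen_expand (H : IsFunctionAction act ι) {v : X} {G : SimAlg n → X}
    (h : ∀ μ, WeakGen p ι v μ (G μ)) (μ : SimAlg n) : WeakGen p ι v μ (expand G μ) := by
  have h1 := H.weakGen_add (H.weakGen_add (H.weakGen_smul μ.1 (h (1, 0, 0)))
    (H.weakGen_sum Finset.univ fun i _ => H.weakGen_sum Finset.univ fun j _ =>
      H.weakGen_smul ((1 / 2 : ℝ) * (μ.2.1 : Matrix (Fin n) (Fin n) ℝ) i j) (h (0, soBasis i j, 0))))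
    (H.weakGen_sum Finset.univ fun i _ => H.weakGen_smul (μ.2.2 i) (h (0, 0, eb i)))
  rw [← eq_sum_basis μ] at h1
  exact h1

lemma weakGen_act (H : IsFunctionAction act ι) {v w : X} (g : SimGroup n p) {μ : SimAlg n}
    (h : WeakGen p ι v (adInv g μ) w) : WeakGen p ι (act g v) μ (act g w) := by
  intro ψ hψ
  rw [H.pairing_act, H.pairing_act, h _ (hψ.coact g)]
  simp only [adjGen_adInv_coact g hψ]

variable [CompleteSpace X]

/-- The passage from weak to strong: each pairing of a(γ)v is a primitive of the pairing of a(γ)W.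
Since test functions separate points, a(γ)v is a primitive of the continuous X-valued curve a(γ)W,
hence differentiable in norm. -/
lemma hasDerivWithinAt_act (H : IsFunctionAction act ι) {γ : ℝ → SimGroup n p} {μ : ℝ → SimAlg n}
    {a b t : ℝ} (ht : t ∈ Icc a b) (hγ : ContinuousOn γ (Icc a b)) (hμ : ContinuousOn μ (Icc a b))
    (hvel : ∀ s ∈ Icc a b, HasVel γ (μ s) (Icc a b) s) {v : X} {W : ℝ → X}
    (hW : ContinuousOn W (Icc a b)) (hgen : ∀ s ∈ Icc a b, WeakGen p ι v (μ s) (W s)) :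
    HasDerivWithinAt (fun τ => act (γ τ) v) (act (γ t) (W t)) (Icc a b) t := by
  have hf := H.continuousOn_act hγ hW
  have key : ∀ τ ∈ Icc a b, act (γ τ) v = act (γ a) v + ∫ s in a..τ, act (γ s) (W s) := by
    intro τ hτ
    refine H.ext_pairing fun ψ hψ => ?_
    obtain ⟨L, hL⟩ := H.pairing ψ hψ
    have hsub : Icc a τ ⊆ Icc a b := Icc_subset_Icc_right hτ.2
    have hi : IntervalIntegrable (fun s => act (γ s) (W s)) volume a τ :=
      (hf.mono (by rw [uIcc_of_le hτ.1]; exact hsub)).intervalIntegrable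
    have hLc : ContinuousOn (fun s => L (act (γ s) v)) (Icc a τ) :=
      L.continuous.comp_continuousOn (H.continuousOn_act (hγ.mono hsub) continuousOn_const)
    have hd : ∀ s ∈ Ioo a τ, HasDerivAt (fun s => L (act (γ s) v)) (L (act (γ s) (W s))) s := by
      intro s hs
      have hs' : s ∈ Icc a b := ⟨hs.1.le, hs.2.le.trans hτ.2⟩
      have h1 := hasDerivAt_pairing (show s ∈ Ioo a b from ⟨hs.1, hs.2.trans_le hτ.2⟩) hγ hμ hvel
        (H.locallyIntegrable v) hψ
      rw [← hgen s hs' _ (hψ.coact (γ s))] at h1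
      simp only [← H.pairing_act, ← hL] at h1
      exact h1
    -- Differentiation under the integral covers interior times; continuity of the pairing takes
    -- care of the endpoints.
    have h2 := intervalIntegral.integral_eq_sub_of_hasDerivAt_of_le hτ.1 hLc hd
      ((L.continuous.comp_continuousOn (hf.mono (by
        rw [uIcc_of_le hτ.1]; exact hsub))).intervalIntegrable)
    rw [L.intervalIntegral_comp_comm hi] at h2
    rw [← hL, ← hL, map_add, h2]
    abel
  have h := (hasDerivWithinAt_integral_Icc hf (left_mem_Icc.mpr (ht.1.trans ht.2)) ht).const_add
    (act (γ a) v)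
  exact h.congr key (key t ht)

end IsFunctionAction

/-! ### Generators -/

lemma IsGen.gen_eq {X : Type} [NormedAddCommGroup X] [NormedSpace ℝ X]
    {act : SimGroup n p → X → X} {v w : X} {μ : SimAlg n} (h : IsGen act v μ w) :
    gen act v μ = w :=
  h.limUnder_eq

lemma MemScal.isGen_gen {X : Type} [NormedAddCommGroup X] [NormedSpace ℝ X]
    {act : SimGroup n p → X → X} {mem : X → Prop} {v : X} (h : MemScal act mem v) (μ : SimAlg n) :
    IsGen act v μ (gen act v μ) := by
  obtain ⟨w, hw⟩ := h.2 μ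
  rwa [hw.gen_eq]

lemma continuousOn_of_hasVel {γ : ℝ → SimGroup n p} {μ : ℝ → SimAlg n} {J : Set ℝ}
    (h : ∀ t ∈ J, HasVel γ (μ t) J t) : ContinuousOn γ J := by
  refine IsInducing.continuousOn_iff ⟨rfl⟩ |>.mpr ?_
  refine ContinuousOn.prodMk (fun t ht => (h t ht).1.continuousWithinAt)
    (ContinuousOn.prodMk ?_ (fun t ht => (h t ht).2.2.continuousWithinAt))
  exact continuousOn_pi.mpr fun i => continuousOn_pi.mpr fun j => fun t ht =>
    ((h t ht).2.1 i j).continuousWithinAt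

section Expand

variable {X : Type} [NormedAddCommGroup X] [NormedSpace ℝ X]

lemma tendsto_expand {α : Type*} {l : Filter α} {G : α → SimAlg n → X} {G₀ : SimAlg n → X}
    {μ : α → SimAlg n} {μ₀ : SimAlg n}
    (h1 : Tendsto (fun a => G a (1, 0, 0)) l (𝓝 (G₀ (1, 0, 0))))
    (h2 : ∀ i j, Tendsto (fun a => G a (0, soBasis i j, 0)) l (𝓝 (G₀ (0, soBasis i j, 0))))
    (h3 : ∀ i, Tendsto (fun a => G a (0, 0, eb i)) l (𝓝 (G₀ (0, 0, eb i))))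
    (hμ : Tendsto μ l (𝓝 μ₀)) : Tendsto (fun a => expand (G a) (μ a)) l (𝓝 (expand G₀ μ₀)) := by
  have hS : ∀ i j, Tendsto (fun a => ((μ a).2.1 : Matrix (Fin n) (Fin n) ℝ) i j) l
      (𝓝 ((μ₀.2.1 : Matrix (Fin n) (Fin n) ℝ) i j)) := fun i j =>
    ((continuous_entry_so i j).tendsto μ₀).comp hμ
  have hw : ∀ i, Tendsto (fun a => (μ a).2.2 i) l (𝓝 (μ₀.2.2 i)) := fun i =>
    ((EuclideanSpace.proj i : Eu n →L[ℝ] ℝ).continuous.tendsto μ₀.2.2).comp hμ.snd_nhds.snd_nhds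
  refine ((hμ.fst_nhds.smul h1).add ?_).add ?_
  · exact tendsto_finsetSum _ fun i _ => tendsto_finsetSum _ fun j _ =>
      ((hS i j).const_mul (1 / 2)).smul (h2 i j)
  · exact tendsto_finsetSum _ fun i _ => (hw i).smul (h3 i)

end Expand

lemma tendsto_adInv {α : Type*} {l : Filter α} {γ : α → SimGroup n p} {γ₀ : SimGroup n p}
    (hγ : Tendsto γ l (𝓝 γ₀)) (μ : SimAlg n) :
    Tendsto (fun a => adInv (γ a) μ) l (𝓝 (adInv γ₀ μ)) :=
  ((continuous_adInv μ).tendsto γ₀).comp hγ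

namespace IsFunctionAction

variable {X : Type} [NormedAddCommGroup X] [NormedSpace ℝ X] [CompleteSpace X]
  {act : SimGroup n p → X → X} {ι : X → Eu n → ℝ}

/-- This is the derivative at time 0 along γ(t) = exp(tμ), with the constant weak generator w. -/
lemma isGen_of_weakGen (H : IsFunctionAction act ι) {v w : X} {μ : SimAlg n}
    (h : WeakGen p ι v μ w) : IsGen act v μ w := by
  have h0 : (0 : ℝ) ∈ Ioo (-1 : ℝ) 1 := by norm_num
  have hvel : ∀ s ∈ Icc (-1 : ℝ) 1, HasVel (fun t : ℝ => gexp p (t • μ)) μ (Icc (-1) 1) s :=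
    fun s _ => (hasVel_gexp μ s).mono (subset_univ _)
  have h1 := (H.hasDerivWithinAt_act (Ioo_subset_Icc_self h0) (continuousOn_of_hasVel hvel)
    continuousOn_const hvel (W := fun _ => w) continuousOn_const fun _ _ => h).hasDerivAt
    (Icc_mem_nhds h0.1 h0.2)
  have h2 := hasDerivAt_iff_tendsto_slope_zero.mp h1
  simp only [zero_add, zero_smul, gexp_zero, H.act_one] at h2
  exact h2

omit [CompleteSpace X] in
-- Pairing with ψ is continuous on X, so the norm limit can be tested and compared with the
-- derivative of the pairing at time 0.
lemma weakGen_of_isGen (H : IsFunctionAction act ι) {v w : X} {μ : SimAlg n}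
    (h : IsGen act v μ w) : WeakGen p ι v μ w := by
  intro ψ hψ
  obtain ⟨L, hL⟩ := H.pairing ψ hψ
  have h0 : (0 : ℝ) ∈ Ioo (-1 : ℝ) 1 := by norm_num
  have hvel : ∀ s ∈ Icc (-1 : ℝ) 1, HasVel (fun t : ℝ => gexp p (t • μ)) μ (Icc (-1) 1) s :=
    fun s _ => (hasVel_gexp μ s).mono (subset_univ _)
  have h1 := hasDerivAt_pairing h0 (continuousOn_of_hasVel hvel) continuousOn_const hvel
    (H.locallyIntegrable v) hψ
  have hc : coact (1 : SimGroup n p) ψ = ψ := by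
    funext y
    simp [coact, jac, pull_symm_apply, aQ_one]
  simp only [← H.pairing_act, ← hL] at h1
  have h2 := hasDerivAt_iff_tendsto_slope_zero.mp h1
  simp only [zero_add, zero_smul, gexp_zero, H.act_one, hc] at h2
  have h3 := (L.continuous.tendsto w).comp h
  rw [← hL]
  refine tendsto_nhds_unique h3 (h2.congr fun t => ?_)
  simp only [Function.comp, map_smul, map_sub]

omit [CompleteSpace X] in
lemma isGen_sub (H : IsFunctionAction act ι) {v v' w w' : X} {μ : SimAlg n}
    (h : IsGen act v μ w) (h' : IsGen act v' μ w') : IsGen act (v - v') μ (w - w') := by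
  refine (Tendsto.sub h h').congr fun t => ?_
  rw [H.act_sub, ← smul_sub]
  congr 1
  abel

/-- Both sides are strong generators by way of the weak ones. This is what lets the finite spanning
family in the norm of Y₁ control T₁a v[μ] for every μ, including a time-dependent one. -/
lemma gen_eq_expand (H : IsFunctionAction act ι) {mem : X → Prop} {v : X}
    (hv : MemScal act mem v) (μ : SimAlg n) : gen act v μ = expand (gen act v) μ :=
  (H.isGen_of_weakGen (H.weakGen_expand (fun μ => H.weakGen_of_isGen (hv.isGen_gen μ)) μ)).gen_eq

lemma isGen_act (H : IsFunctionAction act ι) {mem : X → Prop} {v : X} (hv : MemScal act mem v)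
    (g : SimGroup n p) (μ : SimAlg n) : IsGen act (act g v) μ (act g (gen act v (adInv g μ))) :=
  H.isGen_of_weakGen (H.weakGen_act g (H.weakGen_of_isGen (hv.isGen_gen _)))

/-- Continuity of the generators for a curve that is continuous into the scaled space. -/
lemma tendsto_gen (H : IsFunctionAction act ι) {mem : X → Prop} {N : X → ℝ} (hN : ∀ v, 0 ≤ N v)
    {u : ℝ → X} {J : Set ℝ} (hu : ContIntoScal act mem N u J) {t : ℝ} (ht : t ∈ J)
    {μ : ℝ → SimAlg n} {μ₀ : SimAlg n} (hμ : Tendsto μ (𝓝[J] t) (𝓝 μ₀)) :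
    Tendsto (fun s => gen act (u s) (μ s)) (𝓝[J] t) (𝓝 (gen act (u t) μ₀)) := by
  have hmem : ∀ᶠ s in 𝓝[J] t, MemScal act mem (u s) :=
    eventually_mem_nhdsWithin.mono fun s hs => hu.1 s hs
  -- For ε in the spanning family, ‖T₁a(u(s) - u(t))[ε]‖ is one of the summands of the norm of Y₁.
  have key : ∀ ε : SimAlg n, (∀ v, ‖gen act v ε‖ ≤ scalNorm act N v) →
      Tendsto (fun s => gen act (u s) ε) (𝓝[J] t) (𝓝 (gen act (u t) ε)) := by
    intro ε hε
    rw [← tendsto_sub_nhds_zero_iff]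
    refine squeeze_zero_norm' (hmem.mono fun s hs => ?_) (hu.2 t ht)
    rw [← (H.isGen_sub (hs.isGen_gen ε) ((hu.1 t ht).isGen_gen ε)).gen_eq]
    exact hε _
  have h1 : ∀ v : X, 0 ≤ ‖gen act v (1, 0, 0)‖ := fun v => norm_nonneg _
  have h2 : ∀ v : X, 0 ≤ ∑ i : Fin n, ∑ j : Fin n, ‖gen act v (0, soBasis i j, 0)‖ := fun v =>
    Finset.sum_nonneg fun i _ => Finset.sum_nonneg fun j _ => norm_nonneg _
  have h3 : ∀ v : X, 0 ≤ ∑ i : Fin (n + 1), ‖gen act v (0, 0, eb i)‖ := fun v =>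
    Finset.sum_nonneg fun i _ => norm_nonneg _
  rw [H.gen_eq_expand (hu.1 t ht)]
  refine Tendsto.congr' (hmem.mono fun s hs => (H.gen_eq_expand hs _).symm) ?_
  refine tendsto_expand (key _ fun v => ?_) (fun i j => key _ fun v => ?_) (fun i => key _ fun v => ?_)
    hμ
  · rw [scalNorm]; linarith [hN v, h2 v, h3 v]
  · have h4 : ‖gen act v (0, soBasis i j, 0)‖ ≤
        ∑ i : Fin n, ∑ j : Fin n, ‖gen act v (0, soBasis i j, 0)‖ :=
      (Finset.single_le_sum (f := fun j => ‖gen act v (0, soBasis i j, 0)‖)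
        (fun j _ => norm_nonneg _) (Finset.mem_univ j)).trans
      (Finset.single_le_sum (f := fun i => ∑ j : Fin n, ‖gen act v (0, soBasis i j, 0)‖)
        (fun i _ => Finset.sum_nonneg fun j _ => norm_nonneg _) (Finset.mem_univ i))
    rw [scalNorm]; linarith [hN v, h1 v, h3 v]
  · have h4 : ‖gen act v (0, 0, eb i)‖ ≤ ∑ i : Fin (n + 1), ‖gen act v (0, 0, eb i)‖ :=
      Finset.single_le_sum (f := fun i => ‖gen act v (0, 0, eb i)‖)
        (fun i _ => norm_nonneg _) (Finset.mem_univ i)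
    rw [scalNorm]; linarith [hN v, h1 v, h2 v]

/-- Differentiation of the action along a solution of the reconstruction equation. -/
lemma hasDerivWithinAt_act_tI (H : IsFunctionAction act ι) {mem : X → Prop} {T : EReal}
    {γ : ℝ → SimGroup n p} {μ : ℝ → SimAlg n} (hμ : ContinuousOn μ (tI T))
    (hγ : SolvesGroupODE μ γ (tI T)) {v : X} (hv : MemScal act mem v) {t : ℝ} (ht : t ∈ tI T) :
    HasDerivWithinAt (fun τ => act (γ τ) v) (act (γ t) (gen act v (μ t))) (tI T) t := by
  obtain ⟨b, htb, hb⟩ := exists_gt_mem_tI ht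
  rw [hasDerivWithinAt_congr_nhds (nhdsWithin_tI htb hb)]
  have hsub := Icc_subset_tI hb
  refine H.hasDerivWithinAt_act ⟨ht.1, htb.le⟩ (hγ.continuousOn.mono hsub) (hμ.mono hsub)
    (fun s hs => (hγ.hasVel (hsub hs)).mono hsub) (W := fun s => gen act v (μ s)) ?_
    fun s _ => H.weakGen_of_isGen (hv.isGen_gen _)
  simp only [H.gen_eq_expand hv]
  intro s hs
  exact tendsto_expand tendsto_const_nhds (fun _ _ => tendsto_const_nhds)
    (fun _ => tendsto_const_nhds) (hμ s (hsub hs) |>.mono hsub)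

omit [CompleteSpace X] in
/-- The product rule for the action. -/
lemma hasDerivWithinAt_act_curve (H : IsFunctionAction act ι) {J : Set ℝ} {γ : ℝ → SimGroup n p}
    {t : ℝ} (hγ : ContinuousWithinAt γ J t) {u : ℝ → X} {u' D : X}
    (hu : HasDerivWithinAt u u' J t) (hD : HasDerivWithinAt (fun τ => act (γ τ) (u t)) D J t) :
    HasDerivWithinAt (fun τ => act (γ τ) (u τ)) (D + act (γ t) u') J t := by
  -- The slope of a(γ)u is the slope of a(γ)u(t) plus a(γ(τ)) applied to the slope of u. Joint
  -- continuity handles the second term, so a(γ) need only be differentiable on the single element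
  -- u(t).
  rw [hasDerivWithinAt_iff_tendsto_slope] at hu hD ⊢
  have h1 := H.tendsto_act (hγ.tendsto.mono_left (nhdsWithin_mono t sdiff_subset)) hu
  refine (hD.add h1).congr fun τ => ?_
  rw [slope_def_module, slope_def_module, slope_def_module, H.act_smul, ← smul_add, H.act_sub]
  congr 1
  abel

/-- With w = a(γ(t))⁻¹u one has a(γ(τ))⁻¹u - w = -a(γ(τ))⁻¹(a(γ(τ))w - a(γ(t))w), which reduces the
claim to the derivative of a(γ)w and avoids computing the velocity of γ⁻¹. -/
lemma hasDerivWithinAt_inv_act_tI (H : IsFunctionAction act ι) {mem : X → Prop} {T : EReal}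
    {γ : ℝ → SimGroup n p} {μ : ℝ → SimAlg n} (hμ : ContinuousOn μ (tI T))
    (hγ : SolvesGroupODE μ γ (tI T)) {t : ℝ} (ht : t ∈ tI T) {u : X}
    (hv : MemScal act mem (act (γ t)⁻¹ u)) :
    HasDerivWithinAt (fun τ => act (γ τ)⁻¹ u) (-gen act (act (γ t)⁻¹ u) (μ t)) (tI T) t := by
  have h := H.hasDerivWithinAt_act_tI hμ hγ hv ht
  rw [hasDerivWithinAt_iff_tendsto_slope] at h ⊢
  have hinv : Tendsto (fun τ => (γ τ)⁻¹) (𝓝[tI T \ {t}] t) (𝓝 (γ t)⁻¹) :=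
    (SimGroup.continuous_inv.tendsto _).comp
      ((hγ.continuousOn t ht).tendsto.mono_left (nhdsWithin_mono t sdiff_subset))
  have h1 := (H.tendsto_act hinv h).neg
  rw [H.act_inv_act] at h1
  refine h1.congr fun τ => ?_
  rw [slope_def_module, slope_def_module, H.act_smul, ← smul_neg, H.act_sub, H.act_inv_act,
    H.act_act_inv]
  congr 1
  abel

end IsFunctionAction

/-! ### The transformation between the original and the comoving equation -/

/-- The properties of the action, the smoother space and the vector field that make the freezing
ansatz work. -/
structure IsEquivariantSetting {X : Type} [NormedAddCommGroup X] [NormedSpace ℝ X]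
    (act : SimGroup n p → X → X) (ι : X → Eu n → ℝ) (mem : X → Prop) (N : X → ℝ)
    (isF : X → X → Prop) : Prop extends IsFunctionAction act ι where
  normY_nonneg : ∀ v, 0 ≤ N v
  mem_act : ∀ g v, mem v → mem (act g v)
  norm_tendsto : ∀ (l : Filter ℝ) (γ : ℝ → SimGroup n p) (γ₀ : SimGroup n p) (u : ℝ → X) (u₀ : X),
    mem u₀ → (∀ᶠ i in l, mem (u i)) → Tendsto γ l (𝓝 γ₀) →
    Tendsto (fun i => N (u i - u₀)) l (𝓝 0) →
    Tendsto (fun i => N (act (γ i) (u i) - act γ₀ u₀)) l (𝓝 0)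
  isF_act : ∀ g v f, mem v → isF v f → isF (act g v) (mfac g • act g f)

namespace IsEquivariantSetting

variable {X : Type} [NormedAddCommGroup X] [NormedSpace ℝ X] [CompleteSpace X]
  {act : SimGroup n p → X → X} {ι : X → Eu n → ℝ} {mem : X → Prop} {N : X → ℝ}
  {isF : X → X → Prop}

lemma memScal_act (H : IsEquivariantSetting act ι mem N isF) (g : SimGroup n p) {v : X}
    (hv : MemScal act mem v) : MemScal act mem (act g v) :=
  ⟨H.mem_act g v hv.1, fun μ => ⟨_, H.isGen_act hv g μ⟩⟩

/-- The generator of a(γ)u in the direction ε is a(γ) applied to that of u in the direction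
Ad(γ⁻¹)ε. This direction varies with time, whence the need for `tendsto_gen` with a moving μ. -/
lemma contIntoScal_act (H : IsEquivariantSetting act ι mem N isF) {J : Set ℝ}
    {γ : ℝ → SimGroup n p} {u : ℝ → X} (hγ : ContinuousOn γ J) (hu : ContIntoScal act mem N u J) :
    ContIntoScal act mem N (fun t => act (γ t) (u t)) J := by
  refine ⟨fun t ht => H.memScal_act _ (hu.1 t ht), fun t ht => ?_⟩
  have hmem : ∀ᶠ s in 𝓝[J] t, MemScal act mem (u s) :=
    eventually_mem_nhdsWithin.mono fun s hs => hu.1 s hs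
  have hNu : Tendsto (fun s => N (u s - u t)) (𝓝[J] t) (𝓝 0) := by
    refine squeeze_zero (fun s => H.normY_nonneg _) (fun s => ?_) (hu.2 t ht)
    rw [scalNorm]
    have h1 := norm_nonneg (gen act (u s - u t) (1, 0, 0))
    have h2 : 0 ≤ ∑ i : Fin n, ∑ j : Fin n, ‖gen act (u s - u t) (0, soBasis i j, 0)‖ :=
      Finset.sum_nonneg fun i _ => Finset.sum_nonneg fun j _ => norm_nonneg _
    have h3 : 0 ≤ ∑ i : Fin (n + 1), ‖gen act (u s - u t) (0, 0, eb i)‖ :=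
      Finset.sum_nonneg fun i _ => norm_nonneg _
    linarith
  have hgen : ∀ ε : SimAlg n, Tendsto
      (fun s => ‖gen act (act (γ s) (u s) - act (γ t) (u t)) ε‖) (𝓝[J] t) (𝓝 0) := by
    intro ε
    have h1 := H.tendsto_act (hγ t ht)
      (H.tendsto_gen H.normY_nonneg hu ht (tendsto_adInv (hγ t ht) ε))
    have h2 := (tendsto_sub_nhds_zero_iff.mpr h1).norm
    rw [norm_zero] at h2
    refine h2.congr' (hmem.mono fun s hs => ?_)
    rw [← (H.isGen_sub (H.isGen_act hs (γ s) ε) (H.isGen_act (hu.1 t ht) (γ t) ε)).gen_eq]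
  have h := (((H.norm_tendsto _ γ _ u _ (hu.1 t ht).1 (hmem.mono fun s hs => hs.1) (hγ t ht)
    hNu).add (hgen (1, 0, 0))).add (tendsto_finsetSum Finset.univ fun i _ =>
      tendsto_finsetSum Finset.univ fun j _ => hgen (0, soBasis i j, 0))).add
    (tendsto_finsetSum Finset.univ fun i _ => hgen (0, 0, eb i))
  simp only [Finset.sum_const_zero, add_zero] at h
  exact h

omit [CompleteSpace X] in
lemma contIntoScal_comp {J K : Set ℝ} {u : ℝ → X} {ρ : ℝ → ℝ}
    (hu : ContIntoScal act mem N u J) (hρ : ContinuousOn ρ K) (hm : MapsTo ρ K J) :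
    ContIntoScal act mem N (fun t => u (ρ t)) K :=
  ⟨fun _ ht => hu.1 _ (hm ht), fun t ht => (hu.2 _ (hm ht)).comp
    (tendsto_nhdsWithin_iff.mpr ⟨hρ t ht, eventually_mem_nhdsWithin.mono fun _ hs => hm hs⟩)⟩

lemma mfac_inv (g : SimGroup n p) : mfac g⁻¹ = (mfac g)⁻¹ := by
  rw [mfac, mfac, inv_scale, Real.inv_rpow g.scale_pos.le]

lemma continuous_mfac : Continuous fun g : SimGroup n p => mfac g := continuous_scale_rpow _

/-- From the original to the comoving frame. -/
theorem solvesComoving (H : IsEquivariantSetting act ι mem N isF) {T That : EReal}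
    {μ : ℝ → SimAlg n} (hμ : ContinuousOn μ (tI That)) {g : ℝ → SimGroup n p}
    (hg : SolvesGroupODE μ g (tI That)) {ρ : ℝ → ℝ} (hρ0 : ρ 0 = 0)
    (hρm : MapsTo ρ (tI That) (tI T))
    (hρ : ∀ τ ∈ tI That, HasDerivWithinAt ρ (mfac (g τ))⁻¹ (tI That) τ) {u₀ : X} {u : ℝ → X}
    (hu : SolvesOriginal act mem N isF u₀ T u) :
    SolvesComoving act mem N isF μ u₀ That (fun τ => act (g τ)⁻¹ (u (ρ τ))) := by
  obtain ⟨hu1, hu0, u', ⟨hd, hc⟩, hF⟩ := hu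
  have hgc := hg.continuousOn
  have hinv : ContinuousOn (fun τ => (g τ)⁻¹) (tI That) := SimGroup.continuous_inv.comp_continuousOn hgc
  have hρc : ContinuousOn ρ (tI That) := fun τ hτ => (hρ τ hτ).continuousWithinAt
  have hv := H.contIntoScal_act hinv (contIntoScal_comp hu1 hρc hρm)
  refine ⟨hv, ?_, fun τ => (mfac (g τ))⁻¹ • act (g τ)⁻¹ (u' (ρ τ)) -
    gen act (act (g τ)⁻¹ (u (ρ τ))) (μ τ), ⟨fun τ hτ => ?_, ?_⟩, fun τ hτ => ?_⟩
  · simp only [hg.1, hρ0, hu0, inv_one, H.act_one]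
  · have h1 := HasDerivWithinAt.scomp τ (hd _ (hρm hτ)) (hρ τ hτ) hρm
    have h2 := H.hasDerivWithinAt_act_curve (hinv τ hτ) h1
      (H.hasDerivWithinAt_inv_act_tI hμ hg hτ (hv.1 τ hτ))
    refine h2.congr_deriv ?_
    simp only [H.act_smul, Function.comp]
    abel
  · refine ContinuousOn.sub (ContinuousOn.smul ?_ (H.continuousOn_act hinv (hc.comp hρc hρm)))
      fun τ hτ => H.tendsto_gen H.normY_nonneg hv hτ (hμ τ hτ)
    exact (continuous_mfac.comp_continuousOn hgc).inv₀ fun τ _ => (mfac_pos _).ne'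
  · refine ⟨_, _, ?_, (hv.1 τ hτ).isGen_gen (μ τ), rfl⟩
    -- The speed ρ' = m(g)⁻¹ = m(g⁻¹) is exactly the factor in the equivariance of F under g⁻¹.
    rw [← mfac_inv]
    exact H.isF_act _ _ _ (hu1.1 _ (hρm hτ)).1 (hF _ (hρm hτ))

/-- From the comoving to the original frame. -/
theorem solvesOriginal (H : IsEquivariantSetting act ι mem N isF) {T That : EReal}
    {μ : ℝ → SimAlg n} (hμ : ContinuousOn μ (tI That)) {g : ℝ → SimGroup n p}
    (hg : SolvesGroupODE μ g (tI That)) {σ : ℝ → ℝ} (hσ : SolvesTimeODE That g σ (tI T))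
    {u₀ : X} {v : ℝ → X} (hv : SolvesComoving act mem N isF μ u₀ That v) :
    SolvesOriginal act mem N isF u₀ T (fun t => act (g (σ t)) (v (σ t))) := by
  obtain ⟨hv1, hv0, v', ⟨hd, hc⟩, hF⟩ := hv
  obtain ⟨hσ0, hσm, hσd, hσc'⟩ := hσ
  have hgc := hg.continuousOn
  have hσc : ContinuousOn σ (tI T) := fun t ht => (hσd t ht).continuousWithinAt
  have hgσ : ContinuousOn (fun t => g (σ t)) (tI T) := hgc.comp hσc hσm
  refine ⟨H.contIntoScal_act hgσ (contIntoScal_comp hv1 hσc hσm), ?_, fun t => mfac (g (σ t)) •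
    act (g (σ t)) (v' (σ t) + gen act (v (σ t)) (μ (σ t))), ⟨fun t ht => ?_, ?_⟩, fun t ht => ?_⟩
  · simp only [hσ0, hg.1, hv0, H.act_one]
  · have h1 := H.hasDerivWithinAt_act_curve (hgc _ (hσm ht)) (hd _ (hσm ht))
      (H.hasDerivWithinAt_act_tI hμ hg (hv1.1 _ (hσm ht)) (hσm ht))
    refine (HasDerivWithinAt.scomp t h1 (hσd t ht) hσm).congr_deriv ?_
    simp only [H.act_add]
    rw [add_comm (act _ (v' _))]
  · refine ContinuousOn.smul hσc' (H.continuousOn_act hgσ ?_)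
    have h1 : ContinuousOn (fun τ => gen act (v τ) (μ τ)) (tI That) := fun τ hτ =>
      H.tendsto_gen H.normY_nonneg hv1 hτ (hμ τ hτ)
    exact (hc.comp hσc hσm).add (h1.comp hσc hσm)
  · obtain ⟨f, w, hf, hw, hfw⟩ := hF _ (hσm ht)
    -- The generator produced by differentiating a(g) cancels the one in the comoving equation and
    -- leaves F(v).
    have h1 : v' (σ t) + gen act (v (σ t)) (μ (σ t)) = f := by
      rw [hw.gen_eq, hfw]; abel
    simp only [h1]
    exact H.isF_act _ _ _ (hv1.1 _ (hσm ht)).1 hf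

end IsEquivariantSetting

/-! ### The action on continuous functions vanishing at infinity -/

/-- Convergence is uniform on compact sets by joint continuity, and off a compact set both terms are
small uniformly in g. -/
lemma eventually_forall_norm_sub_lt {G E F : Type*} [TopologicalSpace G] [TopologicalSpace E]
    [NormedAddCommGroup F] {H : G → E → F} (hH : Continuous fun z : G × E => H z.1 z.2) {g₀ : G}
    (h0 : ∀ ε > 0, ∃ K : Set E, IsCompact K ∧ ∀ᶠ g in 𝓝 g₀, ∀ x ∉ K, ‖H g x‖ < ε) {ε : ℝ}
    (hε : 0 < ε) : ∀ᶠ g in 𝓝 g₀, ∀ x, ‖H g x - H g₀ x‖ < ε := by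
  obtain ⟨K, hK, hKε⟩ := h0 (ε / 2) (half_pos hε)
  have h1 : ∀ᶠ g in 𝓝 g₀, ∀ x ∈ K, ‖H g x - H g₀ x‖ < ε := by
    refine hK.eventually_forall_of_forall_eventually fun y _ => ?_
    have hc : Continuous fun z : G × E => ‖H z.1 z.2 - H g₀ z.2‖ :=
      (hH.sub (hH.comp (continuous_const.prodMk continuous_snd))).norm
    refine hc.continuousAt.eventually_lt_const ?_
    simpa using hε
  filter_upwards [h1, hKε] with g hg1 hg2 x
  by_cases hx : x ∈ K
  · exact hg1 x hx
  · calc ‖H g x - H g₀ x‖ ≤ ‖H g x‖ + ‖H g₀ x‖ := norm_sub_le _ _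
      _ < ε / 2 + ε / 2 := add_lt_add (hg2 x hx) (hKε.self_of_nhds x hx)
      _ = ε := add_halves ε

lemma norm_lin_apply (g : SimGroup n p) (y : Eu n) : ‖g.lin y‖ = g.scale ^ (1 - p) * ‖y‖ := by
  rw [lin_apply, norm_smul, norm_oprAQinv, Real.norm_of_nonneg (Real.rpow_nonneg g.scale_pos.le _)]

lemma norm_lin_le (g : SimGroup n p) : ‖(g.lin : Eu n →L[ℝ] Eu n)‖ ≤ g.scale ^ (1 - p) :=
  ContinuousLinearMap.opNorm_le_bound _ (Real.rpow_nonneg g.scale_pos.le _)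
    fun y => (norm_lin_apply g y).le

/-- Functions that vanish at infinity do so uniformly under nearby coordinate changes. -/
lemma exists_isCompact_norm_lt {F : Type*} [NormedAddCommGroup F] {Φ : Eu n → F}
    (hΦ : Tendsto Φ (cocompact (Eu n)) (𝓝 0)) {H : SimGroup n p → Eu n → F}
    {M : SimGroup n p → ℝ} (hM : Continuous M) (hHM : ∀ g x, ‖H g x‖ ≤ M g * ‖Φ (g.pull x)‖)
    (g₀ : SimGroup n p) {ε : ℝ} (hε : 0 < ε) :
    ∃ K : Set (Eu n), IsCompact K ∧ ∀ᶠ g in 𝓝 g₀, ∀ x ∉ K, ‖H g x‖ < ε := by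
  have hδ : 0 < ε / (|M g₀| + 1) := by positivity
  have h1 := hΦ.norm.eventually_lt_const (lt_of_eq_of_lt norm_zero hδ)
  rw [Metric.cobounded_eq_cocompact.symm, ← comap_norm_atTop,
    (atTop_basis.comap _).eventually_iff] at h1
  obtain ⟨R, -, hR⟩ := h1
  have hc : 0 < g₀.scale ^ (1 - p) := Real.rpow_pos_of_pos g₀.scale_pos _
  -- Near g₀ the ratio exceeds half that of g₀ and ‖b‖ is below ‖b₀‖ + 1, so outside this ball
  -- ‖`g.pull x`‖ ≥ R. The modulus is there because R may be negative.
  refine ⟨Metric.closedBall 0 (|R| / (g₀.scale ^ (1 - p) / 2) + (‖g₀.trans‖ + 1)),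
    isCompact_closedBall _ _, ?_⟩
  have e1 : ∀ᶠ g : SimGroup n p in 𝓝 g₀, g₀.scale ^ (1 - p) / 2 < g.scale ^ (1 - p) :=
    (continuous_scale_rpow (1 - p)).continuousAt.eventually_const_lt (half_lt_self hc)
  have e2 : ∀ᶠ g : SimGroup n p in 𝓝 g₀, ‖g.trans‖ < ‖g₀.trans‖ + 1 :=
    continuous_trans.norm.continuousAt.eventually_lt_const (lt_add_one _)
  have e3 : ∀ᶠ g : SimGroup n p in 𝓝 g₀, M g < |M g₀| + 1 :=
    hM.continuousAt.eventually_lt_const ((le_abs_self _).trans_lt (lt_add_one _))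
  filter_upwards [e1, e2, e3] with g h1 h2 h3 x hx
  have hx' : |R| / (g₀.scale ^ (1 - p) / 2) + (‖g₀.trans‖ + 1) < ‖x‖ := by
    simpa using hx
  have h4 : |R| / (g₀.scale ^ (1 - p) / 2) < ‖x - g.trans‖ := by
    linarith [norm_sub_norm_le x g.trans]
  have h5 : R ≤ ‖g.pull x‖ := by
    rw [pull_eq, norm_lin_apply]
    rw [div_lt_iff₀ (half_pos hc)] at h4
    nlinarith [norm_nonneg (x - g.trans), le_abs_self R]
  have h6 : ‖Φ (g.pull x)‖ < ε / (|M g₀| + 1) := hR h5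
  rw [lt_div_iff₀ (by positivity)] at h6
  have h7 := hHM g x
  nlinarith [norm_nonneg (Φ (g.pull x))]

lemma norm_coe_le (v : XC n) (x : Eu n) : ‖v x‖ ≤ ‖v‖ := v.toBCF.norm_coe_le_norm x

lemma norm_le_of_forall {v : XC n} {C : ℝ} (hC : 0 ≤ C) (h : ∀ x, ‖v x‖ ≤ C) : ‖v‖ ≤ C :=
  (v.toBCF.norm_le hC).mpr h

lemma coe_actC (g : SimGroup n p) (v : XC n) : ⇑(actC g v) = g.actFun v := rfl

lemma norm_actFun (g : SimGroup n p) (v : Eu n → ℝ) (x : Eu n) :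
    ‖g.actFun v x‖ = g.scale⁻¹ * ‖v (g.pull x)‖ := by
  rw [actFun, norm_mul, Real.norm_of_nonneg (inv_nonneg.mpr g.scale_pos.le)]

lemma continuous_actC (v : XC n) : Continuous fun g : SimGroup n p => actC g v := by
  refine continuous_iff_continuousAt.mpr fun g₀ => ?_
  rw [ContinuousAt, ZeroAtInftyContinuousMap.tendsto_iff_tendstoUniformly,
    Metric.tendstoUniformly_iff]
  intro ε hε
  have hc : Continuous fun z : SimGroup n p × Eu n => z.1.actFun v z.2 :=
    (continuous_scale_inv.comp continuous_fst).mul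
      (v.continuous.comp (continuous_pull_comp continuous_fst continuous_snd))
  filter_upwards [eventually_forall_norm_sub_lt hc (fun δ hδ => exists_isCompact_norm_lt
    (zero_at_infty v) continuous_scale_inv (fun g x => (norm_actFun g v x).le) g₀ hδ) hε] with g hg x
  rw [dist_comm, dist_eq_norm]
  exact hg x

lemma exists_pairing_C {ψ : Eu n → ℝ} (hψ : Continuous ψ) (hψ2 : HasCompactSupport ψ) :
    ∃ L : XC n →L[ℝ] ℝ, ∀ v, L v = ∫ y, v y * ψ y := by
  have hi : ∀ v : XC n, Integrable fun y => v y * ψ y := fun v =>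
    integrable_mul_of_hasCompactSupport v.continuous.locallyIntegrable hψ hψ2
  have hψi : Integrable ψ := hψ.integrable_of_hasCompactSupport hψ2
  refine ⟨LinearMap.mkContinuous
    { toFun := fun v => ∫ y, v y * ψ y
      map_add' := fun v w => ?_
      map_smul' := fun c v => ?_ } (∫ y, ‖ψ y‖) fun v => ?_, fun v => rfl⟩
  · rw [← integral_add (hi v) (hi w)]
    exact integral_congr_ae (Eventually.of_forall fun y => add_mul _ _ _)
  · rw [RingHom.id_apply, smul_eq_mul, ← integral_const_mul]
    exact integral_congr_ae (Eventually.of_forall fun y => mul_assoc _ _ _)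
  · rw [mul_comm, ← integral_const_mul]
    refine norm_integral_le_of_norm_le (hψi.norm.const_mul _) (Eventually.of_forall fun y => ?_)
    rw [norm_mul]
    exact mul_le_mul_of_nonneg_right (norm_coe_le v y) (norm_nonneg _)

lemma isFunctionAction_actC :
    IsFunctionAction (actC (n := n) (p := p)) (fun v => (v : Eu n → ℝ)) where
  locallyIntegrable v := v.continuous.locallyIntegrable
  act_ae _ _ := EventuallyEq.rfl
  bound := ⟨fun g => g.scale⁻¹, continuous_scale_inv, fun g v =>
    norm_le_of_forall (mul_nonneg (inv_nonneg.mpr g.scale_pos.le) (norm_nonneg _)) fun x => by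
      rw [coe_actC, norm_actFun]
      exact mul_le_mul_of_nonneg_left (norm_coe_le v _) (inv_nonneg.mpr g.scale_pos.le)⟩
  continuous := continuous_actC
  pairing _ hψ := exists_pairing_C hψ.1.continuous hψ.2
  separating v h := by
    have h1 : (v : Eu n → ℝ) =ᵐ[volume] 0 :=
      ae_eq_zero_of_integral_contDiff_smul_eq_zero v.continuous.locallyIntegrable
        fun ψ hψ hψ' => by simpa only [smul_eq_mul, mul_comm] using h ψ ⟨hψ, hψ'⟩
    exact DFunLike.coe_injective (v.continuous.ae_eq_iff_eq volume continuous_const |>.mp h1)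

/-! ### Derivatives up to order two -/

/-- The transformation of the `k`-th derivative under the action. -/
def actDeriv (k : ℕ) (Φ : Eu n → ContinuousMultilinearMap ℝ (fun _ : Fin k => Eu n) ℝ)
    (g : SimGroup n p) (x : Eu n) : ContinuousMultilinearMap ℝ (fun _ : Fin k => Eu n) ℝ :=
  g.scale⁻¹ • (Φ (g.pull x)).compContinuousLinearMap fun _ => (g.lin : Eu n →L[ℝ] Eu n)

lemma iteratedFDeriv_actFun {k : ℕ} (g : SimGroup n p) {v : Eu n → ℝ} (hv : ContDiff ℝ k v)
    (x : Eu n) : iteratedFDeriv ℝ k (g.actFun v) x = actDeriv k (iteratedFDeriv ℝ k v) g x := by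
  have h1 : g.actFun v = g.scale⁻¹ • fun x => (v ∘ g.lin) (x - g.trans) := rfl
  have h2 : ContDiff ℝ k fun x => (v ∘ g.lin) (x - g.trans) :=
    hv.comp (g.lin.contDiff.comp (contDiff_id.sub contDiff_const))
  rw [h1, iteratedFDeriv_const_smul_apply h2.contDiffAt, iteratedFDeriv_comp_sub]
  exact congrArg _ (ContinuousLinearMap.iteratedFDeriv_comp_right (g.lin : Eu n →L[ℝ] Eu n) hv _
    le_rfl)

lemma norm_actDeriv_le {k : ℕ} (Φ : Eu n → ContinuousMultilinearMap ℝ (fun _ : Fin k => Eu n) ℝ)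
    (g : SimGroup n p) (x : Eu n) :
    ‖actDeriv k Φ g x‖ ≤ g.scale⁻¹ * (g.scale ^ (1 - p)) ^ k * ‖Φ (g.pull x)‖ := by
  rw [actDeriv, norm_smul, Real.norm_of_nonneg (inv_nonneg.mpr g.scale_pos.le), mul_assoc]
  refine mul_le_mul_of_nonneg_left ?_ (inv_nonneg.mpr g.scale_pos.le)
  refine (ContinuousMultilinearMap.norm_compContinuousLinearMap_le _ _).trans ?_
  rw [mul_comm, Finset.prod_const, Finset.card_univ, Fintype.card_fin]
  exact mul_le_mul_of_nonneg_right (pow_le_pow_left₀ (norm_nonneg _) (norm_lin_le g) k)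
    (norm_nonneg _)

lemma continuous_derivBound (k : ℕ) :
    Continuous fun g : SimGroup n p => g.scale⁻¹ * (g.scale ^ (1 - p)) ^ k :=
  continuous_scale_inv.mul ((continuous_scale_rpow _).pow k)

lemma continuous_actDeriv {k : ℕ}
    {Φ : Eu n → ContinuousMultilinearMap ℝ (fun _ : Fin k => Eu n) ℝ} (hΦ : Continuous Φ) :
    Continuous fun z : SimGroup n p × Eu n => actDeriv k Φ z.1 z.2 := by
  have h1 : Continuous fun g : SimGroup n p => (g.lin : Eu n →L[ℝ] Eu n) :=
    (continuous_scale_rpow (1 - p)).smul continuous_oprAQinv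
  have h2 : Continuous fun z : SimGroup n p × Eu n =>
      ContinuousMultilinearMap.compContinuousLinearMapContinuousMultilinear ℝ
        (fun _ : Fin k => Eu n) (fun _ : Fin k => Eu n) ℝ
        (fun _ => (z.1.lin : Eu n →L[ℝ] Eu n)) :=
    (ContinuousMultilinearMap.cont _).comp (continuous_pi fun _ => h1.comp continuous_fst)
  exact (continuous_scale_inv.comp continuous_fst).smul
    (h2.clm_apply (hΦ.comp (continuous_pull_comp continuous_fst continuous_snd)))

lemma tendsto_actDeriv {k : ℕ}
    {Φ : Eu n → ContinuousMultilinearMap ℝ (fun _ : Fin k => Eu n) ℝ}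
    (hΦ0 : Tendsto Φ (cocompact (Eu n)) (𝓝 0)) (g : SimGroup n p) :
    Tendsto (actDeriv k Φ g) (cocompact (Eu n)) (𝓝 0) := by
  have h1 := (hΦ0.comp g.pull.isClosedEmbedding.tendsto_cocompact).norm.const_mul
    (g.scale⁻¹ * (g.scale ^ (1 - p)) ^ k)
  rw [norm_zero, mul_zero] at h1
  exact squeeze_zero_norm (norm_actDeriv_le Φ g) h1

lemma MemC2.contDiff {v : XC n} (hv : MemC2 v) {k : ℕ} (hk : k ≤ 2) : ContDiff ℝ k v :=
  hv.1.of_le (by exact_mod_cast hk)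

lemma MemC2.continuous_iteratedFDeriv {v : XC n} (hv : MemC2 v) {k : ℕ} (hk : k ≤ 2) :
    Continuous (iteratedFDeriv ℝ k v) :=
  hv.1.continuous_iteratedFDeriv (by exact_mod_cast hk)

lemma MemC2.act (g : SimGroup n p) {v : XC n} (hv : MemC2 v) : MemC2 (actC g v) := by
  refine ⟨contDiff_const.mul (hv.1.comp (contDiff_pull g)), fun k hk => ?_⟩
  refine (tendsto_actDeriv (hv.2 k hk) g).congr fun x => ?_
  rw [coe_actC, iteratedFDeriv_actFun g (hv.contDiff hk)]

lemma MemC2.sub {v w : XC n} (hv : MemC2 v) (hw : MemC2 w) : MemC2 (v - w) := by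
  refine ⟨hv.1.sub hw.1, fun k hk => ?_⟩
  rw [ZeroAtInftyContinuousMap.coe_sub, iteratedFDeriv_sub (hv.contDiff hk) (hw.contDiff hk)]
  simpa using (hv.2 k hk).sub (hw.2 k hk)

lemma MemC2.norm_iteratedFDeriv_le {v : XC n} (hv : MemC2 v) {k : ℕ} (hk : k ≤ 2) (x : Eu n) :
    ‖iteratedFDeriv ℝ k v x‖ ≤ normC2 v := by
  let Ψ : C₀(Eu n, ContinuousMultilinearMap ℝ (fun _ : Fin k => Eu n) ℝ) :=
    ⟨⟨iteratedFDeriv ℝ k v, hv.continuous_iteratedFDeriv hk⟩, hv.2 k hk⟩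
  -- A real supremum over an unbounded family would have the default value 0; decay at infinity
  -- makes the derivative bounded, so that the supremum is a true bound.
  have hb : BddAbove (range fun x => ‖iteratedFDeriv ℝ k v x‖) :=
    ⟨‖Ψ.toBCF‖, by rintro _ ⟨y, rfl⟩; exact Ψ.toBCF.norm_coe_le_norm y⟩
  refine (le_ciSup hb x).trans (Finset.single_le_sum
    (f := fun k => ⨆ x, ‖iteratedFDeriv ℝ k v x‖) (fun j _ => ?_) (Finset.mem_range.mpr (by omega)))
  exact Real.iSup_nonneg fun _ => norm_nonneg _

lemma normC2_nonneg (v : XC n) : 0 ≤ normC2 v :=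
  Finset.sum_nonneg fun _ _ => Real.iSup_nonneg fun _ => norm_nonneg _

/-- Split the difference as a(γ)(u - u₀) + (a(γ)u₀ - a(γ₀)u₀). The first part is controlled by the
operator bound on derivatives, the second by uniform continuity of the action on the derivatives of
the fixed u₀. -/
lemma tendsto_normC2_actC {l : Filter ℝ} {γ : ℝ → SimGroup n p} {γ₀ : SimGroup n p}
    {u : ℝ → XC n} {u₀ : XC n} (hu₀ : MemC2 u₀) (hu : ∀ᶠ i in l, MemC2 (u i))
    (hγ : Tendsto γ l (𝓝 γ₀)) (h : Tendsto (fun i => normC2 (u i - u₀)) l (𝓝 0)) :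
    Tendsto (fun i => normC2 (actC (γ i) (u i) - actC γ₀ u₀)) l (𝓝 0) := by
  have key : ∀ k ∈ Finset.range 3, Tendsto
      (fun i => ⨆ x, ‖iteratedFDeriv ℝ k (actC (γ i) (u i) - actC γ₀ u₀ : XC n) x‖) l (𝓝 0) := by
    intro k hk3
    have hk : k ≤ 2 := by have := Finset.mem_range.mp hk3; omega
    have hM : Tendsto (fun i => (γ i).scale⁻¹ * ((γ i).scale ^ (1 - p)) ^ k * normC2 (u i - u₀)) l
        (𝓝 0) := by
      simpa using (((continuous_derivBound k).tendsto γ₀).comp hγ).mul h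
    rw [Metric.tendsto_nhds]
    intro ε hε
    -- Each part gets ε/4: the pointwise bound ε/2 passes to the supremum and stays strictly below
    -- ε.
    have h1 := hM.eventually_lt_const (half_pos (half_pos hε))
    have h2 := hγ.eventually (eventually_forall_norm_sub_lt
      (continuous_actDeriv (p := p) (hu₀.continuous_iteratedFDeriv hk)) (fun δ hδ =>
        exists_isCompact_norm_lt (hu₀.2 k hk) (continuous_derivBound k)
          (norm_actDeriv_le (iteratedFDeriv ℝ k u₀)) γ₀ hδ) (half_pos (half_pos hε)))
    filter_upwards [h1, h2, hu] with i hi1 hi2 hui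
    have h3 : ∀ x, ‖iteratedFDeriv ℝ k (actC (γ i) (u i) - actC γ₀ u₀ : XC n) x‖ ≤ ε / 2 := by
      intro x
      have hd := hui.sub hu₀
      have e1 : (actC (γ i) (u i) - actC γ₀ u₀ : XC n) =
          actC (γ i) (u i - u₀) + (actC (γ i) u₀ - actC γ₀ u₀) := by
        rw [isFunctionAction_actC.act_sub]; abel
      have hA := hd.act (γ i)
      have hB := (hu₀.act (γ i)).sub (hu₀.act γ₀)
      rw [e1, ZeroAtInftyContinuousMap.coe_add, iteratedFDeriv_add_apply
        (hA.contDiff hk).contDiffAt (hB.contDiff hk).contDiffAt, ZeroAtInftyContinuousMap.coe_sub,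
        iteratedFDeriv_sub_apply ((hu₀.act (γ i)).contDiff hk).contDiffAt
        ((hu₀.act γ₀).contDiff hk).contDiffAt, coe_actC, coe_actC, coe_actC,
        iteratedFDeriv_actFun _ (hd.contDiff hk), iteratedFDeriv_actFun _ (hu₀.contDiff hk),
        iteratedFDeriv_actFun _ (hu₀.contDiff hk)]
      refine (norm_add_le _ _).trans ?_
      have h4 := norm_actDeriv_le (iteratedFDeriv ℝ k (u i - u₀ : XC n)) (γ i) x
      have h5 := mul_le_mul_of_nonneg_left (hd.norm_iteratedFDeriv_le hk ((γ i).pull x))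
        (mul_nonneg (inv_nonneg.mpr (γ i).scale_pos.le)
          (pow_nonneg (Real.rpow_nonneg (γ i).scale_pos.le (1 - p)) k))
      linarith [hi2 x]
    rw [Real.dist_0_eq_abs, abs_of_nonneg (Real.iSup_nonneg fun _ => norm_nonneg _)]
    exact (ciSup_le h3).trans_lt (half_lt_self hε)
  have h := tendsto_finsetSum _ key
  rw [Finset.sum_const_zero] at h
  exact h

/-! ### Equivariance of the vector field -/

/-- Rotations act only on the other coordinates, so e₁ is merely scaled. This is why ∂₁ transforms
into a multiple of itself. -/
lemma lin_eb_zero (g : SimGroup n p) : g.lin (eb 0) = g.scale ^ (1 - p) • (eb 0 : Eu n) := by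
  rw [lin_apply]
  congr 1
  ext i
  rw [opr, Matrix.ofLp_toEuclideanCLM]
  refine Fin.cases ?_ (fun i => ?_) i <;> simp [aQinv, aug, Matrix.mulVec_single]

lemma pull_add (g : SimGroup n p) (x y : Eu n) : g.pull (x + y) = g.pull x + g.lin y := by
  rw [pull_eq, pull_eq, add_sub_right_comm, map_add]

/-- The Laplacian is independent of the orthonormal basis: at the image point it is computed in the
rotated basis, and the scaling contributes its ratio squared. -/
lemma laplacian_actFun (g : SimGroup n p) {v : Eu n → ℝ} (hv : ContDiff ℝ 2 v) (x : Eu n) :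
    Δ (g.actFun v) x = g.scale⁻¹ * (g.scale ^ (1 - p)) ^ 2 * Δ v (g.pull x) := by
  let b := EuclideanSpace.basisFun (Fin (n + 1)) ℝ
  rw [InnerProductSpace.laplacian_eq_iteratedFDeriv_orthonormalBasis _ b,
    InnerProductSpace.laplacian_eq_iteratedFDeriv_orthonormalBasis _ (b.map (rotEquiv g)),
    Finset.mul_sum]
  refine Finset.sum_congr rfl fun i _ => ?_
  have h1 := iteratedFDeriv_actFun (k := 2) g hv x
  rw [h1, actDeriv]
  have h2 := (iteratedFDeriv ℝ 2 v (g.pull x)).map_smul_univ (fun _ => g.scale ^ (1 - p))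
    ![rotEquiv g (b i), rotEquiv g (b i)]
  rw [Finset.prod_const, Finset.card_univ, Fintype.card_fin, smul_eq_mul] at h2
  rw [OrthonormalBasis.map_apply, mul_assoc, ← h2]
  have h3 : (fun j : Fin 2 => g.lin (![b i, b i] j)) =
      fun j => g.scale ^ (1 - p) • ![rotEquiv g (b i), rotEquiv g (b i)] j := by
    funext j
    fin_cases j <;> rfl
  rw [← h3]
  rfl

/-- Along a line both sides differentiate the same function of one variable up to the factor c, so
no differentiability is required. -/
lemma lineDeriv_comp_pull (g : SimGroup n p) (c : ℝ) (w : Eu n → ℝ) (x y : Eu n) :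
    lineDeriv ℝ (fun z => c * w (g.pull z)) x y = c * lineDeriv ℝ w (g.pull x) (g.lin y) := by
  simp only [lineDeriv, pull_add, map_smul]
  exact deriv_const_mul_field c

lemma abs_actFun_rpow (g : SimGroup n p) (v : Eu n → ℝ) (x : Eu n) :
    |g.actFun v x| ^ p = g.scale ^ (-p) * |v (g.pull x)| ^ p := by
  rw [actFun, abs_mul, abs_of_pos (inv_pos.mpr g.scale_pos),
    Real.mul_rpow (inv_nonneg.mpr g.scale_pos.le) (abs_nonneg _), Real.inv_rpow g.scale_pos.le,
    Real.rpow_neg g.scale_pos.le]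

lemma mfac_mul_scale_inv (g : SimGroup n p) :
    mfac g * g.scale⁻¹ = g.scale⁻¹ * (g.scale ^ (1 - p)) ^ 2 := by
  rw [mfac, mul_comm, ← Real.rpow_natCast, ← Real.rpow_mul g.scale_pos.le]
  congr 2
  push_cast
  ring

/-- The power |v|^p contributes α^(-p) and ∂₁ contributes α^(1-p); the product matches the factor of
the diffusion term. This balance fixes the exponent in the spatial scaling. -/
lemma scale_rpow_neg_mul (g : SimGroup n p) :
    g.scale ^ (-p) * g.scale ^ (1 - p) = mfac g * g.scale⁻¹ := by
  rw [mfac, ← Real.rpow_neg_one, ← Real.rpow_add g.scale_pos, ← Real.rpow_add g.scale_pos]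
  congr 1
  ring

lemma isFC_actC {ν s : ℝ} (g : SimGroup n p) {v f : XC n} (hv : MemC2 v) (h : IsFC p ν s v f) :
    IsFC p ν s (actC g v) (mfac g • actC g f) := by
  intro x
  rw [ZeroAtInftyContinuousMap.smul_apply, smul_eq_mul, coe_actC, coe_actC,
    laplacian_actFun g hv.1]
  simp only [abs_actFun_rpow]
  rw [lineDeriv_comp_pull g _ fun y => |v y| ^ p, lin_eb_zero, lineDeriv_smul, smul_eq_mul,
    ← mul_assoc (g.scale ^ (-p)), scale_rpow_neg_mul, ← mfac_mul_scale_inv, actFun, h]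
  ring

theorem isEquivariantSetting_C (ν s : ℝ) :
    IsEquivariantSetting (actC (n := n) (p := p)) (fun v => (v : Eu n → ℝ)) MemC2 normC2
      (IsFC p ν s) where
  toIsFunctionAction := isFunctionAction_actC
  normY_nonneg := normC2_nonneg
  mem_act g _ hv := hv.act g
  norm_tendsto _ _ _ _ _ hu₀ hu hγ h := tendsto_normC2_actC hu₀ hu hγ h
  isF_act g _ _ hv h := isFC_actC g hv h

lemma IsFunctionAction.act_sum {X : Type} [NormedAddCommGroup X] [NormedSpace ℝ X]
    {act : SimGroup n p → X → X} {ι : X → Eu n → ℝ} (H : IsFunctionAction act ι)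
    (g : SimGroup n p) {κ : Type*} (s : Finset κ) (v : κ → X) :
    act g (∑ i ∈ s, v i) = ∑ i ∈ s, act g (v i) :=
  map_sum (AddMonoidHom.mk' (act g) (H.act_add g)) v s

/-! ### The action on square integrable functions -/

lemma inner_eq_integral (v w : XL n) : inner ℝ v w = ∫ x, v x * w x := by
  rw [L2.inner_def]
  exact integral_congr_ae (Eventually.of_forall fun x => by simp [mul_comm])

lemma norm_sq_eq_integral (v : XL n) : ‖v‖ ^ 2 = ∫ x, v x * v x := by
  rw [← real_inner_self_eq_norm_sq, inner_eq_integral]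

lemma coeFn_actL (g : SimGroup n p) (v : XL n) : actL g v =ᵐ[volume] g.actFun v :=
  (memLp_actFun g v).coeFn_toLp

lemma actFun_congr_ae (g : SimGroup n p) {v w : Eu n → ℝ} (h : v =ᵐ[volume] w) :
    g.actFun v =ᵐ[volume] g.actFun w :=
  ((quasiMeasurePreserving_pull g).ae_eq_comp h).fun_comp fun y => g.scale⁻¹ * y

/-- Proved directly from representatives, because it is used in the strong continuity that enters
`isFunctionAction_actL`. -/
lemma actL_sub (g : SimGroup n p) (v w : XL n) : actL g (v - w) = actL g v - actL g w := by
  refine Lp.ext ?_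
  filter_upwards [coeFn_actL g (v - w), coeFn_actL g v, coeFn_actL g w,
    actFun_congr_ae g (Lp.coeFn_sub v w), Lp.coeFn_sub (actL g v) (actL g w)] with x h1 h2 h3 h4 h5
  rw [h1, h4, h5, Pi.sub_apply, h2, h3]
  exact mul_sub _ _ _

/-- The factor by which the action changes the `L²`-norm. -/
def normFactor (g : SimGroup n p) : ℝ := g.scale⁻¹ * √(jac g)

lemma continuous_normFactor : Continuous fun g : SimGroup n p => normFactor g :=
  continuous_scale_inv.mul continuous_jac.sqrt

lemma normFactor_nonneg (g : SimGroup n p) : 0 ≤ normFactor g :=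
  mul_nonneg (inv_nonneg.mpr g.scale_pos.le) (Real.sqrt_nonneg _)

lemma norm_actL (g : SimGroup n p) (v : XL n) : ‖actL g v‖ = normFactor g * ‖v‖ := by
  rw [← sq_eq_sq₀ (norm_nonneg _) (mul_nonneg (normFactor_nonneg g) (norm_nonneg _)), mul_pow,
    norm_sq_eq_integral, norm_sq_eq_integral, normFactor, mul_pow, Real.sq_sqrt (jac_pos g).le,
    mul_assoc]
  refine (integral_congr_ae ((coeFn_actL g v).mul (coeFn_actL g v))).trans ?_
  have h := integral_comp_pull g fun y => v y * v y
  rw [smul_eq_mul] at h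
  rw [← h, ← integral_const_mul]
  exact integral_congr_ae (Eventually.of_forall fun x => by
    simp only [Pi.mul_apply, actFun]; ring)

lemma continuous_actFun_of_continuous (g : SimGroup n p) {φ : Eu n → ℝ} (hφ : Continuous φ) :
    Continuous (g.actFun φ) :=
  continuous_const.mul (hφ.comp g.pull.continuous)

lemma hasCompactSupport_actFun (g : SimGroup n p) {φ : Eu n → ℝ} (hφ : HasCompactSupport φ) :
    HasCompactSupport (g.actFun φ) :=
  (hφ.comp_homeomorph g.pull).mul_left

/-- A Hilbert space argument: ‖a(g)v - a(g₀)v‖² is expanded, the norms are explicit in g, and the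
inner product is a fixed continuous functional of the C₀-action on φ, which is already known to be
continuous in g. -/
lemma tendsto_actL_of_hasCompactSupport (g₀ : SimGroup n p) {v : XL n} {φ : Eu n → ℝ}
    (hφ : Continuous φ) (hφ2 : HasCompactSupport φ) (hv : v =ᵐ[volume] φ) :
    Tendsto (fun g => actL g v) (𝓝 g₀) (𝓝 (actL g₀ v)) := by
  let Φ : XC n := ⟨⟨φ, hφ⟩, hφ2.is_zero_at_infty⟩
  obtain ⟨L, hL⟩ := exists_pairing_C (continuous_actFun_of_continuous g₀ hφ)
    (hasCompactSupport_actFun g₀ hφ2)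
  have hinner : ∀ g : SimGroup n p, inner ℝ (actL g v) (actL g₀ v) = L (actC g Φ) := by
    intro g
    rw [inner_eq_integral, hL]
    exact integral_congr_ae (((coeFn_actL g v).trans (actFun_congr_ae g hv)).mul
      ((coeFn_actL g₀ v).trans (actFun_congr_ae g₀ hv)))
  have h1 : Tendsto (fun g : SimGroup n p => ‖actL g v - actL g₀ v‖ ^ 2) (𝓝 g₀) (𝓝 0) := by
    have h2 : Continuous fun g : SimGroup n p =>
        (normFactor g * ‖v‖) ^ 2 - 2 * L (actC g Φ) + ‖actL g₀ v‖ ^ 2 :=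
      (((continuous_normFactor.mul_const _).pow 2).sub
        (continuous_const.mul (L.continuous.comp (continuous_actC Φ)))).add continuous_const
    have h3 := h2.tendsto g₀
    have h4 : (normFactor g₀ * ‖v‖) ^ 2 - 2 * L (actC g₀ Φ) + ‖actL g₀ v‖ ^ 2 = 0 := by
      rw [← norm_actL, ← hinner, real_inner_self_eq_norm_sq]; ring
    rw [h4] at h3
    refine h3.congr fun g => ?_
    rw [norm_sub_sq_real, hinner, norm_actL g]
  rw [tendsto_iff_norm_sub_tendsto_zero]
  have h5 := h1.sqrt
  simpa only [Real.sqrt_sq (norm_nonneg _), Real.sqrt_zero] using h5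

lemma continuous_actL (v : XL n) : Continuous fun g : SimGroup n p => actL g v := by
  refine continuous_iff_continuousAt.mpr fun g₀ => ?_
  rw [ContinuousAt, Metric.tendsto_nhds]
  intro ε hε
  have hM : 0 < normFactor g₀ + 1 := by linarith [normFactor_nonneg g₀]
  -- Near g₀ the action magnifies norms by less than this factor + 1, so the error of the compactly
  -- supported approximation stays within ε/3 at both g and g₀.
  have hδ : 0 < ε / (3 * (normFactor g₀ + 1)) := by positivity
  obtain ⟨φ, hφ2, hφε, hφ, hφm⟩ := (Lp.memLp v).exists_hasCompactSupport_eLpNorm_sub_le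
    (by simp) (ENNReal.ofReal_pos.mpr hδ).ne'
  have hd : ‖v - hφm.toLp φ‖ ≤ ε / (3 * (normFactor g₀ + 1)) := by
    have h1 : v - hφm.toLp φ = ((Lp.memLp v).sub hφm).toLp ((v : Eu n → ℝ) - φ) := by
      rw [MemLp.toLp_sub (Lp.memLp v) hφm, Lp.toLp_coeFn]
    rw [h1, Lp.norm_toLp]
    exact ENNReal.toReal_le_of_le_ofReal hδ.le hφε
  have e1 : ∀ᶠ g : SimGroup n p in 𝓝 g₀, normFactor g < normFactor g₀ + 1 :=
    continuous_normFactor.continuousAt.eventually_lt_const (lt_add_one _)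
  have e2 := Metric.tendsto_nhds.mp
    (tendsto_actL_of_hasCompactSupport g₀ hφ hφ2 hφm.coeFn_toLp) (ε / 3) (by positivity)
  have hb : ∀ g : SimGroup n p, normFactor g < normFactor g₀ + 1 →
      ‖actL g (v - hφm.toLp φ)‖ ≤ ε / 3 := by
    intro g hg
    rw [norm_actL]
    calc normFactor g * ‖v - hφm.toLp φ‖
        ≤ (normFactor g₀ + 1) * (ε / (3 * (normFactor g₀ + 1))) :=
          mul_le_mul hg.le hd (norm_nonneg _) hM.le
      _ = ε / 3 := by field_simp
  filter_upwards [e1, e2] with g hg1 hg2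
  rw [dist_eq_norm] at hg2 ⊢
  have h3 : actL g v - actL g₀ v = actL g (v - hφm.toLp φ) +
      (actL g (hφm.toLp φ) - actL g₀ (hφm.toLp φ)) - actL g₀ (v - hφm.toLp φ) := by
    rw [actL_sub, actL_sub]; abel
  rw [h3]
  have h4 := norm_sub_le (actL g (v - hφm.toLp φ) +
    (actL g (hφm.toLp φ) - actL g₀ (hφm.toLp φ))) (actL g₀ (v - hφm.toLp φ))
  have h5 := norm_add_le (actL g (v - hφm.toLp φ)) (actL g (hφm.toLp φ) - actL g₀ (hφm.toLp φ))
  linarith [hb g hg1, hb g₀ (lt_add_one _)]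

lemma locallyIntegrable_XL (v : XL n) : LocallyIntegrable v volume :=
  (Lp.memLp v).locallyIntegrable one_le_two

lemma isFunctionAction_actL :
    IsFunctionAction (actL (n := n) (p := p)) (fun v => (v : Eu n → ℝ)) where
  locallyIntegrable := locallyIntegrable_XL
  act_ae := coeFn_actL
  bound := ⟨normFactor, continuous_normFactor, fun g v => (norm_actL g v).le⟩
  continuous := continuous_actL
  pairing ψ hψ := by
    have hm : MemLp ψ 2 volume := hψ.1.continuous.memLp_of_hasCompactSupport hψ.2
    refine ⟨innerSL ℝ (hm.toLp ψ), fun v => ?_⟩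
    rw [innerSL_apply_apply, real_inner_comm, inner_eq_integral]
    exact integral_congr_ae ((EventuallyEq.refl _ _).mul hm.coeFn_toLp)
  separating v h := by
    refine (Lp.eq_zero_iff_ae_eq_zero).mpr ?_
    exact ae_eq_zero_of_integral_contDiff_smul_eq_zero (locallyIntegrable_XL v)
      fun ψ hψ hψ' => by simpa only [smul_eq_mul, mul_comm] using h ψ ⟨hψ, hψ'⟩

/-! ### Weak derivatives -/

/-- `w` is the weak derivative of `v` in the direction `y`. -/
def WeakDeriv (y : Eu n) (v w : XL n) : Prop :=
  ∀ φ : Eu n → ℝ, IsTest φ → ∫ x, v x * fderiv ℝ φ x y = -∫ x, w x * φ x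

lemma IsTest.fderiv_apply {φ : Eu n → ℝ} (hφ : IsTest φ) (y : Eu n) :
    IsTest fun x => fderiv ℝ φ x y :=
  ⟨(hφ.1.fderiv_right (m := ∞) (by simp)).clm_apply contDiff_const, hφ.2.fderiv_apply ℝ y⟩

lemma hasWeakPartial_iff {j : Fin (n + 1)} {v w : XL n} :
    HasWeakPartial j v w ↔ WeakDeriv (eb j) v w :=
  ⟨fun h φ hφ => h.2.2 φ hφ.1 hφ.2,
    fun h => ⟨locallyIntegrable_XL v, locallyIntegrable_XL w, fun φ h1 h2 => h φ ⟨h1, h2⟩⟩⟩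

lemma exists_pairing_L {ψ : Eu n → ℝ} (hψ : IsTest ψ) :
    ∃ L : XL n →L[ℝ] ℝ, ∀ v, L v = ∫ y, v y * ψ y :=
  -- The pairing does not involve the parameter of the group, so any value serves.
  (isFunctionAction_actL (p := 0)).pairing ψ hψ

lemma WeakDeriv.unique {y : Eu n} {v w w' : XL n} (h : WeakDeriv y v w) (h' : WeakDeriv y v w') :
    w = w' :=
  (isFunctionAction_actL (p := 0)).ext_pairing fun ψ hψ => by
    rw [← neg_inj, ← h ψ hψ, h' ψ hψ]

lemma WeakDeriv.sub {y : Eu n} {v v' w w' : XL n} (h : WeakDeriv y v w) (h' : WeakDeriv y v' w') :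
    WeakDeriv y (v - v') (w - w') := by
  intro φ hφ
  obtain ⟨L, hL⟩ := exists_pairing_L hφ
  obtain ⟨L', hL'⟩ := exists_pairing_L (hφ.fderiv_apply y)
  have h1 := h φ hφ
  have h2 := h' φ hφ
  rw [← hL, ← hL'] at h1 h2 ⊢
  rw [map_sub, map_sub, h1, h2]
  ring

lemma WeakDeriv.sum_smul {y : Eu n} {κ : Type*} {s : Finset κ} {v w : κ → XL n} (c : κ → ℝ)
    (h : ∀ i ∈ s, WeakDeriv y (v i) (w i)) :
    WeakDeriv y (∑ i ∈ s, c i • v i) (∑ i ∈ s, c i • w i) := by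
  intro φ hφ
  obtain ⟨L, hL⟩ := exists_pairing_L hφ
  obtain ⟨L', hL'⟩ := exists_pairing_L (hφ.fderiv_apply y)
  rw [← hL, ← hL', map_sum, map_sum, ← Finset.sum_neg_distrib]
  refine Finset.sum_congr rfl fun i hi => ?_
  rw [map_smul, map_smul, hL, hL', h i hi φ hφ, smul_neg]

/-- The derivative of the test function is linear in the direction. Arbitrary directions are needed
because the action rotates coordinate directions. -/
lemma weakDeriv_of_basis {v : XL n} {D : Fin (n + 1) → XL n}
    (h : ∀ j, WeakDeriv (eb j) v (D j)) (y : Eu n) : WeakDeriv y v (∑ j, y j • D j) := by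
  intro φ hφ
  obtain ⟨L, hL⟩ := exists_pairing_L hφ
  have hy : y = ∑ j, y j • (eb j : Eu n) := by
    ext i
    simp [Finset.sum_apply, Pi.single_apply]
  have h1 : ∀ x, v x * fderiv ℝ φ x y = ∑ j, y j * (v x * fderiv ℝ φ x (eb j)) := by
    intro x
    conv_lhs => rw [hy]
    rw [map_sum, Finset.mul_sum]
    refine Finset.sum_congr rfl fun j _ => ?_
    rw [map_smul, smul_eq_mul]
    ring
  have hi : ∀ j, Integrable fun x => y j * (v x * fderiv ℝ φ x (eb j)) := fun j =>
    (integrable_mul_of_hasCompactSupport (locallyIntegrable_XL v)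
      (hφ.fderiv_apply _).1.continuous (hφ.fderiv_apply _).2).const_mul _
  simp only [h1]
  rw [integral_finsetSum _ fun j _ => hi j, ← hL, map_sum, ← Finset.sum_neg_distrib]
  refine Finset.sum_congr rfl fun j _ => ?_
  rw [integral_const_mul, h j φ hφ, map_smul, hL, smul_eq_mul, mul_neg]

lemma coact_fderiv (g : SimGroup n p) {φ : Eu n → ℝ} (hφ : IsTest φ) (y z : Eu n) :
    coact g (fun x => fderiv ℝ φ x y) z = fderiv ℝ (coact g φ) z (g.lin y) := by
  rw [fderiv_coact g hφ, ContinuousLinearEquiv.symm_apply_apply, coact]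

/-- The weak chain rule by duality: the dual action turns the derivative of φ along y into the
derivative of `coact g φ` along `g.lin y`. -/
lemma WeakDeriv.act (g : SimGroup n p) {y : Eu n} {v w : XL n} (h : WeakDeriv (g.lin y) v w) :
    WeakDeriv y (actL g v) (actL g w) := by
  intro φ hφ
  rw [isFunctionAction_actL.pairing_act, isFunctionAction_actL.pairing_act]
  simp only [coact_fderiv g hφ]
  exact h _ (hφ.coact g)

/-- Weak derivatives in L² are unique, so the choice made in `wpd` is immaterial. -/
lemma HasWeakPartial.wpd_eq {j : Fin (n + 1)} {v w : XL n} (h : HasWeakPartial j v w) :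
    wpd j v = w := by
  have hex : ∃ w : XL n, HasWeakPartial j v w := ⟨w, h⟩
  rw [wpd, dif_pos hex]
  exact (hasWeakPartial_iff.mp hex.choose_spec).unique (hasWeakPartial_iff.mp h)

lemma WeakDeriv.wpd_eq {j : Fin (n + 1)} {v w : XL n} (h : WeakDeriv (eb j) v w) :
    wpd j v = w :=
  (hasWeakPartial_iff.mpr h).wpd_eq

lemma memH2_iff {v : XL n} : MemH2 v ↔
    (∀ i, WeakDeriv (eb i) v (wpd i v)) ∧
      ∀ i j, WeakDeriv (eb j) (wpd i v) (wpd j (wpd i v)) := by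
  constructor
  · rintro ⟨D, D2, h1, h2⟩
    have e1 : ∀ i, wpd i v = D i := fun i => (h1 i).wpd_eq
    refine ⟨fun i => ?_, fun i j => ?_⟩
    · rw [e1]; exact hasWeakPartial_iff.mp (h1 i)
    · rw [e1, (h2 i j).wpd_eq]; exact hasWeakPartial_iff.mp (h2 i j)
  · rintro ⟨h1, h2⟩
    exact ⟨fun i => wpd i v, fun i j => wpd j (wpd i v), fun i => hasWeakPartial_iff.mpr (h1 i),
      fun i j => hasWeakPartial_iff.mpr (h2 i j)⟩

lemma MemH2.weakDeriv {v : XL n} (hv : MemH2 v) (i : Fin (n + 1)) :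
    WeakDeriv (eb i) v (wpd i v) := (memH2_iff.mp hv).1 i

lemma MemH2.weakDeriv_wpd {v : XL n} (hv : MemH2 v) (i j : Fin (n + 1)) :
    WeakDeriv (eb j) (wpd i v) (wpd j (wpd i v)) := (memH2_iff.mp hv).2 i j

lemma MemH2.wpd_sub {v w : XL n} (hv : MemH2 v) (hw : MemH2 w) (i : Fin (n + 1)) :
    wpd i (v - w) = wpd i v - wpd i w := ((hv.weakDeriv i).sub (hw.weakDeriv i)).wpd_eq

lemma MemH2.wpd_wpd_sub {v w : XL n} (hv : MemH2 v) (hw : MemH2 w) (i j : Fin (n + 1)) :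
    wpd j (wpd i (v - w)) = wpd j (wpd i v) - wpd j (wpd i w) := by
  rw [hv.wpd_sub hw]
  exact ((hv.weakDeriv_wpd i j).sub (hw.weakDeriv_wpd i j)).wpd_eq

lemma MemH2.weakDeriv_actL (g : SimGroup n p) {v : XL n} (hv : MemH2 v) (i : Fin (n + 1)) :
    WeakDeriv (eb i) (actL g v) (∑ k, g.lin (eb i) k • actL g (wpd k v)) := by
  have h := (weakDeriv_of_basis hv.weakDeriv (g.lin (eb i))).act g
  have e : actL g (∑ k, g.lin (eb i) k • wpd k v) =
      ∑ k, g.lin (eb i) k • actL g (wpd k v) := by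
    rw [isFunctionAction_actL.act_sum]
    exact Finset.sum_congr rfl fun k _ => isFunctionAction_actL.act_smul g _ _
  rwa [e] at h

lemma MemH2.weakDeriv_wpd_actL (g : SimGroup n p) {v : XL n} (hv : MemH2 v)
    (i j : Fin (n + 1)) :
    WeakDeriv (eb j) (∑ k, g.lin (eb i) k • actL g (wpd k v))
      (∑ k, g.lin (eb i) k • ∑ l, g.lin (eb j) l • actL g (wpd l (wpd k v))) := by
  refine WeakDeriv.sum_smul _ fun k _ => ?_
  have h := (weakDeriv_of_basis (hv.weakDeriv_wpd k) (g.lin (eb j))).act g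
  have e : actL g (∑ l, g.lin (eb j) l • wpd l (wpd k v)) =
      ∑ l, g.lin (eb j) l • actL g (wpd l (wpd k v)) := by
    rw [isFunctionAction_actL.act_sum]
    exact Finset.sum_congr rfl fun k _ => isFunctionAction_actL.act_smul g _ _
  rwa [e] at h

lemma MemH2.wpd_actL (g : SimGroup n p) {v : XL n} (hv : MemH2 v) (i : Fin (n + 1)) :
    wpd i (actL g v) = ∑ k, g.lin (eb i) k • actL g (wpd k v) := (hv.weakDeriv_actL g i).wpd_eq

lemma MemH2.wpd_wpd_actL (g : SimGroup n p) {v : XL n} (hv : MemH2 v) (i j : Fin (n + 1)) :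
    wpd j (wpd i (actL g v)) =
      ∑ k, g.lin (eb i) k • ∑ l, g.lin (eb j) l • actL g (wpd l (wpd k v)) := by
  rw [hv.wpd_actL]
  exact (hv.weakDeriv_wpd_actL g i j).wpd_eq

lemma MemH2.act (g : SimGroup n p) {v : XL n} (hv : MemH2 v) : MemH2 (actL g v) :=
  ⟨_, _, fun i => hasWeakPartial_iff.mpr (hv.weakDeriv_actL g i),
    fun i j => hasWeakPartial_iff.mpr (hv.weakDeriv_wpd_actL g i j)⟩

/-! ### The norm of `H²` -/

lemma norm_le_normH2 (v : XL n) : ‖v‖ ≤ normH2 v :=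
  Real.le_sqrt_of_sq_le (by
    have h1 : 0 ≤ ∑ i, ‖wpd i v‖ ^ 2 := Finset.sum_nonneg fun _ _ => sq_nonneg _
    have h2 : 0 ≤ ∑ i, ∑ j, ‖wpd j (wpd i v)‖ ^ 2 :=
      Finset.sum_nonneg fun _ _ => Finset.sum_nonneg fun _ _ => sq_nonneg _
    linarith)

lemma norm_wpd_le_normH2 (v : XL n) (i : Fin (n + 1)) : ‖wpd i v‖ ≤ normH2 v :=
  Real.le_sqrt_of_sq_le (by
    have h1 : ‖wpd i v‖ ^ 2 ≤ ∑ i, ‖wpd i v‖ ^ 2 :=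
      Finset.single_le_sum (f := fun i => ‖wpd i v‖ ^ 2) (fun _ _ => sq_nonneg _)
        (Finset.mem_univ i)
    have h2 : 0 ≤ ∑ i, ∑ j, ‖wpd j (wpd i v)‖ ^ 2 :=
      Finset.sum_nonneg fun _ _ => Finset.sum_nonneg fun _ _ => sq_nonneg _
    linarith [sq_nonneg ‖v‖])

lemma norm_wpd_wpd_le_normH2 (v : XL n) (i j : Fin (n + 1)) : ‖wpd j (wpd i v)‖ ≤ normH2 v :=
  Real.le_sqrt_of_sq_le (by
    have h1 : 0 ≤ ∑ i, ‖wpd i v‖ ^ 2 := Finset.sum_nonneg fun _ _ => sq_nonneg _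
    have h2 : ‖wpd j (wpd i v)‖ ^ 2 ≤ ∑ i, ∑ j, ‖wpd j (wpd i v)‖ ^ 2 :=
      (Finset.single_le_sum (f := fun j => ‖wpd j (wpd i v)‖ ^ 2) (fun _ _ => sq_nonneg _)
        (Finset.mem_univ j)).trans
      (Finset.single_le_sum (f := fun i => ∑ j, ‖wpd j (wpd i v)‖ ^ 2)
        (fun _ _ => Finset.sum_nonneg fun _ _ => sq_nonneg _) (Finset.mem_univ i))
    linarith [sq_nonneg ‖v‖])

lemma tendsto_lin_entry {l : Filter ℝ} {γ : ℝ → SimGroup n p} {γ₀ : SimGroup n p}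
    (hγ : Tendsto γ l (𝓝 γ₀)) (i k : Fin (n + 1)) :
    Tendsto (fun a => (γ a).lin (eb i) k) l (𝓝 (γ₀.lin (eb i) k)) := by
  have h : Continuous fun g : SimGroup n p => g.lin (eb i) k :=
    (EuclideanSpace.proj k : Eu n →L[ℝ] ℝ).continuous.comp
      (continuous_lin_comp continuous_id continuous_const)
  exact (h.tendsto γ₀).comp hγ

/-- Derivatives of a(γ)u are finite sums of a(γ) applied to derivatives of u, with coefficients
continuous in γ. Joint continuity of the action on L² then applies to each term. -/
lemma tendsto_normH2_actL {l : Filter ℝ} {γ : ℝ → SimGroup n p} {γ₀ : SimGroup n p}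
    {u : ℝ → XL n} {u₀ : XL n} (hu₀ : MemH2 u₀) (hu : ∀ᶠ i in l, MemH2 (u i))
    (hγ : Tendsto γ l (𝓝 γ₀)) (h : Tendsto (fun i => normH2 (u i - u₀)) l (𝓝 0)) :
    Tendsto (fun i => normH2 (actL (γ i) (u i) - actL γ₀ u₀)) l (𝓝 0) := by
  have h0 : Tendsto u l (𝓝 u₀) := by
    rw [← tendsto_sub_nhds_zero_iff]
    exact squeeze_zero_norm (fun i => norm_le_normH2 _) h
  have h1 : ∀ k, Tendsto (fun a => wpd k (u a)) l (𝓝 (wpd k u₀)) := by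
    intro k
    rw [← tendsto_sub_nhds_zero_iff]
    refine squeeze_zero_norm' (hu.mono fun a ha => ?_) h
    rw [← ha.wpd_sub hu₀]
    exact norm_wpd_le_normH2 _ _
  have h2 : ∀ k l', Tendsto (fun a => wpd l' (wpd k (u a))) l (𝓝 (wpd l' (wpd k u₀))) := by
    intro k l'
    rw [← tendsto_sub_nhds_zero_iff]
    refine squeeze_zero_norm' (hu.mono fun a ha => ?_) h
    rw [← ha.wpd_wpd_sub hu₀]
    exact norm_wpd_wpd_le_normH2 _ _ _
  have k0 : Tendsto (fun a => ‖actL (γ a) (u a) - actL γ₀ u₀‖ ^ 2) l (𝓝 0) := by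
    have := (tendsto_sub_nhds_zero_iff.mpr (isFunctionAction_actL.tendsto_act hγ h0)).norm.pow 2
    simpa using this
  have k1 : ∀ i, Tendsto (fun a => ‖wpd i (actL (γ a) (u a) - actL γ₀ u₀)‖ ^ 2) l (𝓝 0) := by
    intro i
    have h3 : Tendsto (fun a => ∑ k, (γ a).lin (eb i) k • actL (γ a) (wpd k (u a))) l
        (𝓝 (∑ k, γ₀.lin (eb i) k • actL γ₀ (wpd k u₀))) :=
      tendsto_finsetSum _ fun k _ => (tendsto_lin_entry hγ i k).smul
        (isFunctionAction_actL.tendsto_act hγ (h1 k))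
    have h4 := (tendsto_sub_nhds_zero_iff.mpr h3).norm.pow 2
    rw [norm_zero, zero_pow two_ne_zero] at h4
    refine h4.congr' (hu.mono fun a ha => ?_)
    beta_reduce
    rw [(ha.act (γ a)).wpd_sub (hu₀.act γ₀), ha.wpd_actL, hu₀.wpd_actL]
  have k2 : ∀ i j, Tendsto (fun a => ‖wpd j (wpd i (actL (γ a) (u a) - actL γ₀ u₀))‖ ^ 2) l
      (𝓝 0) := by
    intro i j
    have h3 : Tendsto (fun a => ∑ k, (γ a).lin (eb i) k •
        ∑ l', (γ a).lin (eb j) l' • actL (γ a) (wpd l' (wpd k (u a)))) l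
        (𝓝 (∑ k, γ₀.lin (eb i) k • ∑ l', γ₀.lin (eb j) l' • actL γ₀ (wpd l' (wpd k u₀)))) :=
      tendsto_finsetSum _ fun k _ => (tendsto_lin_entry hγ i k).smul
        (tendsto_finsetSum _ fun l' _ => (tendsto_lin_entry hγ j l').smul
          (isFunctionAction_actL.tendsto_act hγ (h2 k l')))
    have h4 := (tendsto_sub_nhds_zero_iff.mpr h3).norm.pow 2
    rw [norm_zero, zero_pow two_ne_zero] at h4
    refine h4.congr' (hu.mono fun a ha => ?_)
    beta_reduce
    rw [(ha.act (γ a)).wpd_wpd_sub (hu₀.act γ₀), ha.wpd_wpd_actL, hu₀.wpd_wpd_actL]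
  have h5 := ((k0.add (tendsto_finsetSum Finset.univ fun i _ => k1 i)).add
    (tendsto_finsetSum Finset.univ fun i _ => tendsto_finsetSum Finset.univ fun j _ =>
      k2 i j)).sqrt
  simp only [Finset.sum_const_zero, add_zero, Real.sqrt_zero] at h5
  exact h5

/-! ### Equivariance of the vector field in `L²` -/

/-- The rows of the matrix of a similarity are orthogonal with equal norms; this removes the mixed
second derivatives from the transformed Laplacian. -/
lemma sum_lin_mul_lin (g : SimGroup n p) (k l : Fin (n + 1)) :
    ∑ i, g.lin (eb i) k * g.lin (eb i) l = if k = l then (g.scale ^ (1 - p)) ^ 2 else 0 := by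
  have h1 : ∀ i j : Fin (n + 1), g.lin (eb i) j = g.scale ^ (1 - p) * g.aQinv j i := by
    intro i j
    rw [lin_apply, PiLp.smul_apply, smul_eq_mul, opr, Matrix.ofLp_toEuclideanCLM]
    simp [Matrix.mulVec_single]
  have h2 : g.aQinv * g.aQinv.transpose = 1 := by
    rw [← Matrix.conjTranspose_eq_transpose_of_trivial, ← Matrix.star_eq_conjTranspose,
      star_aQinv, aQinv_mul_aQ]
  have h3 := congrFun (congrFun h2 k) l
  rw [Matrix.mul_apply, Matrix.one_apply] at h3
  simp only [Matrix.transpose_apply] at h3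
  simp only [h1]
  calc ∑ i, g.scale ^ (1 - p) * g.aQinv k i * (g.scale ^ (1 - p) * g.aQinv l i)
      = (g.scale ^ (1 - p)) ^ 2 * ∑ i, g.aQinv k i * g.aQinv l i := by
        rw [Finset.mul_sum]
        exact Finset.sum_congr rfl fun i _ => by ring
    _ = _ := by rw [h3]; split_ifs <;> simp

lemma MemH2.sum_wpd_wpd_actL (g : SimGroup n p) {v : XL n} (hv : MemH2 v) :
    ∑ i, wpd i (wpd i (actL g v)) =
      (g.scale ^ (1 - p)) ^ 2 • actL g (∑ i, wpd i (wpd i v)) := by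
  simp only [hv.wpd_wpd_actL, Finset.smul_sum, smul_smul]
  rw [Finset.sum_comm, isFunctionAction_actL.act_sum, Finset.smul_sum]
  refine Finset.sum_congr rfl fun k _ => ?_
  rw [Finset.sum_comm]
  simp only [← Finset.sum_smul, sum_lin_mul_lin, ite_smul, zero_smul, Finset.sum_ite_eq,
    Finset.mem_univ, if_true]

/-- Stated for functions rather than L² classes, since |v|^p and its weak derivative are only known
to be locally integrable. -/
lemma HasWeakPartial.const_mul_actFun {w h : Eu n → ℝ} (g : SimGroup n p) (c : ℝ)
    (hw : HasWeakPartial 0 w h) :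
    HasWeakPartial 0 (fun x => c * g.actFun w x)
      (fun x => c * g.scale ^ (1 - p) * g.actFun h x) := by
  refine ⟨(locallyIntegrable_actFun g hw.1).smul c,
    (locallyIntegrable_actFun g hw.2.1).smul (c * g.scale ^ (1 - p)), fun φ h1 h2 => ?_⟩
  have hφ : IsTest φ := ⟨h1, h2⟩
  have h3 := hw.2.2 _ (hφ.coact g).1 (hφ.coact g).2
  simp only [mul_assoc, integral_const_mul]
  rw [integral_actFun_mul g w fun x => fderiv ℝ φ x (eb 0), integral_actFun_mul g h φ]
  simp only [coact_fderiv g hφ, lin_eb_zero, map_smul, smul_eq_mul, mul_left_comm _ (g.scale ^ (1 - p))]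
  rw [integral_const_mul, h3]
  ring

lemma HasWeakPartial.congr_ae {j : Fin (n + 1)} {v v' w : Eu n → ℝ} (h : HasWeakPartial j v w)
    (hv : v =ᵐ[volume] v') : HasWeakPartial j v' w :=
  ⟨h.1.congr hv, h.2.1, fun φ h1 h2 => by
    rw [← h.2.2 φ h1 h2]
    exact integral_congr_ae (hv.symm.mul (EventuallyEq.refl _ _))⟩

lemma scale_rpow_one_sub_mul_inv (g : SimGroup n p) :
    g.scale ^ (1 - p) * g.scale⁻¹ = g.scale ^ (-p) := by
  rw [← Real.rpow_neg_one, ← Real.rpow_add g.scale_pos]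
  congr 1
  ring

lemma isFL_actL {ν s : ℝ} (g : SimGroup n p) {v f : XL n} (hv : MemH2 v) (h : IsFL p ν s v f) :
    IsFL p ν s (actL g v) (mfac g • actL g f) := by
  obtain ⟨w, hw, hf⟩ := h
  -- The constant comes from |a(g)v|^p = α^(1-p) a(g)(|v|^p), the action itself supplying the
  -- remaining α⁻¹.
  refine ⟨_, (hw.const_mul_actFun g (g.scale ^ (1 - p))).congr_ae ?_, ?_⟩
  · filter_upwards [coeFn_actL g v] with x hx
    rw [hx, abs_actFun_rpow, actFun, ← mul_assoc, scale_rpow_one_sub_mul_inv]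
  · have e1 := Lp.coeFn_finsetSum Finset.univ fun i => wpd i (wpd i (actL g v))
    have e2 := Lp.coeFn_finsetSum Finset.univ fun i => wpd i (wpd i v)
    rw [hv.sum_wpd_wpd_actL] at e1
    filter_upwards [e1, actFun_congr_ae g e2, Lp.coeFn_smul (mfac g) (actL g f),
      Lp.coeFn_smul ((g.scale ^ (1 - p)) ^ 2) (actL g (∑ i, wpd i (wpd i v))), coeFn_actL g f,
      coeFn_actL g (∑ i, wpd i (wpd i v)), actFun_congr_ae g hf] with x h1 h2 h3 h4 h5 h6 h7
    rw [h3, Pi.smul_apply, smul_eq_mul, h5, h7]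
    have h8 : ∑ i, wpd i (wpd i (actL g v)) x = (g.scale ^ (1 - p)) ^ 2 *
        (g.scale⁻¹ * ∑ i, wpd i (wpd i v) (g.pull x)) := by
      rw [← Finset.sum_apply, ← h1, h4, Pi.smul_apply, smul_eq_mul, h6, h2, actFun,
        Finset.sum_apply]
    rw [h8, actFun, actFun, ← mul_assoc, mfac_mul_scale_inv]
    ring

theorem isEquivariantSetting_L (ν s : ℝ) :
    IsEquivariantSetting (actL (n := n) (p := p)) (fun v => (v : Eu n → ℝ)) MemH2 normH2
      (IsFL p ν s) where
  toIsFunctionAction := isFunctionAction_actL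
  normY_nonneg _ := Real.sqrt_nonneg _
  mem_act g _ hv := hv.act g
  norm_tendsto _ _ _ _ _ hu₀ hu hγ h := tendsto_normH2_actL hu₀ hu hγ h
  isF_act g _ _ hv h := isFL_actL g hv h

/-! ### Restriction to subintervals and conclusion -/

lemma IsC1With.mono {X : Type} [NormedAddCommGroup X] [NormedSpace ℝ X] {f f' : ℝ → X}
    {J K : Set ℝ} (h : IsC1With f f' J) (hK : K ⊆ J) : IsC1With f f' K :=
  ⟨fun t ht => (h.1 t (hK ht)).mono hK, h.2.mono hK⟩

lemma SolvesGroupODE.mono {μ : ℝ → SimAlg n} {g : ℝ → SimGroup n p} {J K : Set ℝ}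
    (h : SolvesGroupODE μ g J) (hK : K ⊆ J) : SolvesGroupODE μ g K :=
  ⟨h.1, h.2.1.mono hK, fun i j => (h.2.2.1 i j).mono hK, h.2.2.2.mono hK⟩

end BurgersFreezing
end

open BurgersFreezing in
theorem theorem3p2 (n : ℕ) (p ν s : ℝ) (hp : 1 < p) (hν : 0 < ν) (hs : s = 1 ∨ s = -1)
    (That : EReal) (hT : 0 < That) (μ : ℝ → SimAlg n) (hμ : ContinuousOn μ (tI That)) :
    ∃ g : ℝ → SimGroup n p,
      -- `g` is a solution on `[0, That)`, and every solution is a restriction of it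
      SolvesGroupODE μ g (tI That) ∧
      (∀ (J : Set ℝ) (h : ℝ → SimGroup n p), IsInitialInterval J → J ⊆ tI That →
        SolvesGroupODE μ h J → EqOn h g J) ∧
      ∃ (T : EReal) (σ ρ : ℝ → ℝ), 0 < T ∧
        -- `σ` is a solution on `[0, T)`, and every solution is a restriction of it
        SolvesTimeODE That g σ (tI T) ∧
        (∀ (J : Set ℝ) (θ : ℝ → ℝ), IsInitialInterval J →
          SolvesTimeODE That g θ J → J ⊆ tI T ∧ EqOn θ σ J) ∧
        -- `σ` is a diffeomorphism from `[0, T)` onto `[0, That)` with inverse `ρ`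
        BijOn σ (tI T) (tI That) ∧ InvOn ρ σ (tI T) (tI That) ∧
        ContDiffOn ℝ 1 σ (tI T) ∧ ContDiffOn ℝ 1 ρ (tI That) ∧
        -- the case `X = C₀⁰`, `Y₁ = C²_scal`
        (∀ u₀ : XC n, MemScal (actC (p := p)) MemC2 u₀ →
          (∀ u : ℝ → XC n,
            SolvesOriginal (actC (p := p)) MemC2 normC2 (IsFC p ν s) u₀ T u →
            SolvesComoving (actC (p := p)) MemC2 normC2 (IsFC p ν s) μ u₀ That
              (fun τ => actC (g τ)⁻¹ (u (ρ τ)))) ∧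
          (∀ v : ℝ → XC n,
            SolvesComoving (actC (p := p)) MemC2 normC2 (IsFC p ν s) μ u₀ That v →
            SolvesOriginal (actC (p := p)) MemC2 normC2 (IsFC p ν s) u₀ T
              (fun t => actC (g (σ t)) (v (σ t))))) ∧
        -- the case `X = L²`, `Y₁ = H²_scal`
        (∀ u₀ : XL n, MemScal (actL (p := p)) MemH2 u₀ →
          (∀ u : ℝ → XL n,
            SolvesOriginal (actL (p := p)) MemH2 normH2 (IsFL p ν s) u₀ T u →
            SolvesComoving (actL (p := p)) MemH2 normH2 (IsFL p ν s) μ u₀ That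
              (fun τ => actL (g τ)⁻¹ (u (ρ τ)))) ∧
          (∀ v : ℝ → XL n,
            SolvesComoving (actL (p := p)) MemH2 normH2 (IsFL p ν s) μ u₀ That v →
            SolvesOriginal (actL (p := p)) MemH2 normH2 (IsFL p ν s) u₀ T
              (fun t => actL (g (σ t)) (v (σ t))))) := by
  obtain ⟨g, hg⟩ := exists_solvesGroupODE (p := p) μ hμ
  obtain ⟨T, σ, ρ, hT0, hρ0, hσ, huniq, hbij, hinv, hσc, hρc, hρ⟩ :=
    exists_solvesTimeODE hT hg.continuousOn
  have hρm : MapsTo ρ (tI That) (tI T) := by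
    intro τ hτ
    obtain ⟨t, ht, rfl⟩ := hbij.surjOn hτ
    rwa [hinv.1 ht]
  exact ⟨g, hg, fun J h hJ hJT hh => SolvesGroupODE.unique hJ (hg.mono hJT) hh, T, σ, ρ, hT0, hσ,
    huniq, hbij, hinv, hσc, hρc,
    fun u₀ _ => ⟨fun u hu => (isEquivariantSetting_C ν s).solvesComoving hμ hg hρ0 hρm hρ hu,
      fun v hv => (isEquivariantSetting_C ν s).solvesOriginal hμ hg hσ hv⟩,
    fun u₀ _ => ⟨fun u hu => (isEquivariantSetting_L ν s).solvesComoving hμ hg hρ0 hρm hρ hu,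
      fun v hv => (isEquivariantSetting_L ν s).solvesOriginal hμ hg hσ hv⟩⟩
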